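/- Let $M$ be a smooth manifold of dimension $n+1$ and let $\pi : M\to\mathbb R$ be a fibration (a smooth surjective submersion). Put $\eta=\pi^*(dt)$, let $J^1\pi=\{v\in TM : \eta(v)=1\}$ be the space of $1$-jets of local sections of $\pi$, $V\pi=\ker\eta$, $V^*\pi$ the dual bundle of $V\pi$, $\mu:T^*M\to V^*\pi$ the restriction of covectors to $V\pi$, $\pi_1:J^1\pi\to\mathbb R$ and $\pi_1^*:V^*\pi\to\mathbb R$ the projections, $\eta_1=(\pi_1)^*(dt)$, $\eta_1^*=(\pi_1^*)^*(dt)$, and let $J^1\pi_1^*=\{X\in T(V^*\pi) : \eta_1^*(X)=1\}$ be the space of $1$-jets of local sections of $\pi_1^*$. * Let $A_M:T(T^*M)\to T^*(TM)$, $(q,p;\dot q,\dot p)\mapsto(q,\dot q;\dot p,p)$, be the Tulczyjew diffeomorphism. The map $\psi:T^*(J^1\pi)\to J^1\pi_1^*$, $\psi(\alpha_v)=T\mu(A_M^{-1}(\tilde\alpha_v))$, where $\tilde\alpha_v\in T^*_v(TM)$ is any extension of $\alpha_v$, induces a diffeomorphism $T^*(J^1\pi)/\langle\eta_1\rangle\to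 J^1\pi_1^*$, whose inverse is denoted by $A_\pi$. * $J^1\pi_1^*$ carries the Poisson structure $\Lambda_{J^1\pi_1^*}$ obtained by restricting to $J^1\pi_1^*\subset T(V^*\pi)$ the complete lift of the canonical Poisson structure $\frac{\partial}{\partial q^i}\wedge\frac{\partial}{\partial p_i}$ of $V^*\pi$; in coordinates $(t,q^i,p_i;\dot q^i,\dot p_i)$ it is $\frac{\partial}{\partial q^i}\wedge\frac{\partial}{\partial \dot p_i}+\frac{\partial}{\partial \dot q^i}\wedge\frac{\partial}{\partial p_i}$. * A submanifold $C$ of a Poisson manifold $(N,\Lambda)$ is Lagrangian if, for all $x\in C$, $\Lambda(\alpha,\beta)=0$ whenever $\Lambda^\sharp(\alpha),\Lambda^\sharp(\beta)\in T_xC$, and $\dim(T_xC\cap\Lambda^\sharp(T_x^*N))=\frac12\dim\Lambda^\sharp(T^*_xN)$. Let $L:J^1\pi\to\mathbb R$ be a smooth Lagrangian function, $\mathrm{Leg}_L:J^1\pi\to T^*M$ its extended Legendre transformation, $$\mathrm{Leg}_L(v)(X)=L(v)\,\eta(X)+\tfrac{d}{ds}\big|_{s=0}L\big(v+s(X-\eta(X)v)\big),$$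 and $\mathrm{leg}_L=\mu\circ\mathrm{Leg}_L:J^1\pi\to V^*\pi$. Assume that $L$ is hyperregular, i.e. that $\mathrm{leg}_L$ is a diffeomorphism, and let $h=\mathrm{Leg}_L\circ\mathrm{leg}_L^{-1}:V^*\pi\to T^*M$ be the associated Hamiltonian section. Let $\widetilde{dL}:J^1\pi\to T^*(J^1\pi)/\langle\eta_1\rangle$ be the section induced by $dL$, and let $R_h$ be the Reeb vector field on $V^*\pi$, determined by $\iota_{R_h}(h^*\Omega_M)=0$ and $\eta_1^*(R_h)=1$, where $\Omega_M$ is the canonical symplectic form of $T^*M$. Theorem. The sets $$S_L=A_\pi^{-1}(\widetilde{dL}(J^1\pi))\qquad\text{and}\qquad S_h=R_h(V^*\pi)$$ are Lagrangian submanifolds of the Poisson manifold $(J^1\pi_1^*,\Lambda_{J^1\pi_1^*})$, and they coincide: $S_L=S_h$. -/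

import Mathlib

open Set Module
open scoped Manifold ContDiff Topology

noncomputable section

namespace TimeMech

/-- A fibration `π : M → ℝ`: a smooth surjective submersion. -/
class IsFibration (E : Type*) [NormedAddCommGroup E] [NormedSpace ℝ E]
    {M : Type*} [TopologicalSpace M] [ChartedSpace E M] (π : M → ℝ) : Prop where
  surjective : Function.Surjective π
  isSubmersion : Manifold.IsSubmersion 𝓘(ℝ, E) 𝓘(ℝ, ℝ) ∞ π

/-- The model `ℝⁿ` of the fibres of a fibration over `ℝ` of an `(n+1)`-dimensional manifold. -/
abbrev Fib (E : Type*) [NormedAddCommGroup E] [NormedSpace ℝ E] : Type :=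
  Fin (finrank ℝ E - 1) → ℝ

section Charts

variable {E : Type*} [NormedAddCommGroup E] [NormedSpace ℝ E]
  {M : Type*} [TopologicalSpace M] [ChartedSpace E M]

/-- Local coordinates `(t, qⁱ)` on `M` adapted to `π`: a smooth chart whose first component
is `π`. -/
structure FibredChart (E : Type*) [NormedAddCommGroup E] [NormedSpace ℝ E]
    {M : Type*} [TopologicalSpace M] [ChartedSpace E M] (π : M → ℝ) where
  chart : OpenPartialHomeomorph M (ℝ × Fib E)
  contMDiffOn : ContMDiffOn 𝓘(ℝ, E) 𝓘(ℝ, ℝ × Fib E) ∞ chart chart.source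
  contMDiffOn_symm : ContMDiffOn 𝓘(ℝ, ℝ × Fib E) 𝓘(ℝ, E) ∞ chart.symm chart.target
  fst_eq : ∀ x ∈ chart.source, (chart x).1 = π x

variable (π : M → ℝ)

/-- Fibred charts exist around every point. -/
theorem exists_fibredChart [FiniteDimensional ℝ E] [IsManifold 𝓘(ℝ, E) ∞ M] [IsFibration E π]
    (x : M) : ∃ ψ : FibredChart E π, x ∈ ψ.chart.source := by
  have h := (IsFibration.isSubmersion (E := E) (π := π)).isSubmersionAt x
  have : FiniteDimensional ℝ (ℝ × h.complement) := h.equiv.toLinearEquiv.finiteDimensional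
  have : FiniteDimensional ℝ h.complement :=
    FiniteDimensional.of_surjective (LinearMap.snd ℝ ℝ h.complement) LinearMap.snd_surjective
  have hd : finrank ℝ h.complement = finrank ℝ (Fib E) := by
    have h1 := h.equiv.toLinearEquiv.finrank_eq
    rw [Module.finrank_prod, Module.finrank_self] at h1
    rw [Module.finrank_fin_fun]
    omega
  let e : h.complement ≃L[ℝ] Fib E := ContinuousLinearEquiv.ofFinrankEq hd
  let A : E ≃L[ℝ] ℝ × Fib E := h.equiv.trans ((ContinuousLinearEquiv.refl ℝ ℝ).prodCongr e)
  let c := h.codChart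
  let φ := h.domChart
  let B : OpenPartialHomeomorph (ℝ × Fib E) (ℝ × Fib E) :=
    c.symm.prod (OpenPartialHomeomorph.refl (Fib E))
  let Ψ : OpenPartialHomeomorph M (ℝ × Fib E) :=
    (φ.trans A.toHomeomorph.toOpenPartialHomeomorph).trans B
  have key : ∀ y ∈ φ.source, (A (φ y)).1 = c (π y) := by
    intro y hy
    have := h.writtenInCharts
      (show φ y ∈ (φ.extend 𝓘(ℝ, E)).target by simpa using φ.map_source hy)
    simp only [Function.comp_apply, OpenPartialHomeomorph.extend_coe,
      OpenPartialHomeomorph.extend_coe_symm, modelWithCornersSelf_coe, id,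
      modelWithCornersSelf_coe_symm] at this
    rw [show h.domChart.symm (φ y) = y from φ.left_inv hy] at this
    exact this.symm
  have hsrc : ∀ y ∈ φ.source, π y ∈ c.source := fun y hy ↦ h.source_subset_preimage_source hy
  have hΨs : Ψ.source = φ.source := by
    ext y
    simp only [Ψ, B, OpenPartialHomeomorph.trans_source, OpenPartialHomeomorph.prod_source]
    simp
    intro hy
    rw [key y hy]
    exact c.map_source (hsrc y hy)
  have hc := h.codChart_mem_maximalAtlas
  have hφ := h.domChart_mem_maximalAtlas
  have hcs := contMDiffOn_symm_of_mem_maximalAtlas hc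
  have hco := contMDiffOn_of_mem_maximalAtlas hc
  have hφs := contMDiffOn_symm_of_mem_maximalAtlas hφ
  have hφo := contMDiffOn_of_mem_maximalAtlas hφ
  have hB : ContDiffOn ℝ ∞ B B.source := by
    have : ContDiffOn ℝ ∞ c.symm c.target := contMDiffOn_iff_contDiffOn.1 hcs
    have h1 := (this.comp (contDiffOn_fst (F := Fib E) (s := B.source))
      (fun p hp ↦ by simpa [B] using hp)).prodMk (contDiffOn_snd (s := B.source))
    exact h1
  have hBs : ContDiffOn ℝ ∞ B.symm B.target := by
    have : ContDiffOn ℝ ∞ c c.source := contMDiffOn_iff_contDiffOn.1 hco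
    have h1 := (this.comp (contDiffOn_fst (F := Fib E) (s := B.target))
      (fun p hp ↦ by simpa [B] using hp)).prodMk (contDiffOn_snd (s := B.target))
    exact h1
  refine ⟨⟨Ψ, ?_, ?_, ?_⟩, ?_⟩
  · have h1 : ContMDiffOn 𝓘(ℝ, E) 𝓘(ℝ, ℝ × Fib E) ∞ (A ∘ φ) φ.source :=
      A.contDiff.contMDiff.comp_contMDiffOn hφo
    refine (contMDiffOn_iff_contDiffOn.2 hB).comp (h1.mono hΨs.subset) ?_
    intro y hy
    exact hy.2
  · have h1 : ContMDiffOn 𝓘(ℝ, ℝ × Fib E) 𝓘(ℝ, ℝ × Fib E) ∞ B.symm Ψ.target :=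
      (contMDiffOn_iff_contDiffOn.2 hBs).mono (fun y hy ↦ hy.1)
    have h2 : ContMDiffOn 𝓘(ℝ, ℝ × Fib E) 𝓘(ℝ, E) ∞ (A.symm ∘ B.symm) Ψ.target :=
      A.symm.contDiff.contMDiff.comp_contMDiffOn h1
    refine hφs.comp h2 ?_
    intro y hy
    exact hy.2.2
  · intro y hy
    have hy' : y ∈ φ.source := hΨs ▸ hy
    change c.symm (A (φ y)).1 = π y
    rw [key y hy']
    exact c.left_inv (hsrc y hy')
  · rw [hΨs]; exact h.mem_domChart_source

end Charts

section Clock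

variable (E : Type*) [NormedAddCommGroup E] [NormedSpace ℝ E]
  {M : Type*} [TopologicalSpace M] [ChartedSpace E M] (π : M → ℝ)

/-- The `1`-form `η = π^*(dt)` on `M`. -/
def clock (x : M) : TangentSpace 𝓘(ℝ, E) x →L[ℝ] ℝ := mfderiv 𝓘(ℝ, E) 𝓘(ℝ, ℝ) π x

/-- The space `J¹π = {v ∈ TM | η(v) = 1}` of `1`-jets of local sections of `π`. -/
def Jet : Type _ := {v : TangentBundle 𝓘(ℝ, E) M // clock E π v.proj v.2 = 1}

/-- The fibre `V_xπ = {v ∈ T_xM | η(v) = 0}` of the vertical bundle. -/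
abbrev Vert (x : M) : Submodule ℝ (TangentSpace 𝓘(ℝ, E) x) := (clock E π x).ker

/-- The dual bundle `V^*π` of the vertical bundle `Vπ`: a point is a linear form on some `V_xπ`. -/
structure VDual where
  base : M
  form : Vert E π base →L[ℝ] ℝ

end Clock

section Tangent

variable {E : Type*} [NormedAddCommGroup E] [NormedSpace ℝ E]
  {M : Type*} [TopologicalSpace M] [ChartedSpace E M] {π : M → ℝ}

namespace FibredChart

variable (ψ ψ' : FibredChart E π)

/-- The tangent map `T_xM → ℝ × ℝⁿ` of a fibred chart. -/
def d (x : M) : TangentSpace 𝓘(ℝ, E) x →L[ℝ] ℝ × Fib E :=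
  mfderiv 𝓘(ℝ, E) 𝓘(ℝ, ℝ × Fib E) ψ.chart x

/-- The inverse `ℝ × ℝⁿ → T_xM` of the tangent map of a fibred chart. -/
def dinv (x : M) : ℝ × Fib E →L[ℝ] TangentSpace 𝓘(ℝ, E) x := (ψ.d x).inverse

theorem mdiff : ψ.chart.MDifferentiable 𝓘(ℝ, E) 𝓘(ℝ, ℝ × Fib E) :=
  ⟨ψ.contMDiffOn.mdifferentiableOn (by simp), ψ.contMDiffOn_symm.mdifferentiableOn (by simp)⟩

theorem clock_eq {x : M} (hx : x ∈ ψ.chart.source) (u : TangentSpace 𝓘(ℝ, E) x) :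
    clock E π x u = (ψ.d x u).1 := by
  have h1 : π =ᶠ[𝓝 x] Prod.fst ∘ ψ.chart := by
    filter_upwards [ψ.chart.open_source.mem_nhds hx] with y hy
    exact (ψ.fst_eq y hy).symm
  have h2 : MDifferentiableAt 𝓘(ℝ, E) 𝓘(ℝ, ℝ × Fib E) ψ.chart x := ψ.mdiff.mdifferentiableAt hx
  have h3 : HasMFDerivAt 𝓘(ℝ, ℝ × Fib E) 𝓘(ℝ, ℝ) (Prod.fst : ℝ × Fib E → ℝ) (ψ.chart x)
      (ContinuousLinearMap.fst ℝ ℝ (Fib E)) := hasFDerivAt_fst.hasMFDerivAt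
  have h4 := (h3.comp x h2.hasMFDerivAt).congr_of_eventuallyEq h1
  unfold clock
  rw [h4.mfderiv]
  rfl

theorem d_isInvertible {x : M} (hx : x ∈ ψ.chart.source) : (ψ.d x).IsInvertible :=
  ⟨ψ.mdiff.mfderiv hx, rfl⟩

theorem d_dinv {x : M} (hx : x ∈ ψ.chart.source) (u : ℝ × Fib E) :
    ψ.d x (ψ.dinv x u) = u :=
  congrArg (fun f ↦ f u) (ψ.d_isInvertible hx).self_comp_inverse

theorem dinv_d {x : M} (hx : x ∈ ψ.chart.source) (u : TangentSpace 𝓘(ℝ, E) x) :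
    ψ.dinv x (ψ.d x u) = u :=
  congrArg (fun f ↦ f u) (ψ.d_isInvertible hx).inverse_comp_self

theorem clock_dinv {x : M} (hx : x ∈ ψ.chart.source) (u : ℝ × Fib E) :
    clock E π x (ψ.dinv x u) = u.1 := by
  rw [ψ.clock_eq hx, ψ.d_dinv hx]

/-- Change of fibred coordinates. -/
def change : OpenPartialHomeomorph (ℝ × Fib E) (ℝ × Fib E) := ψ.chart.symm.trans ψ'.chart

theorem change_contDiffOn : ContDiffOn ℝ ∞ (ψ.change ψ') (ψ.change ψ').source := by
  rw [← contMDiffOn_iff_contDiffOn]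
  exact ψ'.contMDiffOn.comp (ψ.contMDiffOn_symm.mono fun y hy ↦ hy.1) fun y hy ↦ hy.2

theorem d_change {x : M} (hx : x ∈ ψ.chart.source) (hx' : x ∈ ψ'.chart.source)
    (u : TangentSpace 𝓘(ℝ, E) x) :
    ψ'.d x u = fderiv ℝ (ψ.change ψ') (ψ.chart x) (ψ.d x u) := by
  have hs : ψ.chart x ∈ (ψ.change ψ').source := by
    refine ⟨ψ.chart.map_source hx, ?_⟩
    simpa [ψ.chart.left_inv hx] using hx'
  have h1 : (ψ'.chart : M → ℝ × Fib E) =ᶠ[𝓝 x] (ψ.change ψ') ∘ ψ.chart := by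
    filter_upwards [ψ.chart.open_source.mem_nhds hx] with y hy
    simp [change, ψ.chart.left_inv hy]
  have h2 : MDifferentiableAt 𝓘(ℝ, E) 𝓘(ℝ, ℝ × Fib E) ψ.chart x := ψ.mdiff.mdifferentiableAt hx
  have h3 : HasMFDerivAt 𝓘(ℝ, ℝ × Fib E) 𝓘(ℝ, ℝ × Fib E) (ψ.change ψ') (ψ.chart x)
      (fderiv ℝ (ψ.change ψ') (ψ.chart x)) :=
    (((ψ.change_contDiffOn ψ').contDiffAt ((ψ.change ψ').open_source.mem_nhds hs)
      ).differentiableAt (by simp)).hasFDerivAt.hasMFDerivAt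
  have h4 := (h3.comp x h2.hasMFDerivAt).congr_of_eventuallyEq h1
  unfold d
  rw [h4.mfderiv]
  rfl

theorem change_fderiv_contDiffOn :
    ContDiffOn ℝ ∞ (fderiv ℝ (ψ.change ψ')) (ψ.change ψ').source :=
  (ψ.change_contDiffOn ψ').fderiv_of_isOpen (ψ.change ψ').open_source (by simp)

end FibredChart

variable [FiniteDimensional ℝ E] [IsManifold 𝓘(ℝ, E) ∞ M] [IsFibration E π]

variable (E π) in
theorem exists_clock_eq_one (x : M) : ∃ u : TangentSpace 𝓘(ℝ, E) x, clock E π x u = 1 := by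
  obtain ⟨ψ, hψ⟩ := exists_fibredChart (E := E) π x
  exact ⟨ψ.dinv x (1, 0), ψ.clock_dinv hψ _⟩

variable (E π) in
/-- Some tangent vector at `x` with `η = 1`. -/
def unitVec (x : M) : TangentSpace 𝓘(ℝ, E) x := (exists_clock_eq_one E π x).choose

theorem clock_unitVec (x : M) : clock E π x (unitVec E π x) = 1 :=
  (exists_clock_eq_one E π x).choose_spec

/-- The jet `u + (1 - η(u)) e`, with `e` as above; it is `u` itself if `η(u) = 1`. -/
def Jet.ofVec (x : M) (u : TangentSpace 𝓘(ℝ, E) x) : Jet E π :=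
  ⟨⟨x, u + (1 - clock E π x u) • unitVec E π x⟩, by simp [clock_unitVec]⟩

theorem Jet.ofVec_val {x : M} {u : TangentSpace 𝓘(ℝ, E) x} (hu : clock E π x u = 1) :
    (Jet.ofVec (π := π) x u).1 = ⟨x, u⟩ := by
  simp [Jet.ofVec, hu]

variable (E π) in
/-- The projection `u ↦ u - η(u) e` of `T_xM` onto `V_xπ`, with `e` as above. -/
def vertProj (x : M) : TangentSpace 𝓘(ℝ, E) x →L[ℝ] Vert E π x :=
  (ContinuousLinearMap.id ℝ _ - (clock E π x).smulRight (unitVec E π x)).codRestrict _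
    (by intro u; simp [Vert, clock_unitVec])

theorem vertProj_coe {x : M} (u : Vert E π x) : vertProj E π x u = u := by
  have : clock E π x u = 0 := u.2
  ext
  simp [vertProj, this]

theorem vertProj_eq {x : M} {u : TangentSpace 𝓘(ℝ, E) x} (hu : clock E π x u = 0) :
    (vertProj E π x u : TangentSpace 𝓘(ℝ, E) x) = u := by
  simp [vertProj, hu]

end Tangent

section JetManifold

/-- The model of `J¹π`, with points `((t, qⁱ), q̇ⁱ)`. -/
abbrev JModel (E : Type*) [NormedAddCommGroup E] [NormedSpace ℝ E] : Type :=
  (ℝ × Fib E) × Fib E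

variable {E : Type*} [NormedAddCommGroup E] [NormedSpace ℝ E] [FiniteDimensional ℝ E]
  {M : Type*} [TopologicalSpace M] [ChartedSpace E M] [IsManifold 𝓘(ℝ, E) ∞ M]
  {π : M → ℝ} [IsFibration E π]

/-- The coordinates `(t, qⁱ, q̇ⁱ)` on `J¹π` induced by fibred coordinates `(t, qⁱ)` on `M`. -/
def FibredChart.jet (ψ : FibredChart E π) :
    PartialEquiv (Jet E π) (JModel E) where
  toFun v := (ψ.chart v.1.proj, (ψ.d v.1.proj v.1.2).2)
  invFun y := Jet.ofVec (ψ.chart.symm y.1) (ψ.dinv (ψ.chart.symm y.1) (1, y.2))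
  source := {v | v.1.proj ∈ ψ.chart.source}
  target := {y | y.1 ∈ ψ.chart.target}
  map_source' v hv := ψ.chart.map_source hv
  map_target' y hy := ψ.chart.map_target hy
  left_inv' v hv := by
    obtain ⟨⟨x, u⟩, hu⟩ := v
    have hx : x ∈ ψ.chart.source := hv
    have h1 : ((1, (ψ.d x u).2) : ℝ × Fib E) = ψ.d x u := by
      ext1
      · rw [← ψ.clock_eq hx]; exact hu.symm
      · rfl
    have h2 : ∀ x', x' = x → Jet.ofVec (π := π) x' (ψ.dinv x' (ψ.d x u)) = ⟨⟨x, u⟩, hu⟩ := by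
      rintro _ rfl
      rw [ψ.dinv_d hx]
      exact Subtype.ext (Jet.ofVec_val hu)
    simp only [h1]
    exact h2 _ (ψ.chart.left_inv hx)
  right_inv' y hy := by
    have hy' : y.1 ∈ ψ.chart.target := hy
    have hx := ψ.chart.map_target hy'
    rw [Jet.ofVec_val (by rw [ψ.clock_dinv hx])]
    simp only [ψ.d_dinv hx, ψ.chart.right_inv hy']

theorem FibredChart.jet_change_source (ψ ψ' : FibredChart E π) :
    (ψ.jet.symm.trans ψ'.jet).source = (ψ.change ψ').source ×ˢ univ := by
  ext y
  exact ⟨fun h ↦ ⟨⟨h.1, h.2⟩, trivial⟩, fun h ↦ ⟨h.1.1, h.1.2⟩⟩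

theorem FibredChart.jet_change_contDiffOn (ψ ψ' : FibredChart E π) :
    ContDiffOn ℝ ∞ (ψ.jet.symm.trans ψ'.jet) (ψ.jet.symm.trans ψ'.jet).source := by
  rw [FibredChart.jet_change_source]
  have h : ContDiffOn ℝ ∞ (fun y : (ℝ × Fib E) × Fib E ↦
      (ψ.change ψ' y.1, (fderiv ℝ (ψ.change ψ') y.1 (1, y.2)).2))
      ((ψ.change ψ').source ×ˢ univ) := by
    have h1 := (ψ.change_contDiffOn ψ').comp
      (contDiffOn_fst (F := Fib E) (s := (ψ.change ψ').source ×ˢ univ)) fun y hy ↦ hy.1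
    have h2 := (ψ.change_fderiv_contDiffOn ψ').comp
      (contDiffOn_fst (F := Fib E) (s := (ψ.change ψ').source ×ˢ univ)) fun y hy ↦ hy.1
    exact h1.prodMk (h2.clm_apply (contDiffOn_const.prodMk contDiffOn_snd)).snd
  refine h.congr fun y hy ↦ ?_
  have h1 : y.1 ∈ ψ.chart.target := hy.1.1
  have h2 := ψ.chart.map_target h1
  have h3 : ψ.chart.symm y.1 ∈ ψ'.chart.source := hy.1.2
  change (ψ'.chart (Jet.ofVec _ _).1.proj, (ψ'.d (Jet.ofVec _ _).1.proj (Jet.ofVec _ _).1.2).2) = _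
  rw [Jet.ofVec_val (by rw [ψ.clock_dinv h2])]
  simp only [ψ.d_change ψ' h2 h3, ψ.d_dinv h2, ψ.chart.right_inv h1]
  rfl

variable (E π) in
/-- The atlas of `J¹π` given by the coordinates `(t, qⁱ, q̇ⁱ)`. -/
def jetCore : ChartedSpaceCore (JModel E) (Jet E π) where
  atlas := Set.range FibredChart.jet
  chartAt v := (exists_fibredChart (E := E) π v.1.proj).choose.jet
  mem_chart_source v := (exists_fibredChart (E := E) π v.1.proj).choose_spec
  chart_mem_atlas v := ⟨_, rfl⟩
  open_source := by
    rintro _ _ ⟨ψ, rfl⟩ ⟨ψ', rfl⟩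
    rw [FibredChart.jet_change_source]
    exact (ψ.change ψ').open_source.prod isOpen_univ
  continuousOn_toFun := by
    rintro _ _ ⟨ψ, rfl⟩ ⟨ψ', rfl⟩
    exact (ψ.jet_change_contDiffOn ψ').continuousOn

instance : TopologicalSpace (Jet E π) := (jetCore E π).toTopologicalSpace

instance : ChartedSpace (JModel E) (Jet E π) := (jetCore E π).toChartedSpace

instance : IsManifold 𝓘(ℝ, (ℝ × Fib E) × Fib E) ∞ (Jet E π) := by
  refine isManifold_of_contDiffOn _ _ _ fun e e' he he' ↦ ?_
  simp only [atlas, ChartedSpace.atlas, jetCore, mem_iUnion] at he he'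
  obtain ⟨_, ⟨ψ, rfl⟩, rfl⟩ := he
  obtain ⟨_, ⟨ψ', rfl⟩, rfl⟩ := he'
  have h := ψ.jet_change_contDiffOn ψ'
  rw [modelWithCornersSelf_coe, range_id, inter_univ]
  exact h

end JetManifold

section DualManifold

variable {E : Type*} [NormedAddCommGroup E] [NormedSpace ℝ E] [FiniteDimensional ℝ E]
  {M : Type*} [TopologicalSpace M] [ChartedSpace E M] [IsManifold 𝓘(ℝ, E) ∞ M]
  {π : M → ℝ} [IsFibration E π]

/-- The model of `V^*π`, with points `((t, qⁱ), (pᵢ))`, where `(pᵢ)` is a linear form on `ℝⁿ`. -/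
abbrev VModel (E : Type*) [NormedAddCommGroup E] [NormedSpace ℝ E] : Type :=
  (ℝ × Fib E) × (Fib E →L[ℝ] ℝ)

/-- The coordinates `(t, qⁱ, pᵢ)` on `V^*π` induced by fibred coordinates `(t, qⁱ)` on `M`;
on the domain of the chart, `pᵢ` is the value of the form at the vertical vector `∂/∂qⁱ`. -/
def FibredChart.dual (ψ : FibredChart E π) : PartialEquiv (VDual E π) (VModel E) where
  toFun a := (ψ.chart a.base, a.form ∘L vertProj E π a.base ∘L ψ.dinv a.base ∘L
    ContinuousLinearMap.inr ℝ ℝ (Fib E))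
  invFun y := ⟨ψ.chart.symm y.1, y.2 ∘L ContinuousLinearMap.snd ℝ ℝ (Fib E) ∘L
    ψ.d (ψ.chart.symm y.1) ∘L (Vert E π (ψ.chart.symm y.1)).subtypeL⟩
  source := {a | a.base ∈ ψ.chart.source}
  target := {y | y.1 ∈ ψ.chart.target}
  map_source' v hv := ψ.chart.map_source hv
  map_target' y hy := ψ.chart.map_target hy
  left_inv' a ha := by
    obtain ⟨x, f⟩ := a
    have hx : x ∈ ψ.chart.source := ha
    have h2 : ∀ x', x' = x → VDual.mk x' ((f ∘L vertProj E π x ∘L ψ.dinv x ∘L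
        ContinuousLinearMap.inr ℝ ℝ (Fib E)) ∘L ContinuousLinearMap.snd ℝ ℝ (Fib E) ∘L
        ψ.d x' ∘L (Vert E π x').subtypeL) = ⟨x, f⟩ := by
      intro x' hx'
      subst hx'
      congr 1
      ext u
      have h0 : (ψ.d x' u).1 = 0 := by rw [← ψ.clock_eq hx]; exact u.2
      have h1 : ((0, (ψ.d x' u).2) : ℝ × Fib E) = ψ.d x' u := by rw [← h0]
      simp only [ContinuousLinearMap.comp_apply, ContinuousLinearMap.inr_apply,
        ContinuousLinearMap.coe_snd', Submodule.subtypeL_apply, h1, ψ.dinv_d hx, vertProj_coe]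
    exact h2 _ (ψ.chart.left_inv hx)
  right_inv' y hy := by
    have hy' : y.1 ∈ ψ.chart.target := hy
    have hx := ψ.chart.map_target hy'
    ext1
    · exact ψ.chart.right_inv hy'
    · ext1 w
      simp only [ContinuousLinearMap.comp_apply, ContinuousLinearMap.inr_apply,
        ContinuousLinearMap.coe_snd', Submodule.subtypeL_apply]
      rw [vertProj_eq (by rw [ψ.clock_dinv hx]), ψ.d_dinv hx]

theorem FibredChart.dual_change_source (ψ ψ' : FibredChart E π) :
    (ψ.dual.symm.trans ψ'.dual).source = (ψ.change ψ').source ×ˢ univ := by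
  ext y
  exact ⟨fun h ↦ ⟨⟨h.1, h.2⟩, trivial⟩, fun h ↦ ⟨h.1.1, h.1.2⟩⟩

theorem FibredChart.dual_change_contDiffOn (ψ ψ' : FibredChart E π) :
    ContDiffOn ℝ ∞ (ψ.dual.symm.trans ψ'.dual) (ψ.dual.symm.trans ψ'.dual).source := by
  rw [FibredChart.dual_change_source]
  have h : ContDiffOn ℝ ∞ (fun y : VModel E ↦
      (ψ.change ψ' y.1, y.2 ∘L ContinuousLinearMap.snd ℝ ℝ (Fib E) ∘L
        fderiv ℝ (ψ'.change ψ) (ψ.change ψ' y.1) ∘L ContinuousLinearMap.inr ℝ ℝ (Fib E)))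
      ((ψ.change ψ').source ×ˢ univ) := by
    have h1 := (ψ.change_contDiffOn ψ').comp
      (contDiffOn_fst (F := Fib E →L[ℝ] ℝ) (s := (ψ.change ψ').source ×ˢ univ)) fun y hy ↦ hy.1
    have h2 := (ψ'.change_fderiv_contDiffOn ψ).comp h1 fun y hy ↦ by
      have := (ψ.change ψ').map_source hy.1
      simpa [FibredChart.change] using this
    exact h1.prodMk (contDiffOn_snd.clm_comp (contDiffOn_const.clm_comp
      (h2.clm_comp contDiffOn_const)))
  refine h.congr fun y hy ↦ ?_
  have h1 : y.1 ∈ ψ.chart.target := hy.1.1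
  have h2 := ψ.chart.map_target h1
  have h3 : ψ.chart.symm y.1 ∈ ψ'.chart.source := hy.1.2
  refine Prod.ext rfl ?_
  ext1 w
  simp only [FibredChart.dual, PartialEquiv.coe_trans, Function.comp_apply,
    PartialEquiv.coe_symm_mk, ContinuousLinearMap.comp_apply, ContinuousLinearMap.inr_apply,
    ContinuousLinearMap.coe_snd', Submodule.subtypeL_apply]
  rw [vertProj_eq (by rw [ψ'.clock_dinv h3]), ψ'.d_change ψ h3 h2, ψ'.d_dinv h3]
  rfl

variable (E π) in
/-- The atlas of `V^*π` given by the coordinates `(t, qⁱ, pᵢ)`. -/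
def dualCore : ChartedSpaceCore (VModel E) (VDual E π) where
  atlas := Set.range FibredChart.dual
  chartAt a := (exists_fibredChart (E := E) π a.base).choose.dual
  mem_chart_source a := (exists_fibredChart (E := E) π a.base).choose_spec
  chart_mem_atlas v := ⟨_, rfl⟩
  open_source := by
    rintro _ _ ⟨ψ, rfl⟩ ⟨ψ', rfl⟩
    rw [FibredChart.dual_change_source]
    exact (ψ.change ψ').open_source.prod isOpen_univ
  continuousOn_toFun := by
    rintro _ _ ⟨ψ, rfl⟩ ⟨ψ', rfl⟩
    exact (ψ.dual_change_contDiffOn ψ').continuousOn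

instance : TopologicalSpace (VDual E π) := (dualCore E π).toTopologicalSpace

instance : ChartedSpace (VModel E) (VDual E π) := (dualCore E π).toChartedSpace

instance : IsManifold 𝓘(ℝ, VModel E) ∞ (VDual E π) := by
  refine isManifold_of_contDiffOn _ _ _ fun e e' he he' ↦ ?_
  simp only [atlas, ChartedSpace.atlas, dualCore, mem_iUnion] at he he'
  obtain ⟨_, ⟨ψ, rfl⟩, rfl⟩ := he
  obtain ⟨_, ⟨ψ', rfl⟩, rfl⟩ := he'
  have h := ψ.dual_change_contDiffOn ψ'
  rw [modelWithCornersSelf_coe, range_id, inter_univ]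
  exact h

variable (E π) in
/-- The projection `π₁^* : V^*π → ℝ`. -/
def dualProj (a : VDual E π) : ℝ := π a.base

instance : IsFibration (VModel E) (dualProj E π) where
  surjective t := by
    obtain ⟨x, hx⟩ := IsFibration.surjective (E := E) (π := π) t
    exact ⟨⟨x, 0⟩, hx⟩
  isSubmersion := by
    refine Manifold.IsSubmersionOfComplement.isSubmersion
      (F := Fib E × (Fib E →L[ℝ] ℝ)) fun a ↦ ?_
    refine Manifold.IsSubmersionAtOfComplement.mk_of_charts
      (ContinuousLinearEquiv.prodAssoc ℝ ℝ (Fib E) (Fib E →L[ℝ] ℝ)) (chartAt (VModel E) a)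
      (OpenPartialHomeomorph.refl ℝ) (mem_chart_source _ a) (mem_univ _)
      (IsManifold.chart_mem_maximalAtlas a) (IsManifold.chart_mem_maximalAtlas (0 : ℝ))
      (fun _ _ ↦ mem_univ _) ?_
    intro y hy
    let ψ := (exists_fibredChart (E := E) π a.base).choose
    have hy0 : y ∈ (chartAt (VModel E) a).target := by simpa using hy
    have hy1 : y.1 ∈ ψ.chart.target := hy0
    have h := ψ.fst_eq _ (ψ.chart.map_target hy1)
    rw [ψ.chart.right_inv hy1] at h
    exact h.symm

end DualManifold

section Cotangent

variable (E : Type*) [NormedAddCommGroup E] [NormedSpace ℝ E]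
  (M : Type*) [TopologicalSpace M] [ChartedSpace E M] [IsManifold 𝓘(ℝ, E) ∞ M]

/-- The cotangent bundle `T^*M`. -/
abbrev Cotangent : Type _ :=
  Bundle.TotalSpace (E →L[ℝ] ℝ)
    (fun x : M ↦ TangentSpace 𝓘(ℝ, E) x →L[ℝ] Bundle.Trivial M ℝ x)

/-- The model with corners of `T^*M`. -/
abbrev cotModel : ModelWithCorners ℝ (E × (E →L[ℝ] ℝ)) (ModelProd E (E →L[ℝ] ℝ)) :=
  𝓘(ℝ, E).prod 𝓘(ℝ, E →L[ℝ] ℝ)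

/-- The set of covectors of the manifold `TM`, i.e. `T^*(TM)`. -/
abbrev CotangentTangent : Type _ :=
  Σ v : TangentBundle 𝓘(ℝ, E) M, (TangentSpace 𝓘(ℝ, E).tangent v →L[ℝ] ℝ)

variable {E M}

/-- The canonical symplectic structure `Ω_M = dqⁱ ∧ dpᵢ` of `T^*M`. The tangent space of `T^*M`
at `α` consists of the pairs `(q̇, ṗ)` in the canonical coordinates of `T^*M` that are induced by
the preferred chart of `M` at the base point of `α`. -/
def canonicalForm (α : Cotangent E M) (X Y : TangentSpace (cotModel E) α) : ℝ :=
  let X' : E × (E →L[ℝ] ℝ) := X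
  let Y' : E × (E →L[ℝ] ℝ) := Y
  Y'.2 X'.1 - X'.2 Y'.1

variable (E M) in
/-- The canonical Tulczyjew diffeomorphism
`A_M : T(T^*M) → T^*(TM)`, `(q, p; q̇, ṗ) ↦ (q, q̇; ṗ, p)`.
Tangent vectors of `T^*M` at a point over `x` and of `TM` at a point over `x` are both written in
the coordinates induced by the preferred chart of `M` at `x`. -/
def tulczyjew : TangentBundle (cotModel E) (Cotangent E M) ≃ CotangentTangent E M where
  toFun X :=
    let α : E →L[ℝ] ℝ := X.proj.2
    let X' : E × (E →L[ℝ] ℝ) := X.2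
    ⟨⟨X.proj.proj, X'.1⟩, (X'.2.coprod α : E × E →L[ℝ] ℝ)⟩
  invFun β :=
    let v : E := β.1.2
    let β' : E × E →L[ℝ] ℝ := β.2
    ⟨⟨β.1.proj, β' ∘L ContinuousLinearMap.inr ℝ E E⟩,
      ((v, β' ∘L ContinuousLinearMap.inl ℝ E E) : E × (E →L[ℝ] ℝ))⟩
  left_inv X := by
    obtain ⟨⟨x, p⟩, ⟨q', p'⟩⟩ := X
    have h1 (a b : E →L[ℝ] ℝ) : a.coprod b ∘L ContinuousLinearMap.inr ℝ E E = b := by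
      ext u; simp
    have h2 (a b : E →L[ℝ] ℝ) : a.coprod b ∘L ContinuousLinearMap.inl ℝ E E = a := by
      ext u; simp
    have h (a b : E →L[ℝ] ℝ) (ha : a = p) (hb : b = p') :
        (⟨⟨x, a⟩, ((q', b) : E × (E →L[ℝ] ℝ))⟩ : TangentBundle (cotModel E) (Cotangent E M)) =
          ⟨⟨x, p⟩, ((q', p') : E × (E →L[ℝ] ℝ))⟩ := by
      subst ha hb; rfl
    exact h _ _ (h1 _ _) (h2 _ _)
  right_inv β := by
    obtain ⟨⟨x, v⟩, β⟩ := β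
    have h (γ : E × E →L[ℝ] ℝ) : (γ ∘L ContinuousLinearMap.inl ℝ E E).coprod
        (γ ∘L ContinuousLinearMap.inr ℝ E E) = γ := by
      ext u <;> simp
    exact Sigma.ext rfl (heq_of_eq (h β))

end Cotangent

section Legendre

variable {E : Type*} [NormedAddCommGroup E] [NormedSpace ℝ E]
  {M : Type*} [TopologicalSpace M] [ChartedSpace E M] {π : M → ℝ}

theorem add_vert_mem (v : Jet E π) (X : TangentSpace 𝓘(ℝ, E) v.1.proj) :
    clock E π v.1.proj (v.1.2 + (X - clock E π v.1.proj X • v.1.2)) = 1 := by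
  simp [v.2]

variable [IsManifold 𝓘(ℝ, E) ∞ M]

variable (E π) in
/-- The canonical projection `μ : T^*M → V^*π`, the restriction of covectors to `Vπ`. -/
def dualRestrict (α : Cotangent E M) : VDual E π :=
  ⟨α.proj, (α.2 : TangentSpace 𝓘(ℝ, E) α.proj →L[ℝ] ℝ) ∘L (Vert E π α.proj).subtypeL⟩

/-- The extended Legendre transformation `Leg_L : J¹π → T^*M`,
`Leg_L(v)(X) = L(v) η(X) + d/ds|_{s=0} L(v + s (X - η(X) v))`. The second summand is written as
the derivative at `0`, in the direction `X`, of the function `X ↦ L(v + (X - η(X) v))` on `T_xM`. -/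
def extLegendre (L : Jet E π → ℝ) (v : Jet E π) : Cotangent E M :=
  let η : E →L[ℝ] ℝ := clock E π v.1.proj
  let D : E →L[ℝ] ℝ := fderiv ℝ (fun X : TangentSpace 𝓘(ℝ, E) v.1.proj ↦
    L ⟨⟨v.1.proj, v.1.2 + (X - clock E π v.1.proj X • v.1.2)⟩, add_vert_mem v X⟩ : E → ℝ) 0
  ⟨v.1.proj, L v • η + D⟩

/-- The restricted Legendre transformation `leg_L = μ ∘ Leg_L : J¹π → V^*π`. -/
def resLegendre (L : Jet E π → ℝ) (v : Jet E π) : VDual E π :=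
  dualRestrict E π (extLegendre L v)

variable [FiniteDimensional ℝ E] [IsFibration E π]

/-- `L` is hyperregular: `leg_L` is a global diffeomorphism. -/
def IsHyperregular (L : Jet E π → ℝ) : Prop :=
  ∃ Φ : Diffeomorph 𝓘(ℝ, JModel E) 𝓘(ℝ, VModel E) (Jet E π) (VDual E π) ∞,
    ∀ v, Φ v = resLegendre L v

/-- The Hamiltonian section `h = Leg_L ∘ leg_L⁻¹ : V^*π → T^*M` of a hyperregular Lagrangian. -/
def hamiltonianSection {L : Jet E π → ℝ} (hL : IsHyperregular L) (a : VDual E π) :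
    Cotangent E M :=
  extLegendre L (hL.choose.symm a)

end Legendre

section Sets

variable (E : Type*) [NormedAddCommGroup E] [NormedSpace ℝ E] [FiniteDimensional ℝ E]
  {M : Type*} [TopologicalSpace M] [ChartedSpace E M] [IsManifold 𝓘(ℝ, E) ∞ M]
  (π : M → ℝ) [IsFibration E π]

/-- The space `J¹π₁^*` of `1`-jets of local sections of `π₁^* : V^*π → ℝ`, as a subset of
`T(V^*π)`. -/
abbrev DualJet : Type _ := Jet (VModel E) (dualProj E π)

/-- The tangent map of the inclusion `J¹π ⊆ TM`. -/
def dIncl (v : Jet E π) :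
    TangentSpace 𝓘(ℝ, JModel E) v →L[ℝ] TangentSpace 𝓘(ℝ, E).tangent v.1 :=
  mfderiv 𝓘(ℝ, JModel E) 𝓘(ℝ, E).tangent (fun w : Jet E π ↦ w.1) v

/-- The `1`-form `η₁ = π₁^*(dt)` on `J¹π`. -/
def jetClock (v : Jet E π) : TangentSpace 𝓘(ℝ, JModel E) v →L[ℝ] ℝ :=
  mfderiv 𝓘(ℝ, JModel E) 𝓘(ℝ, ℝ) (fun w : Jet E π ↦ π w.1.proj) v

/-- The quotient bundle `T^*(J¹π)/⟨η₁⟩`. -/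
abbrev ReducedCotangent : Type _ :=
  Σ v : Jet E π, (TangentSpace 𝓘(ℝ, JModel E) v →L[ℝ] ℝ) ⧸ Submodule.span ℝ {jetClock E π v}

variable {E π}

/-- An extension of a covector `α` of `J¹π` at `v` to `T_v(TM)`: the composition of `α` with a
linear left inverse of the (injective) tangent map of the inclusion `J¹π ⊆ TM`. -/
def extendCovector (v : Jet E π) (α : TangentSpace 𝓘(ℝ, JModel E) v →L[ℝ] ℝ) :
    TangentSpace 𝓘(ℝ, E).tangent v.1 →L[ℝ] ℝ :=
  let β : E × E →ₗ[ℝ] ℝ :=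
    (α : TangentSpace 𝓘(ℝ, JModel E) v →ₗ[ℝ] ℝ) ∘ₗ (dIncl E π v).toLinearMap.leftInverse
  let β' : E × E →L[ℝ] ℝ := LinearMap.toContinuousLinearMap β
  β'

/-- The map `ψ : T^*(J¹π) → T(V^*π)` that sends `α` at `v` to `Tμ(A_M⁻¹(β))`, where `β` is an
extension of `α` to `T_v(TM)`; the result does not depend on the extension. -/
def psi (v : Jet E π) (α : TangentSpace 𝓘(ℝ, JModel E) v →L[ℝ] ℝ) :
    TangentBundle 𝓘(ℝ, VModel E) (VDual E π) :=
  tangentMap (cotModel E) 𝓘(ℝ, VModel E) (dualRestrict E π)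
    ((tulczyjew E M).symm ⟨v.1, extendCovector v α⟩)

/-- The map induced by `ψ` on `T^*(J¹π)/⟨η₁⟩`. It is a bijection onto the subset `J¹π₁^*` of
`T(V^*π)`; the Tulczyjew diffeomorphism `A_π : J¹π₁^* → T^*(J¹π)/⟨η₁⟩` is its inverse, that is,
this map is `A_π⁻¹`. -/
def tulczyjewInv (z : ReducedCotangent E π) : TangentBundle 𝓘(ℝ, VModel E) (VDual E π) :=
  psi z.1 (Quotient.out z.2)

/-- The section of `T^*(J¹π)/⟨η₁⟩` induced by the differential `dL`. -/
def reducedDifferential (L : Jet E π → ℝ) (v : Jet E π) : ReducedCotangent E π :=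
  ⟨v, Submodule.Quotient.mk (mfderiv 𝓘(ℝ, JModel E) 𝓘(ℝ, ℝ) L v)⟩

/-- The subset `S_L` of `J¹π₁^*`: the image under `A_π⁻¹` of the image of the section of
`T^*(J¹π)/⟨η₁⟩` induced by `dL`. -/
def lagrangianSet (L : Jet E π → ℝ) : Set (DualJet E π) :=
  {X | X.1 ∈ tulczyjewInv '' Set.range (reducedDifferential L)}

/-- The `2`-form `Ω_h = h^*Ω_M` on `V^*π`. -/
def pullbackForm (h : VDual E π → Cotangent E M) (a : VDual E π)
    (X Y : TangentSpace 𝓘(ℝ, VModel E) a) : ℝ :=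
  canonicalForm (h a) (mfderiv 𝓘(ℝ, VModel E) (cotModel E) h a X)
    (mfderiv 𝓘(ℝ, VModel E) (cotModel E) h a Y)

/-- The conditions `ι_R Ω_h = 0` and `ι_R η₁^* = 1` at the point `a`, where `η₁^* = (π₁^*)^*(dt)`. -/
def IsReebAt (h : VDual E π → Cotangent E M) (a : VDual E π)
    (R : TangentSpace 𝓘(ℝ, VModel E) a) : Prop :=
  (∀ Y, pullbackForm h a R Y = 0) ∧ clock (VModel E) (dualProj E π) a R = 1

/-- The Reeb vector field `R_h` of the cosymplectic structure `(Ω_h, η₁^*)`: the vector field that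
is characterized by the conditions `IsReebAt`. -/
def reeb (h : VDual E π → Cotangent E M) (a : VDual E π) : TangentSpace 𝓘(ℝ, VModel E) a :=
  Classical.epsilon (IsReebAt h a)

/-- The subset `S_h = R_h(V^*π)` of `J¹π₁^*`. -/
def hamiltonianSet (h : VDual E π → Cotangent E M) : Set (DualJet E π) :=
  {X | ∃ a, X.1 = ⟨a, reeb h a⟩}

end Sets

section Poisson

/-- Fields of bilinear forms on the cotangent spaces of a manifold; bivector fields are the
skew-symmetric ones. -/
abbrev BivectorField (E : Type*) [NormedAddCommGroup E] [NormedSpace ℝ E]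
    (N : Type*) [TopologicalSpace N] [ChartedSpace E N] : Type _ :=
  ∀ x : N, LinearMap.BilinForm ℝ (Dual ℝ (TangentSpace 𝓘(ℝ, E) x))

variable {E : Type*} [NormedAddCommGroup E] [NormedSpace ℝ E]
  {N : Type*} [TopologicalSpace N] [ChartedSpace E N]

instance [FiniteDimensional ℝ E] (x : N) : FiniteDimensional ℝ (TangentSpace 𝓘(ℝ, E) x) :=
  inferInstanceAs (FiniteDimensional ℝ E)

/-- The map `Λ^♯ : T^*_xN → T_xN`, characterized by `β(Λ^♯(α)) = Λ(α, β)`. -/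
def sharp [FiniteDimensional ℝ E] (Λ : BivectorField E N) (x : N) :
    Dual ℝ (TangentSpace 𝓘(ℝ, E) x) →ₗ[ℝ] TangentSpace 𝓘(ℝ, E) x :=
  (evalEquiv ℝ (TangentSpace 𝓘(ℝ, E) x)).symm.toLinearMap ∘ₗ Λ x

variable (E) in
/-- `C` is an embedded smooth submanifold: around each of its points there is a chart of `N`
in which `C` is a linear subspace. -/
def IsEmbeddedSubmanifold (C : Set N) : Prop :=
  ∀ x ∈ C, ∃ φ ∈ IsManifold.maximalAtlas 𝓘(ℝ, E) ∞ N, x ∈ φ.source ∧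
    ∃ W : Submodule ℝ E, ∀ y ∈ φ.source, y ∈ C ↔ φ y ∈ W

/-- The tangent space `T_xC` of a submanifold `C`, spanned by the velocities at `x` of the smooth
curves in `C`. -/
def tangentOf [IsManifold 𝓘(ℝ, E) 1 N] (C : Set N) (x : N) :
    Submodule ℝ (TangentSpace 𝓘(ℝ, E) x) :=
  Submodule.span ℝ {w | ∃ γ : ℝ → N, ContMDiffAt 𝓘(ℝ, ℝ) 𝓘(ℝ, E) ∞ γ 0 ∧
    (∀ᶠ s in 𝓝 0, γ s ∈ C) ∧
    (⟨γ 0, mfderiv 𝓘(ℝ, ℝ) 𝓘(ℝ, E) γ 0 (1 : ℝ)⟩ : TangentBundle 𝓘(ℝ, E) N) = ⟨x, w⟩}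

/-- `C` is a Lagrangian submanifold of `(N, Λ)`: it is a submanifold, `Λ(α, β) = 0` for all
`α, β ∈ (Λ^♯)⁻¹(T_xC)`, and `dim (T_xC ∩ Λ^♯(T^*_xN)) = dim (Λ^♯(T^*_xN)) / 2`, for `x ∈ C`. -/
def IsLagrangian [FiniteDimensional ℝ E] [IsManifold 𝓘(ℝ, E) 1 N] (Λ : BivectorField E N)
    (C : Set N) : Prop :=
  IsEmbeddedSubmanifold E C ∧ ∀ x ∈ C,
    (∀ α β, sharp Λ x α ∈ tangentOf C x → sharp Λ x β ∈ tangentOf C x → Λ x α β = 0) ∧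
    2 * finrank ℝ ↥(tangentOf C x ⊓ (sharp Λ x).range) = finrank ℝ (sharp Λ x).range

end Poisson

section DualPoisson

variable (E : Type*) [NormedAddCommGroup E] [NormedSpace ℝ E] [FiniteDimensional ℝ E]
  {M : Type*} [TopologicalSpace M] [ChartedSpace E M] [IsManifold 𝓘(ℝ, E) ∞ M]
  (π : M → ℝ) [IsFibration E π]

/-- The vector `∂/∂qⁱ` in the coordinates `(t, qⁱ, pᵢ)`. -/
def dq (i : Fin (finrank ℝ E - 1)) : VModel E := ((0, Pi.single i 1), 0)

/-- The vector `∂/∂pᵢ` in the coordinates `(t, qⁱ, pᵢ)`. -/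
def dp (i : Fin (finrank ℝ E - 1)) : VModel E := (0, ContinuousLinearMap.proj i)

/-- The canonical Poisson structure `Λ = ∑ ∂/∂qⁱ ∧ ∂/∂pᵢ` of `V^*π`, that is,
`Λ(α, β) = ∑ (α(∂/∂qⁱ) β(∂/∂pᵢ) - α(∂/∂pᵢ) β(∂/∂qⁱ))`, at each point in the preferred coordinates
`(t, qⁱ, pᵢ)` around it. -/
def dualPoisson : BivectorField (VModel E) (VDual E π) := fun _ ↦
  ∑ i, ((Dual.eval ℝ (VModel E) (dq E i)).smulRight (Dual.eval ℝ (VModel E) (dp E i)) -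
    (Dual.eval ℝ (VModel E) (dp E i)).smulRight (Dual.eval ℝ (VModel E) (dq E i)))

/-- The complete lift `Λ^c` to `T(V^*π)` of the canonical Poisson structure `Λ` of `V^*π`. In the
coordinates `(x, ẋ)` of `T(V^*π)` induced by coordinates `x = (t, qⁱ, pᵢ)` of `V^*π`, in which `Λ`
has constant coefficients `Λ^{jk}`, it is given by `Λ^c(dx^j, dx^k) = Λ^c(dẋ^j, dẋ^k) = 0` and
`Λ^c(dx^j, dẋ^k) = Λ^c(dẋ^j, dx^k) = Λ^{jk}`, that is,
`Λ^c = ∑ (∂/∂qⁱ ∧ ∂/∂ṗᵢ + ∂/∂q̇ⁱ ∧ ∂/∂pᵢ)`. -/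
def dualPoissonLift (X : TangentBundle 𝓘(ℝ, VModel E) (VDual E π)) :
    LinearMap.BilinForm ℝ (Dual ℝ (TangentSpace 𝓘(ℝ, VModel E).tangent X)) :=
  let Λ : LinearMap.BilinForm ℝ (Dual ℝ (VModel E)) := dualPoisson E π X.proj
  let f : Dual ℝ (VModel E × VModel E) →ₗ[ℝ] Dual ℝ (VModel E) :=
    (LinearMap.inl ℝ (VModel E) (VModel E)).dualMap
  let g : Dual ℝ (VModel E × VModel E) →ₗ[ℝ] Dual ℝ (VModel E) :=
    (LinearMap.inr ℝ (VModel E) (VModel E)).dualMap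
  (Λ.compl₁₂ f g + Λ.compl₁₂ g f : LinearMap.BilinForm ℝ (Dual ℝ (VModel E × VModel E)))

/-- The Poisson structure of `J¹π₁^*`, the restriction of `Λ^c`, which is tangent to the
submanifold `J¹π₁^*` of `T(V^*π)`: covectors of `J¹π₁^*` are extended to `T(V^*π)` by means of a
linear left inverse of the (injective) tangent map of the inclusion, and then paired by `Λ^c`. -/
def dualJetPoisson : BivectorField (JModel (VModel E)) (DualJet E π) := fun X ↦
  let r : TangentSpace 𝓘(ℝ, VModel E).tangent X.1 →ₗ[ℝ]
      TangentSpace 𝓘(ℝ, JModel (VModel E)) X :=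
    (dIncl (VModel E) (dualProj E π) X).toLinearMap.leftInverse
  (dualPoissonLift E π X.1).compl₁₂ r.dualMap r.dualMap

end DualPoisson

end TimeMech

end

/-!
The map `σ : J¹π → J¹π₁^*`, `σ(v) = A_π⁻¹(dL(v))`, parametrizes `S_L`
(`lagrangianEmbedding`). In coordinates `(t, qⁱ)` on `M` adapted to `π`, it is

`(t, qⁱ, q̇ⁱ) ↦ (t, qⁱ, ∂L/∂q̇ⁱ; q̇ⁱ, ∂L/∂qⁱ)`

(`tulczyjewInv_reducedDifferential`). The only point in the passage from the canonical
coordinates of `T(T^*M)`, where `A_M` is given, to adapted ones is that the second derivative of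
the change of coordinates is symmetric.

**`S_L = S_h`.** The map `σ` covers `leg_L`, so `S_L` is the image of the vector field
`σ ∘ leg_L⁻¹` on `V^*π`, and it has to be shown that this is the Reeb field. Pulled back to `J¹π`
by the diffeomorphism `leg_L`, the form `h^*Ω_M` is minus the differential of the
Poincaré–Cartan form `L dt + ∂L/∂q̇ⁱ (dqⁱ - q̇ⁱ dt)`. By the invertibility of the Hessian
`∂²L/∂q̇ⁱ∂q̇ʲ`, its kernel is described by the equations `q̇ⁱ = dqⁱ/dt` and
`d(∂L/∂q̇ⁱ)/dt = ∂L/∂qⁱ` (`cartanForm_eq_zero_iff`). These are the equations satisfied by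
`σ ∘ leg_L⁻¹`, and they have a unique solution (`isReebAt_iff`).

**`S_L` is a Lagrangian submanifold.** Being the image of the section `σ ∘ leg_L⁻¹` of
`J¹π₁^* → V^*π`, the set `S_L` is a submanifold (`isEmbeddedSubmanifold_range_section`), whose
tangent spaces are the ranges of the tangent maps of `σ`. In coordinates these consist of the
vectors `(w₀, P w; (0, w₁), Q w)`, where `w = (w₀, w₁) ∈ ℝ¹⁺ⁿ × ℝⁿ` and `P`, `Q` are the rows of
the second derivative of `L` in the directions `q̇` and `q`. The image of `Λ^♯` is given by
`δt = δṫ = 0` and has dimension `4n`; its intersection with the tangent space of `S_L` is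
the image of `{w | δt = 0}` and has dimension `2n`; and the vanishing of `Λ` is the symmetry of the
second derivative of `L` (`isotropic_and_finrank_of_symm`).
-/

noncomputable section

namespace TimeMech

/-! ### Charts and coordinates -/

section Calculus

variable {V : Type*} [NormedAddCommGroup V] [NormedSpace ℝ V]
  {F : Type*} [NormedAddCommGroup F] [NormedSpace ℝ F] {H : Type*} [TopologicalSpace H]
  {I : ModelWithCorners ℝ F H} {N : Type*} [TopologicalSpace N] [ChartedSpace H N]

theorem hasMFDerivAt_of_source_normedSpace_iff {f : V → N} {y : V} {f' : V →L[ℝ] F} :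
    HasMFDerivAt 𝓘(ℝ, V) I f y f' ↔
      ContinuousAt f y ∧ HasFDerivAt (extChartAt I (f y) ∘ f) f' y := by
  unfold HasMFDerivAt
  simp only [writtenInExtChartAt, extChartAt_model_space_eq_id, modelWithCornersSelf_coe, range_id]
  exact and_congr_right fun _ ↦ hasFDerivWithinAt_univ

/-- The derivative of a map from a normed space to a manifold is the derivative of its expression in
the preferred chart. -/
theorem mfderiv_of_source_normedSpace {f : V → N} {y : V}
    (hf : MDifferentiableAt 𝓘(ℝ, V) I f y) {g : V → F} {g' : V →L[ℝ] F} (hg : HasFDerivAt g g' y)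
    (h : ∀ᶠ z in 𝓝 y, extChartAt I (f y) (f z) = g z) (w : V) :
    (mfderiv 𝓘(ℝ, V) I f y w : F) = g' w := by
  have h1 : HasMFDerivAt 𝓘(ℝ, V) I f y g' :=
    hasMFDerivAt_of_source_normedSpace_iff.2 ⟨hf.continuousAt, hg.congr_of_eventuallyEq h⟩
  rw [h1.mfderiv]
  rfl

/-- The derivative of a function `f` on a manifold, computed in coordinates `z` other than the
preferred ones: `g` is the change of coordinates, and `h` is `f` in the coordinates `z`. -/
theorem mfderiv_apply_of_target_normedSpace [I.Boundaryless] {V' : Type*} [NormedAddCommGroup V']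
    [NormedSpace ℝ V'] {f : N → V} {p : N} (hf : MDifferentiableAt I 𝓘(ℝ, V) f p) {g : V' → F}
    {g' : V' →L[ℝ] F} {k : V'} (hg : HasFDerivAt g g' k) (hgk : g k = extChartAt I p p)
    {h : V' → V} {h' : V' →L[ℝ] V} (hh : HasFDerivAt h h' k)
    (heq : ∀ᶠ z in 𝓝 k, f ((extChartAt I p).symm (g z)) = h z) (w : V') :
    (mfderiv I 𝓘(ℝ, V) f p (g' w : F) : V) = h' w := by
  let D : F →L[ℝ] V := mfderiv I 𝓘(ℝ, V) f p
  have h1 : HasFDerivWithinAt (f ∘ (extChartAt I p).symm) D (range I) (extChartAt I p p) :=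
    hf.hasMFDerivAt.2
  rw [I.range_eq_univ, hasFDerivWithinAt_univ] at h1
  rw [← hgk] at h1
  have h3 := (h1.comp k hg).congr_of_eventuallyEq (heq.mono fun z hz ↦ hz.symm)
  exact congrArg (fun l ↦ l w) (h3.unique hh)

end Calculus

section Charts

variable {E : Type*} [NormedAddCommGroup E] [NormedSpace ℝ E]
  {M : Type*} [TopologicalSpace M] [ChartedSpace E M] {π : M → ℝ}

namespace FibredChart

variable (ψ : FibredChart E π)

theorem contMDiffAt_chart_symm {y : ℝ × Fib E} (hy : y ∈ ψ.chart.target) :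
    ContMDiffAt 𝓘(ℝ, ℝ × Fib E) 𝓘(ℝ, E) ∞ ψ.chart.symm y :=
  ψ.contMDiffOn_symm.contMDiffAt (ψ.chart.open_target.mem_nhds hy)

theorem dinv_eq_mfderiv_symm {y : ℝ × Fib E} (hy : y ∈ ψ.chart.target) (w : ℝ × Fib E) :
    ψ.dinv (ψ.chart.symm y) w = mfderiv 𝓘(ℝ, ℝ × Fib E) 𝓘(ℝ, E) ψ.chart.symm y w := by
  have h := ψ.mdiff.comp_symm_deriv hy
  have h1 : ψ.d (ψ.chart.symm y) (mfderiv 𝓘(ℝ, ℝ × Fib E) 𝓘(ℝ, E) ψ.chart.symm y w) = w :=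
    congrArg (fun f ↦ f w) h
  rw [← ψ.dinv_d (ψ.chart.map_target hy)
    (mfderiv 𝓘(ℝ, ℝ × Fib E) 𝓘(ℝ, E) ψ.chart.symm y w), h1]

/-- The coordinate change from a fibred chart to the preferred chart of `M` at `x`. -/
def toModel (x : M) (y : ℝ × Fib E) : E := chartAt E x (ψ.chart.symm y)

/-- The coordinate change from the preferred chart of `M` at `x` to a fibred chart. -/
def ofModel (x : M) (e : E) : ℝ × Fib E := ψ.chart ((chartAt E x).symm e)

/-- The points at which the coordinate change `toModel` is defined. -/
def overlap (x : M) : Set (ℝ × Fib E) := ψ.chart.target ∩ ψ.chart.symm ⁻¹' (chartAt E x).source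

theorem isOpen_overlap (x : M) : IsOpen (ψ.overlap x) :=
  ψ.chart.symm.isOpen_inter_preimage (chartAt E x).open_source

theorem chart_mem_overlap {x : M} (hx : x ∈ ψ.chart.source) : ψ.chart x ∈ ψ.overlap x :=
  ⟨ψ.chart.map_source hx, by simp [ψ.chart.left_inv hx]⟩

theorem ofModel_toModel {x : M} {y : ℝ × Fib E} (hy : y ∈ ψ.overlap x) :
    ψ.ofModel x (ψ.toModel x y) = y := by
  simp only [ofModel, toModel]
  rw [(chartAt E x).left_inv hy.2, ψ.chart.right_inv hy.1]

theorem symm_mem_overlap {y : ℝ × Fib E} (hy : y ∈ ψ.chart.target) :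
    y ∈ ψ.overlap (ψ.chart.symm y) := ⟨hy, mem_chart_source E _⟩

theorem toModel_mem {x : M} {y : ℝ × Fib E} (hy : y ∈ ψ.overlap x) : ψ.toModel x y ∈
    (chartAt E x).target ∩ (chartAt E x).symm ⁻¹' ψ.chart.source := by
  refine ⟨(chartAt E x).map_source hy.2, ?_⟩
  simp only [toModel, mem_preimage]
  rw [(chartAt E x).left_inv hy.2]
  exact ψ.chart.map_target hy.1

theorem dinv_bijective {x : M} (hx : x ∈ ψ.chart.source) : Function.Bijective (ψ.dinv x) :=
  ⟨fun a b h ↦ by rw [← ψ.d_dinv hx a, h, ψ.d_dinv hx], fun u ↦ ⟨ψ.d x u, ψ.dinv_d hx u⟩⟩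

variable [IsManifold 𝓘(ℝ, E) ∞ M]

theorem contDiffOn_toModel (x : M) : ContDiffOn ℝ ∞ (ψ.toModel x) (ψ.overlap x) := by
  rw [← contMDiffOn_iff_contDiffOn]
  exact contMDiffOn_chart.comp (ψ.contMDiffOn_symm.mono fun y hy ↦ hy.1) fun y hy ↦ hy.2

theorem contDiffAt_toModel {x : M} {y : ℝ × Fib E} (hy : y ∈ ψ.overlap x) :
    ContDiffAt ℝ ∞ (ψ.toModel x) y :=
  (ψ.contDiffOn_toModel x).contDiffAt ((ψ.isOpen_overlap x).mem_nhds hy)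

theorem contDiffOn_ofModel (x : M) : ContDiffOn ℝ ∞ (ψ.ofModel x)
    ((chartAt E x).target ∩ (chartAt E x).symm ⁻¹' ψ.chart.source) := by
  rw [← contMDiffOn_iff_contDiffOn]
  exact ψ.contMDiffOn.comp (contMDiffOn_chart_symm.mono fun y hy ↦ hy.1) fun y hy ↦ hy.2

theorem contDiffAt_ofModel {x : M} {y : ℝ × Fib E} (hy : y ∈ ψ.overlap x) :
    ContDiffAt ℝ ∞ (ψ.ofModel x) (ψ.toModel x y) :=
  (ψ.contDiffOn_ofModel x).contDiffAt
    (((chartAt E x).symm.isOpen_inter_preimage ψ.chart.open_source).mem_nhds (ψ.toModel_mem hy))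

theorem mfderiv_chartAt_dinv {x : M} {y : ℝ × Fib E} (hy : y ∈ ψ.overlap x) (w : ℝ × Fib E) :
    mfderiv 𝓘(ℝ, E) 𝓘(ℝ, E) (chartAt E x) (ψ.chart.symm y) (ψ.dinv (ψ.chart.symm y) w) =
      fderiv ℝ (ψ.toModel x) y w := by
  rw [ψ.dinv_eq_mfderiv_symm hy.1, ← mfderiv_eq_fderiv]
  have h1 : MDifferentiableAt 𝓘(ℝ, E) 𝓘(ℝ, E) (chartAt E x) (ψ.chart.symm y) :=
    mdifferentiableAt_atlas (chart_mem_atlas _ _) hy.2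
  have h2 : MDifferentiableAt 𝓘(ℝ, ℝ × Fib E) 𝓘(ℝ, E) ψ.chart.symm y :=
    (ψ.contMDiffAt_chart_symm hy.1).mdifferentiableAt (by simp)
  exact (congrArg (fun f ↦ f w) (mfderiv_comp y h1 h2)).symm

theorem toModel_fderiv_comp {x : M} {y : ℝ × Fib E} (hy : y ∈ ψ.overlap x) (w : ℝ × Fib E) :
    fderiv ℝ (ψ.ofModel x) (ψ.toModel x y) (fderiv ℝ (ψ.toModel x) y w) = w := by
  have h1 := ((ψ.contDiffAt_ofModel hy).differentiableAt (by simp)).hasFDerivAt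
  have h2 := ((ψ.contDiffAt_toModel hy).differentiableAt (by simp)).hasFDerivAt
  have h3 : (id : ℝ × Fib E → ℝ × Fib E) =ᶠ[𝓝 y] ψ.ofModel x ∘ ψ.toModel x := by
    filter_upwards [(ψ.isOpen_overlap x).mem_nhds hy] with z hz
    exact (ψ.ofModel_toModel hz).symm
  have h4 := (h1.comp y h2).congr_of_eventuallyEq h3
  exact congrArg (fun f ↦ f w) (h4.unique (hasFDerivAt_id y))

theorem fderiv_toModel_surjective {x : M} {y : ℝ × Fib E} (hy : y ∈ ψ.overlap x) :
    Function.Surjective (fderiv ℝ (ψ.toModel x) y) := by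
  intro e
  obtain ⟨u, hu⟩ := ((mdifferentiable_chart (I := 𝓘(ℝ, E)) x).mfderiv_bijective hy.2).2 e
  obtain ⟨w, rfl⟩ := (ψ.dinv_bijective (ψ.chart.map_target hy.1)).2 u
  exact ⟨w, (ψ.mfderiv_chartAt_dinv hy w).symm.trans hu⟩

/-- Mathlib identifies `T_xM` with `E` by means of the preferred chart at `x`. -/
theorem mfderiv_chartAt_self (x : M) (u : TangentSpace 𝓘(ℝ, E) x) :
    mfderiv 𝓘(ℝ, E) 𝓘(ℝ, E) (chartAt E x) x u = u := by
  rw [mfderiv_chartAt_eq_tangentCoordChange (mem_chart_source E x)]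
  exact tangentCoordChange_self (I := 𝓘(ℝ, E)) (v := (u : E)) (mem_extChartAt_source x)

theorem mfderiv_chartAt_dinv_of_mem {x z : M} (hz : z ∈ ψ.chart.source)
    (hz' : z ∈ (chartAt E x).source) (w : ℝ × Fib E) :
    (mfderiv 𝓘(ℝ, E) 𝓘(ℝ, E) (chartAt E x) z (ψ.dinv z w) : E) =
      fderiv ℝ (ψ.toModel x) (ψ.chart z) w := by
  have hz1 : ψ.chart z ∈ ψ.overlap x :=
    ⟨ψ.chart.map_source hz, by simpa [ψ.chart.left_inv hz] using hz'⟩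
  have h := ψ.mfderiv_chartAt_dinv hz1 w
  rw [ψ.chart.left_inv hz] at h
  exact h

theorem dinv_eq_fderiv_toModel {y : ℝ × Fib E} (hy : y ∈ ψ.chart.target) (w : ℝ × Fib E) :
    (ψ.dinv (ψ.chart.symm y) w : E) = fderiv ℝ (ψ.toModel (ψ.chart.symm y)) y w := by
  rw [← ψ.mfderiv_chartAt_dinv (ψ.symm_mem_overlap hy)]
  exact (mfderiv_chartAt_self (ψ.chart.symm y) (ψ.dinv (ψ.chart.symm y) w)).symm

theorem contDiffAt_fderiv_toModel {x : M} {y : ℝ × Fib E} (hy : y ∈ ψ.overlap x) :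
    ContDiffAt ℝ ∞ (fderiv ℝ (ψ.toModel x)) y :=
  (ψ.contDiffAt_toModel hy).fderiv_right (m := ∞) (by simp)

theorem hasFDerivAt_toModel {x : M} {y : ℝ × Fib E} (hy : y ∈ ψ.overlap x) :
    HasFDerivAt (ψ.toModel x) (fderiv ℝ (ψ.toModel x) y) y :=
  ((ψ.contDiffAt_toModel hy).differentiableAt (by simp)).hasFDerivAt

theorem hasFDerivAt_fderiv_toModel {x : M} {y : ℝ × Fib E} (hy : y ∈ ψ.overlap x) :
    HasFDerivAt (fderiv ℝ (ψ.toModel x)) (fderiv ℝ (fderiv ℝ (ψ.toModel x)) y) y :=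
  ((ψ.contDiffAt_fderiv_toModel hy).differentiableAt (by simp)).hasFDerivAt

theorem fderiv_fderiv_toModel_symm {x : M} {y : ℝ × Fib E} (hy : y ∈ ψ.overlap x)
    (u w : ℝ × Fib E) : fderiv ℝ (fderiv ℝ (ψ.toModel x)) y u w =
      fderiv ℝ (fderiv ℝ (ψ.toModel x)) y w u :=
  ((ψ.contDiffAt_toModel hy).isSymmSndFDerivAt (by simp [ENat.LEInfty.out])).eq u w

theorem toModel_fderiv_injective {x : M} {y : ℝ × Fib E} (hy : y ∈ ψ.overlap x) :
    Function.Injective (fderiv ℝ (ψ.toModel x) y) :=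
  Function.LeftInverse.injective (ψ.toModel_fderiv_comp hy)

end FibredChart

variable [IsManifold 𝓘(ℝ, E) ∞ M]

theorem extChartAt_tangentBundle_apply (v z : TangentBundle 𝓘(ℝ, E) M)
    (hz : z.proj ∈ (chartAt E v.proj).source) :
    extChartAt 𝓘(ℝ, E).tangent v z = (chartAt E v.proj z.proj,
      mfderiv 𝓘(ℝ, E) 𝓘(ℝ, E) (chartAt E v.proj) z.proj z.2) := by
  rw [mfderiv_chartAt_eq_tangentCoordChange hz]
  rfl

theorem extChartAt_cotangent_snd (p z : Cotangent E M)
    (hz : z.proj ∈ (chartAt E p.proj).source) (u : TangentSpace 𝓘(ℝ, E) z.proj) :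
    (extChartAt (cotModel E) p z).2
      (mfderiv 𝓘(ℝ, E) 𝓘(ℝ, E) (chartAt E p.proj) z.proj u) = z.2 u := by
  have h : (extChartAt (cotModel E) p z).2 = ContinuousLinearMap.inCoordinates E
      (TangentSpace 𝓘(ℝ, E)) ℝ (Bundle.Trivial M ℝ) p.proj z.proj p.proj z.proj z.2 :=
    congrArg Prod.snd (hom_chart p z)
  have h1 : (trivializationAt E (TangentSpace 𝓘(ℝ, E)) p.proj).symmL ℝ z.proj
      (mfderiv 𝓘(ℝ, E) 𝓘(ℝ, E) (chartAt E p.proj) z.proj u) = u := by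
    rw [mfderiv_chartAt_eq_tangentCoordChange hz]
    have h2 := (trivializationAt E (TangentSpace 𝓘(ℝ, E)) p.proj).symmL_continuousLinearMapAt
      (R := ℝ) (b := z.proj) hz u
    rwa [TangentBundle.continuousLinearMapAt_trivializationAt_eq_core hz] at h2
  have h3 (w : E) : ContinuousLinearMap.inCoordinates E
      (TangentSpace 𝓘(ℝ, E)) ℝ (Bundle.Trivial M ℝ) p.proj z.proj p.proj z.proj z.2 w =
      z.2 ((trivializationAt E (TangentSpace 𝓘(ℝ, E)) p.proj).symmL ℝ z.proj w) := by
    simp [ContinuousLinearMap.inCoordinates]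
  rw [h]
  exact (h3 _).trans (congrArg _ h1)

namespace FibredChart

variable [FiniteDimensional ℝ E] [IsFibration E π] (ψ : FibredChart E π)

/-- The coordinates `(t, qⁱ, q̇ⁱ)` of `J¹π`, as a homeomorphism between open sets. -/
def jetChart : OpenPartialHomeomorph (Jet E π) (JModel E) :=
  (jetCore E π).openPartialHomeomorph ψ.jet ⟨ψ, rfl⟩

/-- The coordinates `(t, qⁱ, pᵢ)` of `V^*π`, as a homeomorphism between open sets. -/
def dualChart : OpenPartialHomeomorph (VDual E π) (VModel E) :=
  (dualCore E π).openPartialHomeomorph ψ.dual ⟨ψ, rfl⟩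

theorem jetChart_mem_maximalAtlas :
    ψ.jetChart ∈ IsManifold.maximalAtlas 𝓘(ℝ, JModel E) ∞ (Jet E π) := by
  refine IsManifold.subset_maximalAtlas ?_
  simp only [atlas, ChartedSpace.atlas, jetCore, mem_iUnion]
  exact ⟨_, ⟨ψ, rfl⟩, rfl⟩

theorem dualChart_mem_maximalAtlas :
    ψ.dualChart ∈ IsManifold.maximalAtlas 𝓘(ℝ, VModel E) ∞ (VDual E π) := by
  refine IsManifold.subset_maximalAtlas ?_
  simp only [atlas, ChartedSpace.atlas, dualCore, mem_iUnion]
  exact ⟨_, ⟨ψ, rfl⟩, rfl⟩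

theorem jetChart_apply (v : Jet E π) :
    ψ.jetChart v = (ψ.chart v.1.proj, (ψ.d v.1.proj v.1.2).2) := rfl

theorem jetChart_source : ψ.jetChart.source = {v | v.1.proj ∈ ψ.chart.source} := rfl

theorem jetChart_symm_snd {y : JModel E} (hy : y.1 ∈ ψ.chart.target) :
    (ψ.jetChart.symm y).1.2 = ψ.dinv (ψ.chart.symm y.1) (1, y.2) := by
  change ψ.dinv (ψ.chart.symm y.1) (1, y.2) + (1 - clock E π (ψ.chart.symm y.1)
    (ψ.dinv (ψ.chart.symm y.1) (1, y.2))) • unitVec E π (ψ.chart.symm y.1) = _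
  rw [ψ.clock_dinv (ψ.chart.map_target hy)]
  simp

theorem dualChart_apply_snd {a : VDual E π} (ha : a.base ∈ ψ.chart.source) (u : Fib E) :
    (ψ.dualChart a).2 u = a.form ⟨ψ.dinv a.base (0, u), by
      simp [Vert, ψ.clock_dinv ha]⟩ := by
  change a.form (vertProj E π a.base (ψ.dinv a.base (0, u))) = _
  congr 1
  exact Subtype.ext (vertProj_eq (by rw [ψ.clock_dinv ha]))

theorem contMDiffAt_jetChart {v : Jet E π} (hv : v.1.proj ∈ ψ.chart.source) :
    ContMDiffAt 𝓘(ℝ, JModel E) 𝓘(ℝ, JModel E) ∞ ψ.jetChart v :=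
  contMDiffAt_of_mem_maximalAtlas ψ.jetChart_mem_maximalAtlas hv

theorem contMDiffAt_jetChart_symm {y : JModel E} (hy : y.1 ∈ ψ.chart.target) :
    ContMDiffAt 𝓘(ℝ, JModel E) 𝓘(ℝ, JModel E) ∞ ψ.jetChart.symm y :=
  contMDiffAt_symm_of_mem_maximalAtlas ψ.jetChart_mem_maximalAtlas hy

theorem contMDiffAt_dualChart {a : VDual E π} (ha : a.base ∈ ψ.chart.source) :
    ContMDiffAt 𝓘(ℝ, VModel E) 𝓘(ℝ, VModel E) ∞ ψ.dualChart a :=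
  contMDiffAt_of_mem_maximalAtlas ψ.dualChart_mem_maximalAtlas ha

theorem contMDiffAt_dualChart_symm {y : VModel E} (hy : y.1 ∈ ψ.chart.target) :
    ContMDiffAt 𝓘(ℝ, VModel E) 𝓘(ℝ, VModel E) ∞ ψ.dualChart.symm y :=
  contMDiffAt_symm_of_mem_maximalAtlas ψ.dualChart_mem_maximalAtlas hy

end FibredChart

end Charts

/-! ### Images of embeddings and sections -/

section Submanifolds

/-- Smoothness of a map can be checked in any smooth coordinates `r` on the source and `s⁻¹` on the
target. -/
theorem contMDiffAt_of_factor {V F : Type*} [NormedAddCommGroup V] [NormedSpace ℝ V]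
    [NormedAddCommGroup F] [NormedSpace ℝ F]
    {E₁ H₁ N₁ : Type*} [NormedAddCommGroup E₁] [NormedSpace ℝ E₁] [TopologicalSpace H₁]
    {I₁ : ModelWithCorners ℝ E₁ H₁} [TopologicalSpace N₁] [ChartedSpace H₁ N₁]
    {E₂ H₂ N₂ : Type*} [NormedAddCommGroup E₂] [NormedSpace ℝ E₂] [TopologicalSpace H₂]
    {I₂ : ModelWithCorners ℝ E₂ H₂} [TopologicalSpace N₂] [ChartedSpace H₂ N₂]
    {f : N₁ → N₂} {x : N₁} {r : N₁ → V} {g : V → F} {s : F → N₂}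
    (hr : ContMDiffAt I₁ 𝓘(ℝ, V) ∞ r x) (hg : ContDiffAt ℝ ∞ g (r x))
    (hs : ContMDiffAt 𝓘(ℝ, F) I₂ ∞ s (g (r x))) (h : ∀ᶠ z in 𝓝 x, f z = s (g (r z))) :
    ContMDiffAt I₁ I₂ ∞ f x :=
  (hs.comp x (hg.contMDiffAt.comp x hr)).congr_of_eventuallyEq h

variable {E₁ N₁ : Type*} [NormedAddCommGroup E₁] [NormedSpace ℝ E₁]
    [TopologicalSpace N₁] [ChartedSpace E₁ N₁]
    {E₂ N₂ : Type*} [NormedAddCommGroup E₂] [NormedSpace ℝ E₂]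
    [TopologicalSpace N₂] [ChartedSpace E₂ N₂] [IsManifold 𝓘(ℝ, E₂) 1 N₂]

theorem mfderiv_symm_bijective_of_mem_maximalAtlas {e : OpenPartialHomeomorph N₁ E₁}
    (he : e ∈ IsManifold.maximalAtlas 𝓘(ℝ, E₁) ∞ N₁) {y : E₁} (hy : y ∈ e.target) :
    Function.Bijective (mfderiv 𝓘(ℝ, E₁) 𝓘(ℝ, E₁) e.symm y) :=
  OpenPartialHomeomorph.MDifferentiable.mfderiv_bijective (e := e.symm)
    ⟨(contMDiffOn_symm_of_mem_maximalAtlas he).mdifferentiableOn (by simp),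
      (contMDiffOn_of_mem_maximalAtlas he).mdifferentiableOn (by simp)⟩ hy

variable [IsManifold 𝓘(ℝ, E₁) ∞ N₁]

/-- The tangent space of the image of an embedding `σ` with a smooth left inverse is the range
of the tangent map of `σ`. -/
theorem tangentOf_range {σ : N₁ → N₂} {r : N₂ → N₁} (hσ : ContMDiff 𝓘(ℝ, E₁) 𝓘(ℝ, E₂) ∞ σ)
    (hr : ContMDiff 𝓘(ℝ, E₂) 𝓘(ℝ, E₁) ∞ r) (hrσ : Function.LeftInverse r σ) (n : N₁) :
    tangentOf (range σ) (σ n) = (mfderiv 𝓘(ℝ, E₁) 𝓘(ℝ, E₂) σ n).range := by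
  apply le_antisymm
  · refine Submodule.span_le.2 ?_
    rintro w ⟨γ, hγ, hC, hw⟩
    have h0 : γ 0 = σ n := congrArg (fun z : TangentBundle 𝓘(ℝ, E₂) N₂ ↦ z.proj) hw
    -- A curve in the image of `σ` is the image under `σ` of the smooth curve `r ∘ γ`.
    have h1 : γ =ᶠ[𝓝 0] σ ∘ (r ∘ γ) := by
      filter_upwards [hC]
      rintro s ⟨m, hm⟩
      simp only [Function.comp_apply, ← hm, hrσ m]
    have h2 : MDifferentiableAt 𝓘(ℝ, ℝ) 𝓘(ℝ, E₁) (r ∘ γ) 0 :=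
      ((hr.contMDiffAt).comp 0 hγ).mdifferentiableAt (by simp)
    have h3 : mfderiv 𝓘(ℝ, ℝ) 𝓘(ℝ, E₂) γ 0 =
        mfderiv 𝓘(ℝ, ℝ) 𝓘(ℝ, E₂) (σ ∘ (r ∘ γ)) 0 := h1.mfderiv_eq
    have h4 := mfderiv_comp 0 (hσ.contMDiffAt.mdifferentiableAt (by simp)) h2
    have h5 : (⟨γ 0, mfderiv 𝓘(ℝ, ℝ) 𝓘(ℝ, E₂) γ 0 (1 : ℝ)⟩ : TangentBundle 𝓘(ℝ, E₂) N₂) =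
        tangentMap 𝓘(ℝ, E₁) 𝓘(ℝ, E₂) σ ⟨r (γ 0), mfderiv 𝓘(ℝ, ℝ) 𝓘(ℝ, E₁) (r ∘ γ) 0 (1 : ℝ)⟩ := by
      have h6 (p q : N₂) (hpq : p = q) (a : TangentSpace 𝓘(ℝ, E₂) p) :
          (⟨p, a⟩ : TangentBundle 𝓘(ℝ, E₂) N₂) = ⟨q, (a : E₂)⟩ := by subst hpq; rfl
      rw [h3, h4]
      exact h6 _ _ h1.self_of_nhds _
    obtain ⟨m, u, hm, hu⟩ : ∃ (m : N₁) (u : TangentSpace 𝓘(ℝ, E₁) m), m = n ∧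
        (⟨σ n, w⟩ : TangentBundle 𝓘(ℝ, E₂) N₂) = tangentMap 𝓘(ℝ, E₁) 𝓘(ℝ, E₂) σ ⟨m, u⟩ :=
      ⟨r (γ 0), _, by rw [h0, hrσ], hw.symm.trans h5⟩
    subst hm
    simp only [tangentMap, Bundle.TotalSpace.mk_inj] at hu
    exact ⟨u, hu.symm⟩
  · rintro _ ⟨u, rfl⟩
    obtain ⟨e, he, hn⟩ : ∃ e ∈ IsManifold.maximalAtlas 𝓘(ℝ, E₁) ∞ N₁, n ∈ e.source :=
      ⟨chartAt E₁ n, IsManifold.chart_mem_maximalAtlas n, mem_chart_source E₁ n⟩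
    obtain ⟨y, hy, rfl⟩ : ∃ y ∈ e.target, e.symm y = n := ⟨e n, e.map_source hn, e.left_inv hn⟩
    obtain ⟨(w : E₁), rfl⟩ := (mfderiv_symm_bijective_of_mem_maximalAtlas he hy).2 u
    have hs := contMDiffAt_symm_of_mem_maximalAtlas he hy
    -- Conversely, a tangent vector is the velocity of a straight line in a chart.
    let l : ℝ → E₁ := fun s ↦ y + s • w
    have hl0 : l 0 = y := by simp [l]
    have hl : ContDiff ℝ ∞ l := by fun_prop
    have hl1 : HasFDerivAt l (ContinuousLinearMap.toSpanSingleton ℝ w) 0 := by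
      have h := ((hasDerivAt_id (0 : ℝ)).smul_const w).const_add y
      rw [one_smul] at h
      exact h.hasFDerivAt
    have hg : ContMDiffAt 𝓘(ℝ, E₁) 𝓘(ℝ, E₂) ∞ (σ ∘ e.symm) y := hσ.contMDiffAt.comp y hs
    have hg' : ContMDiffAt 𝓘(ℝ, E₁) 𝓘(ℝ, E₂) ∞ (σ ∘ e.symm) (l 0) := by rwa [hl0]
    refine Submodule.subset_span ⟨(σ ∘ e.symm) ∘ l, hg'.comp 0 hl.contMDiff.contMDiffAt,
      Filter.Eventually.of_forall fun s ↦ ⟨_, rfl⟩, ?_⟩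
    have h1 := mfderiv_comp 0 (hg'.mdifferentiableAt (by simp)) hl1.hasMFDerivAt.mdifferentiableAt
    rw [h1, hl1.hasMFDerivAt.mfderiv]
    have h2 (q : E₁) (hq : q = y) (u : ℝ) (hu : u = 1) : (⟨σ (e.symm q),
        mfderiv 𝓘(ℝ, E₁) 𝓘(ℝ, E₂) (σ ∘ e.symm) q (u • w)⟩ : TangentBundle 𝓘(ℝ, E₂) N₂) =
        ⟨σ (e.symm y), mfderiv 𝓘(ℝ, E₁) 𝓘(ℝ, E₂) σ (e.symm y)
          (mfderiv 𝓘(ℝ, E₁) 𝓘(ℝ, E₁) e.symm y w)⟩ := by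
      subst hq hu
      rw [mfderiv_comp q (hσ.contMDiffAt.mdifferentiableAt (by simp))
        (hs.mdifferentiableAt (by simp)), one_smul]
      rfl
    exact h2 _ hl0 _ rfl

end Submanifolds

section Sections

variable {E : Type*} [NormedAddCommGroup E] [NormedSpace ℝ E] [FiniteDimensional ℝ E]
  {M : Type*} [TopologicalSpace M] [ChartedSpace E M] [IsManifold 𝓘(ℝ, E) ∞ M]
  {π : M → ℝ} [IsFibration E π]

theorem contMDiff_jet_proj : ContMDiff 𝓘(ℝ, JModel E) 𝓘(ℝ, E) ∞
    (fun v : Jet E π ↦ v.1.proj) := by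
  intro v
  obtain ⟨ψ, hψ⟩ := exists_fibredChart (E := E) π v.1.proj
  refine contMDiffAt_of_factor (ψ.contMDiffAt_jetChart hψ) contDiff_fst.contDiffAt
    (ψ.contMDiffAt_chart_symm (ψ.chart.map_source hψ)) ?_
  filter_upwards [ψ.jetChart.open_source.mem_nhds hψ] with w hw
  exact (ψ.chart.left_inv hw).symm

/-- The image of a smooth section of `J¹π → M` is a submanifold: subtracting the section straightens
it in the coordinates `(t, qⁱ, q̇ⁱ)`. -/
theorem isEmbeddedSubmanifold_range_section {s : M → Jet E π}
    (hs : ContMDiff 𝓘(ℝ, E) 𝓘(ℝ, JModel E) ∞ s) (hproj : ∀ x, (s x).1.proj = x) :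
    IsEmbeddedSubmanifold (JModel E) (range s) := by
  rintro _ ⟨x, rfl⟩
  obtain ⟨ψ, hψ⟩ := exists_fibredChart (E := E) π x
  let r : ℝ × Fib E → Fib E := fun y ↦ (ψ.jetChart (s (ψ.chart.symm y))).2
  have hr : ContDiffOn ℝ ∞ r ψ.chart.target := by
    intro y hy
    have h1 := (hs.contMDiffAt (x := ψ.chart.symm y)).comp y (ψ.contMDiffAt_chart_symm hy)
    have h2 : (s (ψ.chart.symm y)).1.proj ∈ ψ.chart.source := by
      rw [hproj]; exact ψ.chart.map_target hy
    have h3 := contMDiffAt_iff_contDiffAt.1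
      (ContMDiffAt.comp y (g := ψ.jetChart) (ψ.contMDiffAt_jetChart h2) h1)
    exact (contDiffAt_snd.comp y h3).contDiffWithinAt
  have hr' : ContDiffOn ℝ ∞ (fun p : JModel E ↦ r p.1) (ψ.chart.target ×ˢ univ) :=
    hr.comp contDiffOn_fst fun p hp ↦ hp.1
  let sh : OpenPartialHomeomorph (JModel E) (JModel E) :=
    { toFun := fun p ↦ (p.1, p.2 - r p.1)
      invFun := fun p ↦ (p.1, p.2 + r p.1)
      source := ψ.chart.target ×ˢ univ
      target := ψ.chart.target ×ˢ univ
      map_source' := fun p hp ↦ ⟨hp.1, trivial⟩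
      map_target' := fun p hp ↦ ⟨hp.1, trivial⟩
      left_inv' := fun p _ ↦ by simp
      right_inv' := fun p _ ↦ by simp
      open_source := ψ.chart.open_target.prod isOpen_univ
      open_target := ψ.chart.open_target.prod isOpen_univ
      continuousOn_toFun := continuousOn_fst.prodMk (continuousOn_snd.sub hr'.continuousOn)
      continuousOn_invFun := continuousOn_fst.prodMk (continuousOn_snd.add hr'.continuousOn) }
  have h1 : ContDiffOn ℝ ∞ sh (ψ.chart.target ×ˢ univ) :=
    contDiffOn_fst.prodMk (contDiffOn_snd.sub hr')
  have h2 : ContDiffOn ℝ ∞ sh.symm (ψ.chart.target ×ˢ univ) :=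
    contDiffOn_fst.prodMk (contDiffOn_snd.add hr')
  have hm := ψ.jetChart_mem_maximalAtlas
  have hsrc : (ψ.jetChart.trans sh).source = ψ.jetChart.source := by
    ext v
    exact ⟨fun h ↦ h.1, fun h ↦ ⟨h, ψ.chart.map_source h, trivial⟩⟩
  have h3 := contMDiffOn_of_mem_maximalAtlas hm
  have h4 := contMDiffOn_symm_of_mem_maximalAtlas hm
  refine ⟨ψ.jetChart.trans sh, ?_, ?_, LinearMap.ker (LinearMap.snd ℝ (ℝ × Fib E) (Fib E)), ?_⟩
  · exact OpenPartialHomeomorph.mem_maximalAtlas_of_contMDiffOn _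
      (h1.contMDiffOn.comp (h3.mono fun v hv ↦ hv.1) fun v hv ↦ hv.2)
      (h4.comp (h2.contMDiffOn.mono fun v hv ↦ hv.1) fun v hv ↦ hv.2)
  · rw [hsrc, ψ.jetChart_source, mem_ofPred_eq, hproj]
    exact hψ
  · intro v hv
    rw [hsrc] at hv
    have hv' : v.1.proj ∈ ψ.chart.source := hv
    have h3 : ψ.chart.symm (ψ.jetChart v).1 = v.1.proj := ψ.chart.left_inv hv'
    have h4 : (ψ.jetChart.trans sh) v = ((ψ.jetChart v).1,
        (ψ.jetChart v).2 - (ψ.jetChart (s v.1.proj)).2) := by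
      rw [← h3]; rfl
    rw [h4, LinearMap.mem_ker, LinearMap.snd_apply, sub_eq_zero]
    constructor
    · rintro ⟨x', rfl⟩
      rw [hproj]
    · intro h5
      refine ⟨v.1.proj, ?_⟩
      have h6 : s v.1.proj ∈ ψ.jetChart.source := by
        rw [ψ.jetChart_source, mem_ofPred_eq, hproj]; exact hv'
      refine ψ.jetChart.injOn h6 hv (Prod.ext ?_ h5.symm)
      simp only [ψ.jetChart_apply, hproj]

end Sections

/-! ### Coordinates of the inclusion `J¹π ⊂ TM` and of `μ` -/

section Inclusion

variable {E : Type*} [NormedAddCommGroup E] [NormedSpace ℝ E]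
  {M : Type*} [TopologicalSpace M] [ChartedSpace E M] [IsManifold 𝓘(ℝ, E) ∞ M] {π : M → ℝ}

namespace FibredChart

variable (ψ : FibredChart E π)

/-- The inclusion `J¹π ⊆ TM` in the coordinates `(t, qⁱ, q̇ⁱ)` and in the coordinates of `TM` that
are induced by the preferred chart of `M` at `x`. -/
def inclModel (x : M) (y : JModel E) : E × E :=
  (ψ.toModel x y.1, fderiv ℝ (ψ.toModel x) y.1 (1, y.2))

theorem contDiffAt_inclModel {x : M} {y : JModel E} (hy : y.1 ∈ ψ.overlap x) :
    ContDiffAt ℝ ∞ (ψ.inclModel x) y :=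
  ((ψ.contDiffAt_toModel hy).comp y contDiffAt_fst).prodMk
    (((ψ.contDiffAt_fderiv_toModel hy).comp y contDiffAt_fst).clm_apply
      (contDiffAt_const.prodMk contDiffAt_snd))

theorem fderiv_inclModel {x : M} {y : JModel E} (hy : y.1 ∈ ψ.overlap x) (w : JModel E) :
    fderiv ℝ (ψ.inclModel x) y w = (fderiv ℝ (ψ.toModel x) y.1 w.1,
      fderiv ℝ (fderiv ℝ (ψ.toModel x)) y.1 w.1 (1, y.2) +
        fderiv ℝ (ψ.toModel x) y.1 (0, w.2)) := by
  have h1 := (ψ.hasFDerivAt_toModel hy).comp y hasFDerivAt_fst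
  have h2 := (ψ.hasFDerivAt_fderiv_toModel hy).comp y hasFDerivAt_fst
  have h3 : HasFDerivAt (fun z : JModel E ↦ ((1, z.2) : ℝ × Fib E))
      ((0 : JModel E →L[ℝ] ℝ).prod (ContinuousLinearMap.snd ℝ (ℝ × Fib E) (Fib E))) y :=
    (hasFDerivAt_const _ _).prodMk hasFDerivAt_snd
  have h4 := h1.prodMk (h2.clm_apply h3)
  have h5 : HasFDerivAt (ψ.inclModel x) _ y := h4
  rw [h5.fderiv]
  simp [add_comm]

variable [FiniteDimensional ℝ E] [IsFibration E π]

theorem extChartAt_jetChart_symm {v : TangentBundle 𝓘(ℝ, E) M} {y : JModel E}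
    (hy : y.1 ∈ ψ.overlap v.proj) :
    extChartAt 𝓘(ℝ, E).tangent v (ψ.jetChart.symm y).1 = ψ.inclModel v.proj y := by
  rw [extChartAt_tangentBundle_apply _ _ hy.2, ψ.jetChart_symm_snd hy.1]
  exact Prod.ext rfl (ψ.mfderiv_chartAt_dinv hy _)

end FibredChart

variable [FiniteDimensional ℝ E] [IsFibration E π]

theorem contMDiff_jet_incl : ContMDiff 𝓘(ℝ, JModel E) 𝓘(ℝ, E).tangent ∞
    (fun v : Jet E π ↦ v.1) := by
  intro v
  obtain ⟨ψ, hψ⟩ := exists_fibredChart (E := E) π v.1.proj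
  have hmem : (ψ.jetChart v).1 ∈ ψ.overlap v.1.proj := ψ.chart_mem_overlap hψ
  have key : ∀ w : Jet E π, w.1.proj ∈ ψ.chart.source → w.1.proj ∈ (chartAt E v.1.proj).source →
      ψ.inclModel v.1.proj (ψ.jetChart w) = extChartAt 𝓘(ℝ, E).tangent v.1 w.1 := by
    intro w hw hw'
    rw [← ψ.extChartAt_jetChart_symm, ψ.jetChart.left_inv hw]
    exact ⟨ψ.chart.map_source hw, by simpa [ψ.jetChart_apply, ψ.chart.left_inv hw] using hw'⟩
  refine contMDiffAt_of_factor (ψ.contMDiffAt_jetChart hψ) (ψ.contDiffAt_inclModel hmem)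
    (s := (extChartAt 𝓘(ℝ, E).tangent v.1).symm) ?_ ?_
  · rw [key v hψ (mem_chart_source E _)]
    exact (contMDiffOn_extChartAt_symm v.1).contMDiffAt (extChartAt_target_mem_nhds v.1)
  · have h1 := contMDiff_jet_proj.continuous.continuousAt (x := v) |>.preimage_mem_nhds
      ((chartAt E v.1.proj).open_source.mem_nhds (mem_chart_source E _))
    filter_upwards [ψ.jetChart.open_source.mem_nhds hψ, h1] with w hw hw'
    rw [key w hw hw', PartialEquiv.left_inv]
    rw [extChartAt_source]
    simpa using hw'

namespace FibredChart

variable (ψ : FibredChart E π)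

/-- The tangent map of the inclusion `J¹π ⊆ TM` in the coordinates `(t, qⁱ, q̇ⁱ)`. -/
theorem dIncl_mfderiv_jetChart_symm {y : JModel E} (hy : y.1 ∈ ψ.chart.target) (w : JModel E) :
    (dIncl E π (ψ.jetChart.symm y)
      (mfderiv 𝓘(ℝ, JModel E) 𝓘(ℝ, JModel E) ψ.jetChart.symm y w) : E × E) =
      fderiv ℝ (ψ.inclModel (ψ.chart.symm y.1)) y w := by
  have h1 : MDifferentiableAt 𝓘(ℝ, JModel E) 𝓘(ℝ, E).tangent (fun v : Jet E π ↦ v.1)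
    (ψ.jetChart.symm y) := contMDiff_jet_incl.contMDiffAt.mdifferentiableAt (by simp)
  have h2 := (ψ.contMDiffAt_jetChart_symm hy).mdifferentiableAt (by simp)
  have h3 := mfderiv_comp y h1 h2
  have hmem := ψ.symm_mem_overlap hy
  have h4 := mfderiv_of_source_normedSpace (h1.comp y h2)
    ((ψ.contDiffAt_inclModel hmem).differentiableAt (by simp)).hasFDerivAt
    (by
      have hc : ContinuousAt (fun z : JModel E ↦ z.1) y := continuousAt_fst
      filter_upwards [hc.preimage_mem_nhds ((ψ.isOpen_overlap _).mem_nhds hmem)] with z hz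
      exact ψ.extChartAt_jetChart_symm (v := (ψ.jetChart.symm y).1) hz) w
  rw [← h4]
  exact (congrArg (fun l ↦ l w) h3).symm

theorem mfderiv_jetChart_symm_bijective {y : JModel E} (hy : y.1 ∈ ψ.chart.target) :
    Function.Bijective (mfderiv 𝓘(ℝ, JModel E) 𝓘(ℝ, JModel E) ψ.jetChart.symm y) :=
  mfderiv_symm_bijective_of_mem_maximalAtlas ψ.jetChart_mem_maximalAtlas hy

end FibredChart

theorem exists_fibredChart_jet (v : Jet E π) :
    ∃ (ψ : FibredChart E π) (y : JModel E), y.1 ∈ ψ.chart.target ∧ ψ.jetChart.symm y = v := by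
  obtain ⟨ψ, hψ⟩ := exists_fibredChart (E := E) π v.1.proj
  exact ⟨ψ, ψ.jetChart v, ψ.chart.map_source hψ, ψ.jetChart.left_inv hψ⟩

theorem dIncl_injective (v : Jet E π) : Function.Injective (dIncl E π v) := by
  obtain ⟨ψ, y, hy, rfl⟩ := exists_fibredChart_jet v
  rw [injective_iff_map_eq_zero]
  intro u hu
  obtain ⟨(w : JModel E), rfl⟩ := (ψ.mfderiv_jetChart_symm_bijective hy).2 u
  have hmem := ψ.symm_mem_overlap hy
  have h1 : fderiv ℝ (ψ.inclModel (ψ.chart.symm y.1)) y w = (0, 0) :=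
    (ψ.dIncl_mfderiv_jetChart_symm hy w).symm.trans hu
  rw [ψ.fderiv_inclModel hmem, Prod.mk.injEq] at h1
  have h2 : w.1 = 0 := ψ.toModel_fderiv_injective hmem (by rw [h1.1, map_zero])
  have h3 : ((0, w.2) : ℝ × Fib E) = 0 :=
    ψ.toModel_fderiv_injective hmem (by simpa [h2] using h1.2)
  have h4 : w = 0 := Prod.ext h2 (congrArg (Prod.snd : ℝ × Fib E → Fib E) h3)
  rw [h4]
  exact map_zero _

theorem extendCovector_dIncl (v : Jet E π) (α : TangentSpace 𝓘(ℝ, JModel E) v →L[ℝ] ℝ)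
    (u : TangentSpace 𝓘(ℝ, JModel E) v) : extendCovector v α (dIncl E π v u) = α u := by
  have h := LinearMap.leftInverse_apply_of_inj
    (LinearMap.ker_eq_bot.2 (dIncl_injective v) : (dIncl E π v).toLinearMap.ker = ⊥) u
  exact congrArg α h

end Inclusion

section Restriction

variable {E : Type*} [NormedAddCommGroup E] [NormedSpace ℝ E] [FiniteDimensional ℝ E]
  {M : Type*} [TopologicalSpace M] [ChartedSpace E M] [IsManifold 𝓘(ℝ, E) ∞ M]
  {π : M → ℝ} [IsFibration E π] (ψ : FibredChart E π)

theorem FibredChart.dualChart_dualRestrict (p z : Cotangent E M) (hz : z.proj ∈ ψ.chart.source)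
    (hz' : z.proj ∈ (chartAt E p.proj).source) :
    ψ.dualChart (dualRestrict E π z) = (ψ.chart z.proj,
      (extChartAt (cotModel E) p z).2 ∘L fderiv ℝ (ψ.toModel p.proj) (ψ.chart z.proj) ∘L
        ContinuousLinearMap.inr ℝ ℝ (Fib E)) := by
  refine Prod.ext rfl ?_
  ext1 u
  rw [ψ.dualChart_apply_snd hz]
  change z.2 (ψ.dinv z.proj (0, u)) = (extChartAt (cotModel E) p z).2
    (fderiv ℝ (ψ.toModel p.proj) (ψ.chart z.proj) (0, u))
  rw [← extChartAt_cotangent_snd p z hz', ψ.mfderiv_chartAt_dinv_of_mem hz hz']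

/-- The restriction `μ : T^*M → V^*π` of covectors is smooth. -/
theorem contMDiff_dualRestrict :
    ContMDiff (cotModel E) 𝓘(ℝ, VModel E) ∞ (dualRestrict E π : Cotangent E M → VDual E π) := by
  intro p
  obtain ⟨ψ, hψ⟩ := exists_fibredChart (E := E) π p.proj
  have hmem : ψ.chart p.proj ∈ ψ.overlap p.proj := ψ.chart_mem_overlap hψ
  have hp : ψ.toModel p.proj (ψ.chart p.proj) = chartAt E p.proj p.proj := by
    simp only [FibredChart.toModel, ψ.chart.left_inv hψ]
  let g : E × (E →L[ℝ] ℝ) → VModel E := fun e ↦ (ψ.ofModel p.proj e.1,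
    e.2 ∘L fderiv ℝ (ψ.toModel p.proj) (ψ.ofModel p.proj e.1) ∘L
      ContinuousLinearMap.inr ℝ ℝ (Fib E))
  have key (z : Cotangent E M) (hz : z.proj ∈ ψ.chart.source)
      (hz' : z.proj ∈ (chartAt E p.proj).source) :
      g (extChartAt (cotModel E) p z) = ψ.dualChart (dualRestrict E π z) := by
    have h1 : ψ.ofModel p.proj (chartAt E p.proj z.proj) = ψ.chart z.proj := by
      simp only [FibredChart.ofModel, (chartAt E p.proj).left_inv hz']
    rw [ψ.dualChart_dualRestrict p z hz hz', ← h1]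
    rfl
  refine contMDiffAt_of_factor (V := E × (E →L[ℝ] ℝ)) (g := g) contMDiffAt_extChartAt ?_
    (ψ.contMDiffAt_dualChart_symm ?_) ?_
  · have h1 : ContDiffAt ℝ ∞ (ψ.ofModel p.proj) (chartAt E p.proj p.proj) := by
      rw [← hp]; exact ψ.contDiffAt_ofModel hmem
    have h2 : ContDiffAt ℝ ∞ (fun e : E × (E →L[ℝ] ℝ) ↦ ψ.ofModel p.proj e.1)
        (extChartAt (cotModel E) p p) :=
      ContDiffAt.comp (extChartAt (cotModel E) p p) (g := ψ.ofModel p.proj) (f := Prod.fst) h1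
        contDiffAt_fst
    have h3 : ContDiffAt ℝ ∞ (fderiv ℝ (ψ.toModel p.proj))
        (ψ.ofModel p.proj (chartAt E p.proj p.proj)) := by
      rw [← hp, ψ.ofModel_toModel hmem]; exact ψ.contDiffAt_fderiv_toModel hmem
    have h4 := ContDiffAt.comp (extChartAt (cotModel E) p p)
      (f := fun e : E × (E →L[ℝ] ℝ) ↦ ψ.ofModel p.proj e.1) h3 h2
    exact h2.prodMk (contDiffAt_snd.clm_comp (h4.clm_comp contDiffAt_const))
  · rw [key p hψ (mem_chart_source E _)]
    exact ψ.chart.map_source hψ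
  · have hc : Continuous (fun z : Cotangent E M ↦ z.proj) := FiberBundle.continuous_proj _ _
    filter_upwards [hc.continuousAt.preimage_mem_nhds (ψ.chart.open_source.mem_nhds hψ),
      hc.continuousAt.preimage_mem_nhds
        ((chartAt E p.proj).open_source.mem_nhds (mem_chart_source E _))] with z hz hz'
    rw [key z hz hz']
    exact (ψ.dualChart.left_inv hz).symm

end Restriction

/-! ### The Tulczyjew map in coordinates -/

section Psi

variable {E : Type*} [NormedAddCommGroup E] [NormedSpace ℝ E]
  {M : Type*} [TopologicalSpace M] [ChartedSpace E M] [IsManifold 𝓘(ℝ, E) ∞ M]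

theorem canonicalForm_apply (α : Cotangent E M) (X Y : E × (E →L[ℝ] ℝ)) :
    canonicalForm α X Y = Y.2 X.1 - X.2 Y.1 := rfl

/-- The coordinates of a covector at `x` in the preferred chart at `x` are given by the covector
itself. -/
theorem extChartAt_cotangent_self_snd (p : Cotangent E M) :
    (extChartAt (cotModel E) p p).2 = (p.2 : E →L[ℝ] ℝ) := by
  ext1 u
  have h := extChartAt_cotangent_snd p p (mem_chart_source E _) u
  exact (congrArg (extChartAt (cotModel E) p p).2
    (FibredChart.mfderiv_chartAt_self p.proj u)).symm.trans h

variable [FiniteDimensional ℝ E] {π : M → ℝ} [IsFibration E π] (ψ : FibredChart E π)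

namespace FibredChart

theorem dualChart_dualRestrict_self {y : ℝ × Fib E} (hy : y ∈ ψ.chart.target) (ξ : E →L[ℝ] ℝ) :
    ψ.dualChart (dualRestrict E π (⟨ψ.chart.symm y, ξ⟩ : Cotangent E M)) =
      (y, ξ ∘L fderiv ℝ (ψ.toModel (ψ.chart.symm y)) y ∘L ContinuousLinearMap.inr ℝ ℝ (Fib E)) := by
  rw [ψ.dualChart_dualRestrict ⟨ψ.chart.symm y, ξ⟩ _ (ψ.chart.map_target hy)
    (mem_chart_source E _), extChartAt_cotangent_self_snd]
  simp only [ψ.chart.right_inv hy]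

/-- The tangent map of `μ : T^*M → V^*π`. In the coordinates `(t, qⁱ)` a vector `(q̇, ṗ)` at `ξ`
is sent to the restriction to `Vπ` of the derivative of `ξ ∘ DG`, where `G` is the coordinate
change from `(t, qⁱ)` to the preferred chart of `M`. -/
theorem mfderiv_dualChart_dualRestrict {y : ℝ × Fib E} (hy : y ∈ ψ.chart.target)
    (ξ ξ' : E →L[ℝ] ℝ) (w : ℝ × Fib E) :
    (mfderiv (cotModel E) 𝓘(ℝ, VModel E) (ψ.dualChart ∘ dualRestrict E π)
      (⟨ψ.chart.symm y, ξ⟩ : Cotangent E M)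
      ((fderiv ℝ (ψ.toModel (ψ.chart.symm y)) y w, ξ') : E × (E →L[ℝ] ℝ)) : VModel E) =
    (w, ξ ∘L fderiv ℝ (fderiv ℝ (ψ.toModel (ψ.chart.symm y))) y w ∘L
          ContinuousLinearMap.inr ℝ ℝ (Fib E) +
        ξ' ∘L fderiv ℝ (ψ.toModel (ψ.chart.symm y)) y ∘L
          ContinuousLinearMap.inr ℝ ℝ (Fib E)) := by
  let x : M := ψ.chart.symm y
  let p : Cotangent E M := ⟨x, ξ⟩
  let G := ψ.toModel x
  have hmem : y ∈ ψ.overlap x := ψ.symm_mem_overlap hy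
  have hG : HasFDerivAt G (fderiv ℝ G y) y := ψ.hasFDerivAt_toModel hmem
  have hG2 := ψ.hasFDerivAt_fderiv_toModel hmem
  have hf : MDifferentiableAt (cotModel E) 𝓘(ℝ, VModel E) (ψ.dualChart ∘ dualRestrict E π) p :=
    ((ψ.contMDiffAt_dualChart (a := dualRestrict E π p) (ψ.chart.map_target hy)).comp p
      contMDiff_dualRestrict.contMDiffAt).mdifferentiableAt (by simp)
  let k : (ℝ × Fib E) × (E →L[ℝ] ℝ) := (y, ξ)
  let g : (ℝ × Fib E) × (E →L[ℝ] ℝ) → E × (E →L[ℝ] ℝ) := fun z ↦ (G z.1, z.2)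
  have hg : HasFDerivAt g _ k :=
    (HasFDerivAt.comp k (f := Prod.fst) (g := G) hG hasFDerivAt_fst).prodMk hasFDerivAt_snd
  have hgk : g k = extChartAt (cotModel E) p p :=
    Prod.ext rfl (extChartAt_cotangent_self_snd p).symm
  let h : (ℝ × Fib E) × (E →L[ℝ] ℝ) → VModel E := fun z ↦
    (z.1, z.2 ∘L fderiv ℝ G z.1 ∘L ContinuousLinearMap.inr ℝ ℝ (Fib E))
  have h1 : HasFDerivAt (fun z : (ℝ × Fib E) × (E →L[ℝ] ℝ) ↦ fderiv ℝ G z.1) _ k :=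
    HasFDerivAt.comp k (f := Prod.fst) (g := fderiv ℝ G) hG2 hasFDerivAt_fst
  have hh : HasFDerivAt h _ k := hasFDerivAt_fst.prodMk
    (hasFDerivAt_snd.clm_comp (h1.clm_comp
      (hasFDerivAt_const (ContinuousLinearMap.inr ℝ ℝ (Fib E)) k)))
  have heq : ∀ᶠ z in 𝓝 k, (ψ.dualChart ∘ dualRestrict E π)
      ((extChartAt (cotModel E) p).symm (g z)) = h z := by
    have hgc : ∀ᶠ z in 𝓝 k, g z ∈ (extChartAt (cotModel E) p).target :=
      hg.continuousAt.preimage_mem_nhds (by rw [hgk]; exact extChartAt_target_mem_nhds p)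
    have hfc : ContinuousAt (fun z : (ℝ × Fib E) × (E →L[ℝ] ℝ) ↦ z.1) k := continuousAt_fst
    filter_upwards [hgc, hfc.preimage_mem_nhds ((ψ.isOpen_overlap x).mem_nhds hmem)] with z hz hz1
    have hz1' : z.1 ∈ ψ.overlap x := hz1
    set q := (extChartAt (cotModel E) p).symm (g z) with hq
    have h2 : extChartAt (cotModel E) p q = g z := PartialEquiv.right_inv _ hz
    have h3 : q.proj ∈ (chartAt E x).source := by
      have := PartialEquiv.map_target _ hz
      rw [← hq, extChartAt_source, FiberBundle.chartedSpace_chartAt] at this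
      simp only [mfld_simps] at this
      exact this.2
    have h4 : q.proj = ψ.chart.symm z.1 :=
      (chartAt E x).injOn h3 hz1'.2 (congrArg Prod.fst h2)
    have h5 : ψ.chart q.proj = z.1 := by rw [h4, ψ.chart.right_inv hz1'.1]
    rw [Function.comp_apply, ψ.dualChart_dualRestrict p q
      (by rw [h4]; exact ψ.chart.map_target hz1'.1) h3, h2, h5]
  have key := mfderiv_apply_of_target_normedSpace hf hg hgk hh heq (w, ξ')
  refine Eq.trans ?_ (key.trans ?_)
  · rfl
  · refine Prod.ext rfl ?_
    ext1 u
    simp [k, G, x]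

/-- The tangent vector `ψ(α)` of `V^*π` in coordinates: if `α = a_t dt + a_q dq + a_q̇ dq̇` at
`(t, q, q̇)`, then `ψ(α)` is the vector `(1, q̇; a_q)` at the point `(t, q; a_q̇)`. The second
derivatives of the coordinate change, which occur in the extension of `α` to `TM` and in the tangent
map of `μ`, cancel because they are symmetric. -/
theorem psi_coordinates {y : JModel E} (hy : y.1 ∈ ψ.chart.target)
    (α : TangentSpace 𝓘(ℝ, JModel E) (ψ.jetChart.symm y) →L[ℝ] ℝ) (a : JModel E →L[ℝ] ℝ)
    (ha : ∀ w : JModel E, α (mfderiv 𝓘(ℝ, JModel E) 𝓘(ℝ, JModel E) ψ.jetChart.symm y w) = a w) :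
    ψ.dualChart (psi (ψ.jetChart.symm y) α).proj =
      (y.1, a ∘L ContinuousLinearMap.inr ℝ (ℝ × Fib E) (Fib E)) ∧
    (mfderiv 𝓘(ℝ, VModel E) 𝓘(ℝ, VModel E) ψ.dualChart (psi (ψ.jetChart.symm y) α).proj
      (psi (ψ.jetChart.symm y) α).2 : VModel E) =
      ((1, y.2), a ∘L ContinuousLinearMap.inl ℝ (ℝ × Fib E) (Fib E) ∘L
        ContinuousLinearMap.inr ℝ ℝ (Fib E)) := by
  let v := ψ.jetChart.symm y
  let x : M := ψ.chart.symm y.1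
  let β : E × E →L[ℝ] ℝ := extendCovector v α
  let β₁ : E →L[ℝ] ℝ := β ∘L ContinuousLinearMap.inl ℝ E E
  let β₂ : E →L[ℝ] ℝ := β ∘L ContinuousLinearMap.inr ℝ E E
  have hmem : y.1 ∈ ψ.overlap x := ψ.symm_mem_overlap hy
  have hβ (w : JModel E) : β (fderiv ℝ (ψ.inclModel x) y w) = a w := by
    refine Eq.trans ?_ (ha w)
    rw [← extendCovector_dIncl]
    exact congrArg β (ψ.dIncl_mfderiv_jetChart_symm hy w).symm
  have hsplit (e e' : E) : β (e, e') = β₁ e + β₂ e' := by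
    rw [← Prod.fst_add_snd (e, e'), map_add]
    rfl
  have h1 (u : Fib E) : a (0, u) = β₂ (fderiv ℝ (ψ.toModel x) y.1 (0, u)) := by
    rw [← hβ, ψ.fderiv_inclModel hmem, hsplit]
    simp
  have h2 (u : Fib E) : a ((0, u), 0) = β₁ (fderiv ℝ (ψ.toModel x) y.1 (0, u)) +
      β₂ (fderiv ℝ (fderiv ℝ (ψ.toModel x)) y.1 (1, y.2) (0, u)) := by
    rw [← hβ, ψ.fderiv_inclModel hmem, hsplit, ψ.fderiv_fderiv_toModel_symm hmem (1, y.2)]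
    have h0 : fderiv ℝ (ψ.toModel x) y.1 (0, 0) = 0 := map_zero _
    simp [h0]
  let p : Cotangent E M := ⟨x, β₂⟩
  constructor
  · refine (ψ.dualChart_dualRestrict_self hy β₂).trans (Prod.ext rfl ?_)
    ext1 u
    exact (h1 u).symm
  · have h3 := mfderiv_comp (I := cotModel E) p
      ((ψ.contMDiffAt_dualChart (a := dualRestrict E π p)
        (ψ.chart.map_target hy)).mdifferentiableAt (by simp))
      (contMDiff_dualRestrict.contMDiffAt.mdifferentiableAt (by simp))
    have h4 : (v.1.2 : E) = fderiv ℝ (ψ.toModel x) y.1 (1, y.2) :=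
      (ψ.jetChart_symm_snd hy).trans (ψ.dinv_eq_fderiv_toModel hy (1, y.2))
    have h5 := ψ.mfderiv_dualChart_dualRestrict hy β₂ β₁ (1, y.2)
    refine Eq.trans ?_ (h5.trans (Prod.ext rfl ?_))
    · have h6 := congrArg (fun l ↦ l ((v.1.2, β₁) : E × (E →L[ℝ] ℝ))) h3
      refine h6.symm.trans ?_
      change mfderiv (cotModel E) 𝓘(ℝ, VModel E) (ψ.dualChart ∘ dualRestrict E π) p
        (((v.1.2 : E), β₁) : E × (E →L[ℝ] ℝ)) = _
      rw [h4]
    · ext1 u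
      refine Eq.trans ?_ (h2 u).symm
      rw [add_comm]
      rfl

end FibredChart

end Psi

/-! ### The Poincaré–Cartan form of a local Lagrangian -/

section LocalLagrangian

variable {F : Type*} [NormedAddCommGroup F] [NormedSpace ℝ F]

/-- The momenta `pᵢ = ∂Λ/∂q̇ⁱ` of a function `Λ(t, q, q̇)`. -/
def momentum (Λ : (ℝ × F) × F → ℝ) (y : (ℝ × F) × F) : F →L[ℝ] ℝ :=
  fderiv ℝ Λ y ∘L ContinuousLinearMap.inr ℝ (ℝ × F) F

/-- The derivatives `∂Λ/∂qⁱ` of a function `Λ(t, q, q̇)`. -/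
def force (Λ : (ℝ × F) × F → ℝ) (y : (ℝ × F) × F) : F →L[ℝ] ℝ :=
  fderiv ℝ Λ y ∘L ContinuousLinearMap.inl ℝ (ℝ × F) F ∘L ContinuousLinearMap.inr ℝ ℝ F

/-- The Poincaré–Cartan `1`-form `Λ dt + (∂Λ/∂q̇ⁱ) (dqⁱ - q̇ⁱ dt)` of a function `Λ(t, q, q̇)`. -/
def poincareCartan (Λ : (ℝ × F) × F → ℝ) (y : (ℝ × F) × F) : ℝ × F →L[ℝ] ℝ :=
  Λ y • ContinuousLinearMap.fst ℝ ℝ F + momentum Λ y ∘L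
    (ContinuousLinearMap.snd ℝ ℝ F - (ContinuousLinearMap.fst ℝ ℝ F).smulRight y.2)

theorem poincareCartan_apply (Λ : (ℝ × F) × F → ℝ) (y : (ℝ × F) × F) (u : ℝ × F) :
    poincareCartan Λ y u = Λ y * u.1 + momentum Λ y (u.2 - u.1 • y.2) := rfl

/-- The negative of the exterior derivative of the Poincaré–Cartan `1`-form. -/
def cartanForm (Λ : (ℝ × F) × F → ℝ) (y w w' : (ℝ × F) × F) : ℝ :=
  fderiv ℝ (poincareCartan Λ) y w' w.1 - fderiv ℝ (poincareCartan Λ) y w w'.1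

variable {Λ : (ℝ × F) × F → ℝ} {y : (ℝ × F) × F}

theorem fderiv_eq_force_add_momentum (τ : ℝ) (u z : F) :
    fderiv ℝ Λ y ((τ, u), z) = τ * fderiv ℝ Λ y ((1, 0), 0) + force Λ y u + momentum Λ y z := by
  have h : (((τ, u), z) : (ℝ × F) × F) = τ • ((1, 0), 0) + ((0, u), 0) + (0, z) := by
    ext <;> simp
  rw [h, map_add, map_add, map_smul]
  rfl

theorem contDiffAt_momentum (h : ContDiffAt ℝ ∞ Λ y) : ContDiffAt ℝ ∞ (momentum Λ) y :=
  (h.fderiv_right (m := ∞) (by simp)).clm_comp contDiffAt_const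

theorem contDiffAt_force (h : ContDiffAt ℝ ∞ Λ y) : ContDiffAt ℝ ∞ (force Λ) y :=
  (h.fderiv_right (m := ∞) (by simp)).clm_comp contDiffAt_const

theorem contDiffAt_poincareCartan (h : ContDiffAt ℝ ∞ Λ y) :
    ContDiffAt ℝ ∞ (poincareCartan Λ) y :=
  (h.smul contDiffAt_const).add ((contDiffAt_momentum h).clm_comp
    (contDiffAt_const.sub (contDiffAt_const.smulRight contDiffAt_snd)))

theorem hasFDerivAt_momentum (h : ContDiffAt ℝ ∞ Λ y) :
    HasFDerivAt (momentum Λ) (fderiv ℝ (momentum Λ) y) y :=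
  ((contDiffAt_momentum h).differentiableAt (by simp)).hasFDerivAt

theorem hasFDerivAt_force (h : ContDiffAt ℝ ∞ Λ y) :
    HasFDerivAt (force Λ) (fderiv ℝ (force Λ) y) y :=
  ((contDiffAt_force h).differentiableAt (by simp)).hasFDerivAt

theorem fderiv_momentum_apply (h : ContDiffAt ℝ ∞ Λ y) (w : (ℝ × F) × F) (z : F) :
    fderiv ℝ (momentum Λ) y w z = fderiv ℝ (fderiv ℝ Λ) y w (0, z) := by
  have h1 := ((h.fderiv_right (m := ∞) (by simp)).differentiableAt (by simp)).hasFDerivAt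
  have h2 : HasFDerivAt (momentum Λ) _ y := h1.clm_comp (hasFDerivAt_const _ y)
  rw [h2.fderiv]
  simp

theorem fderiv_force_apply (h : ContDiffAt ℝ ∞ Λ y) (w : (ℝ × F) × F) (u : F) :
    fderiv ℝ (force Λ) y w u = fderiv ℝ (fderiv ℝ Λ) y w ((0, u), 0) := by
  have h1 := ((h.fderiv_right (m := ∞) (by simp)).differentiableAt (by simp)).hasFDerivAt
  have h2 : HasFDerivAt (force Λ) _ y := h1.clm_comp (hasFDerivAt_const _ y)
  rw [h2.fderiv]
  simp

theorem fderiv_poincareCartan_apply (h : ContDiffAt ℝ ∞ Λ y) (w : (ℝ × F) × F) (u : ℝ × F) :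
    fderiv ℝ (poincareCartan Λ) y w u = fderiv ℝ Λ y w * u.1 +
      fderiv ℝ (momentum Λ) y w (u.2 - u.1 • y.2) - u.1 * momentum Λ y w.2 := by
  have h1 := (h.differentiableAt (by simp)).hasFDerivAt
  have h2 := hasFDerivAt_momentum h
  have h3 : HasFDerivAt (fun y : (ℝ × F) × F ↦ poincareCartan Λ y u) _ y :=
    (h1.mul_const u.1).add (h2.clm_apply
      ((hasFDerivAt_const u.2 y).sub (hasFDerivAt_snd.const_smul u.1)))
  have h4 := ((contDiffAt_poincareCartan h).differentiableAt (by simp)).hasFDerivAt.clm_apply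
    (hasFDerivAt_const u y)
  have h5 := congrArg (fun l ↦ l w) (h4.unique h3)
  simp at h5
  rw [h5]
  simp
  ring

/-- The Reeb conditions for the form `cartanForm Λ` are the equation `q̇ = dq/dt` and the
Euler–Lagrange equation, if the Legendre transformation is a local diffeomorphism. -/
theorem cartanForm_eq_zero_iff (h : ContDiffAt ℝ ∞ Λ y) (hΛ : Function.Surjective
    fun w : (ℝ × F) × F ↦ (w.1, fderiv ℝ (momentum Λ) y w)) [FiniteDimensional ℝ F]
    (w : (ℝ × F) × F) :
    ((∀ w', cartanForm Λ y w w' = 0) ∧ w.1.1 = 1) ↔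
      w.1 = (1, y.2) ∧ fderiv ℝ (momentum Λ) y w = force Λ y := by
  have key (w' : (ℝ × F) × F) : cartanForm Λ y w w' = fderiv ℝ Λ y w' * w.1.1 +
      fderiv ℝ (momentum Λ) y w' (w.1.2 - w.1.1 • y.2) - w.1.1 * momentum Λ y w'.2 -
      (fderiv ℝ Λ y w * w'.1.1 + fderiv ℝ (momentum Λ) y w (w'.1.2 - w'.1.1 • y.2) -
        w'.1.1 * momentum Λ y w.2) := by
    rw [cartanForm, fderiv_poincareCartan_apply h, fderiv_poincareCartan_apply h]
  constructor
  · rintro ⟨h0, h1⟩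
    -- Testing with the vectors `∂/∂q̇` yields `q̇ = dq/dt`, as all `p ∈ F*` are values of `∂p/∂q̇`.
    have h2 : w.1.2 - y.2 = 0 := by
      refine (forall_dual_apply_eq_zero_iff ℝ _).1 fun φ ↦ ?_
      obtain ⟨⟨w₀, z⟩, hw⟩ := hΛ (0, LinearMap.toContinuousLinearMap φ)
      rw [Prod.mk.injEq] at hw
      obtain ⟨rfl, hw⟩ := hw
      have h3 := h0 (0, z)
      rw [key, hw, h1] at h3
      have h4 := fderiv_eq_force_add_momentum (Λ := Λ) (y := y) 0 0 z
      simp only [Prod.mk_zero_zero] at h4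
      simpa [h4] using h3
    have h3 : w.1 = (1, y.2) := Prod.ext h1 (sub_eq_zero.1 h2)
    refine ⟨h3, ?_⟩
    ext1 u
    -- Testing with the vectors `∂/∂q` yields the Euler–Lagrange equation.
    have h4 := h0 ((0, u), 0)
    rw [key, h3, fderiv_eq_force_add_momentum] at h4
    simp at h4
    linarith
  · rintro ⟨h0, h1⟩
    refine ⟨fun w' ↦ ?_, by rw [h0]⟩
    obtain ⟨⟨τ, u⟩, z⟩ := w'
    obtain ⟨w₀, z₀⟩ := w
    simp only at h0
    subst h0
    rw [key, h1, fderiv_eq_force_add_momentum τ u z, fderiv_eq_force_add_momentum 1 y.2 z₀]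
    simp
    ring

end LocalLagrangian

/-! ### The Legendre transformations in coordinates -/

section LegendreCoordinates

variable {E : Type*} [NormedAddCommGroup E] [NormedSpace ℝ E] [FiniteDimensional ℝ E]
  {M : Type*} [TopologicalSpace M] [ChartedSpace E M] [IsManifold 𝓘(ℝ, E) ∞ M]
  {π : M → ℝ} [IsFibration E π]

namespace FibredChart

variable (ψ : FibredChart E π) {L : Jet E π → ℝ}

variable (L) in
/-- The expression of a Lagrangian function in the coordinates `(t, qⁱ, q̇ⁱ)`. -/
def localLagrangian : JModel E → ℝ := L ∘ ψ.jetChart.symm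

theorem contDiffAt_localLagrangian (hL : ContMDiff 𝓘(ℝ, JModel E) 𝓘(ℝ, ℝ) ∞ L) {y : JModel E}
    (hy : y.1 ∈ ψ.chart.target) : ContDiffAt ℝ ∞ (ψ.localLagrangian L) y :=
  contMDiffAt_iff_contDiffAt.1 (hL.contMDiffAt.comp y (ψ.contMDiffAt_jetChart_symm hy))

/-- The extended Legendre transformation is given by the Poincaré–Cartan form. -/
theorem extLegendre_snd (hL : ContMDiff 𝓘(ℝ, JModel E) 𝓘(ℝ, ℝ) ∞ L) {y : JModel E}
    (hy : y.1 ∈ ψ.chart.target) (w : ℝ × Fib E) :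
    ((extLegendre L (ψ.jetChart.symm y)).2 (ψ.dinv (ψ.chart.symm y.1) w) : ℝ) =
      poincareCartan (ψ.localLagrangian L) y w := by
  let v := ψ.jetChart.symm y
  let x : M := ψ.chart.symm y.1
  have hx : x ∈ ψ.chart.source := ψ.chart.map_target hy
  let A : E →L[ℝ] ℝ × Fib E := ψ.d x
  let v' : E := v.1.2
  let η : E →L[ℝ] ℝ := clock E π x
  have hv : A v' = (1, y.2) :=
    (congrArg A (ψ.jetChart_symm_snd hy)).trans (ψ.d_dinv hx _)
  have hη (X : E) : η X = (A X).1 := ψ.clock_eq hx X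
  let f : E → ℝ := fun X ↦ L ⟨⟨x, (v' + (X - η X • v') : E)⟩, add_vert_mem v X⟩
  -- `f` is the function differentiated in the definition of `Leg_L`, and `g` gives the coordinates
  -- of its argument.
  let g : E → JModel E := fun X ↦ (y.1, y.2 + ((A X).2 - (A X).1 • y.2))
  have hfg : f = ψ.localLagrangian L ∘ g := by
    funext X
    let u : Jet E π := ⟨⟨x, (v' + (X - η X • v') : E)⟩, add_vert_mem v X⟩
    have h1 : ψ.jetChart u = g X := by
      refine Prod.ext (ψ.chart.right_inv hy) ?_
      change (A (v' + (X - η X • v'))).2 = y.2 + ((A X).2 - (A X).1 • y.2)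
      rw [map_add, map_sub, map_smul, hv, hη]
      rfl
    have h2 : ψ.jetChart.symm (ψ.jetChart u) = u := ψ.jetChart.left_inv hx
    rw [h1] at h2
    exact congrArg L h2.symm
  have hg : HasFDerivAt g ((0 : E →L[ℝ] ℝ × Fib E).prod
      (ContinuousLinearMap.snd ℝ ℝ (Fib E) ∘L A -
        (ContinuousLinearMap.fst ℝ ℝ (Fib E) ∘L A).smulRight y.2)) 0 := by
    refine (hasFDerivAt_const _ _).prodMk (HasFDerivAt.const_add _ ?_)
    exact ((ContinuousLinearMap.snd ℝ ℝ (Fib E) ∘L A).hasFDerivAt).sub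
      ((ContinuousLinearMap.fst ℝ ℝ (Fib E) ∘L A).hasFDerivAt.smul_const y.2)
  have hg0 : g 0 = y := by simp [g]
  have hΛ := ((ψ.contDiffAt_localLagrangian hL hy).differentiableAt (by simp)).hasFDerivAt
  rw [← hg0] at hΛ
  have hf := hΛ.comp 0 hg
  rw [hg0, ← hfg] at hf
  let e : E := ψ.dinv x w
  have he : A e = w := ψ.d_dinv hx w
  change L v * η e + fderiv ℝ f 0 e = _
  rw [hf.fderiv, hη, he, poincareCartan_apply]
  congr 1
  change fderiv ℝ (ψ.localLagrangian L) y (0, (A e).2 - (A e).1 • y.2) = _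
  rw [he]
  rfl

/-- In coordinates, `leg_L` is the map `(t, q, q̇) ↦ (t, q, ∂L/∂q̇)`. -/
theorem dualChart_resLegendre (hL : ContMDiff 𝓘(ℝ, JModel E) 𝓘(ℝ, ℝ) ∞ L) {y : JModel E}
    (hy : y.1 ∈ ψ.chart.target) : ψ.dualChart (resLegendre L (ψ.jetChart.symm y)) =
      (y.1, momentum (ψ.localLagrangian L) y) := by
  refine Prod.ext (ψ.chart.right_inv hy) ?_
  ext1 u
  rw [ψ.dualChart_apply_snd (ψ.chart.map_target hy)]
  refine (ψ.extLegendre_snd hL hy (0, u)).trans ?_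
  simp [poincareCartan_apply]

variable (L) in
/-- The extended Legendre transformation in the coordinates `(t, qⁱ, q̇ⁱ)` and in the coordinates of
`T^*M` that are induced by the preferred chart of `M` at `x`. -/
def legendreModel (x : M) (y : JModel E) : E × (E →L[ℝ] ℝ) :=
  (ψ.toModel x y.1, poincareCartan (ψ.localLagrangian L) y ∘L
    fderiv ℝ (ψ.ofModel x) (ψ.toModel x y.1))

theorem extChartAt_extLegendre (hL : ContMDiff 𝓘(ℝ, JModel E) 𝓘(ℝ, ℝ) ∞ L) (p : Cotangent E M)
    {y : JModel E} (hy : y.1 ∈ ψ.overlap p.proj) :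
    extChartAt (cotModel E) p (extLegendre L (ψ.jetChart.symm y)) =
      ψ.legendreModel L p.proj y := by
  refine Prod.ext rfl ?_
  ext1 e
  obtain ⟨w, rfl⟩ := ψ.fderiv_toModel_surjective hy e
  change _ = poincareCartan (ψ.localLagrangian L) y
    (fderiv ℝ (ψ.ofModel p.proj) (ψ.toModel p.proj y.1) (fderiv ℝ (ψ.toModel p.proj) y.1 w))
  rw [ψ.toModel_fderiv_comp hy, ← ψ.extLegendre_snd hL hy.1, ← ψ.mfderiv_chartAt_dinv hy]
  exact extChartAt_cotangent_snd p (extLegendre L (ψ.jetChart.symm y)) hy.2 _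

theorem contDiffAt_legendreModel (hL : ContMDiff 𝓘(ℝ, JModel E) 𝓘(ℝ, ℝ) ∞ L) {x : M}
    {y : JModel E} (hy : y.1 ∈ ψ.overlap x) : ContDiffAt ℝ ∞ (ψ.legendreModel L x) y := by
  have h1 : ContDiffAt ℝ ∞ (fun z : JModel E ↦ ψ.toModel x z.1) y :=
    (ψ.contDiffAt_toModel hy).comp y contDiffAt_fst
  have h2 : ContDiffAt ℝ ∞ (fderiv ℝ (ψ.ofModel x)) (ψ.toModel x y.1) :=
    (ψ.contDiffAt_ofModel hy).fderiv_right (m := ∞) (by simp)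
  exact h1.prodMk ((contDiffAt_poincareCartan (ψ.contDiffAt_localLagrangian hL hy.1)).clm_comp
    (h2.comp y h1))

end FibredChart

/-- The extended Legendre transformation is smooth. -/
theorem contMDiff_extLegendre {L : Jet E π → ℝ} (hL : ContMDiff 𝓘(ℝ, JModel E) 𝓘(ℝ, ℝ) ∞ L) :
    ContMDiff 𝓘(ℝ, JModel E) (cotModel E) ∞ (extLegendre L) := by
  intro v
  obtain ⟨ψ, hψ⟩ := exists_fibredChart (E := E) π v.1.proj
  have hmem : (ψ.jetChart v).1 ∈ ψ.overlap v.1.proj := ψ.chart_mem_overlap hψ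
  have key : ∀ w : Jet E π, w.1.proj ∈ ψ.chart.source → w.1.proj ∈ (chartAt E v.1.proj).source →
      ψ.legendreModel L v.1.proj (ψ.jetChart w) =
        extChartAt (cotModel E) (extLegendre L v) (extLegendre L w) := by
    intro w hw hw'
    have hmem' : (ψ.jetChart w).1 ∈ ψ.overlap v.1.proj :=
      ⟨ψ.chart.map_source hw, by simpa [ψ.jetChart_apply, ψ.chart.left_inv hw] using hw'⟩
    have h := ψ.extChartAt_extLegendre hL (extLegendre L v) (y := ψ.jetChart w) hmem'
    rw [ψ.jetChart.left_inv hw] at h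
    exact h.symm
  refine contMDiffAt_of_factor (ψ.contMDiffAt_jetChart hψ) (ψ.contDiffAt_legendreModel hL hmem)
    (s := (extChartAt (cotModel E) (extLegendre L v)).symm) ?_ ?_
  · rw [key v hψ (mem_chart_source E _)]
    exact (contMDiffOn_extChartAt_symm _).contMDiffAt (extChartAt_target_mem_nhds _)
  · have h1 := contMDiff_jet_proj.continuous.continuousAt (x := v) |>.preimage_mem_nhds
      ((chartAt E v.1.proj).open_source.mem_nhds (mem_chart_source E _))
    filter_upwards [ψ.jetChart.open_source.mem_nhds hψ, h1] with w hw hw'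
    rw [key w hw hw', PartialEquiv.left_inv]
    rw [extChartAt_source, FiberBundle.chartedSpace_chartAt]
    simp only [mfld_simps]
    exact ⟨⟨hw', mem_univ _⟩, hw'⟩

namespace FibredChart

variable (ψ : FibredChart E π) {L : Jet E π → ℝ}

theorem mfderiv_extLegendre_jetChart_symm (hL : ContMDiff 𝓘(ℝ, JModel E) 𝓘(ℝ, ℝ) ∞ L)
    {y : JModel E} (hy : y.1 ∈ ψ.chart.target) (w : JModel E) :
    (mfderiv 𝓘(ℝ, JModel E) (cotModel E) (extLegendre L) (ψ.jetChart.symm y)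
      (mfderiv 𝓘(ℝ, JModel E) 𝓘(ℝ, JModel E) ψ.jetChart.symm y w) : E × (E →L[ℝ] ℝ)) =
      fderiv ℝ (ψ.legendreModel L (ψ.chart.symm y.1)) y w := by
  have h1 : MDifferentiableAt 𝓘(ℝ, JModel E) (cotModel E) (extLegendre L) (ψ.jetChart.symm y) :=
    (contMDiff_extLegendre hL).contMDiffAt.mdifferentiableAt (by simp)
  have h2 := (ψ.contMDiffAt_jetChart_symm hy).mdifferentiableAt (by simp)
  have h3 := mfderiv_comp y h1 h2
  have hmem := ψ.symm_mem_overlap hy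
  have h4 := mfderiv_of_source_normedSpace (h1.comp y h2)
    ((ψ.contDiffAt_legendreModel hL hmem).differentiableAt (by simp)).hasFDerivAt
    (by
      have hc : ContinuousAt (fun z : JModel E ↦ z.1) y := continuousAt_fst
      filter_upwards [hc.preimage_mem_nhds ((ψ.isOpen_overlap _).mem_nhds hmem)] with z hz
      exact ψ.extChartAt_extLegendre hL (extLegendre L (ψ.jetChart.symm y)) hz) w
  rw [← h4]
  exact (congrArg (fun l ↦ l w) h3).symm

/-- The pullback of the canonical symplectic form by the extended Legendre transformation is the
negative of the exterior derivative of the Poincaré–Cartan form. -/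
theorem canonicalForm_mfderiv_extLegendre (hL : ContMDiff 𝓘(ℝ, JModel E) 𝓘(ℝ, ℝ) ∞ L)
    {y : JModel E} (hy : y.1 ∈ ψ.chart.target) (w w' : JModel E) :
    canonicalForm (extLegendre L (ψ.jetChart.symm y))
      (mfderiv 𝓘(ℝ, JModel E) (cotModel E) (extLegendre L) (ψ.jetChart.symm y)
        (mfderiv 𝓘(ℝ, JModel E) 𝓘(ℝ, JModel E) ψ.jetChart.symm y w))
      (mfderiv 𝓘(ℝ, JModel E) (cotModel E) (extLegendre L) (ψ.jetChart.symm y)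
        (mfderiv 𝓘(ℝ, JModel E) 𝓘(ℝ, JModel E) ψ.jetChart.symm y w')) =
      cartanForm (ψ.localLagrangian L) y w w' := by
  let x : M := ψ.chart.symm y.1
  let Λ := ψ.localLagrangian L
  have hmem : y.1 ∈ ψ.overlap x := ψ.symm_mem_overlap hy
  have hΛ : ContDiffAt ℝ ∞ Λ y := ψ.contDiffAt_localLagrangian hL hy
  let ξ : JModel E → E →L[ℝ] ℝ := fun z ↦ (ψ.legendreModel L x z).2
  have hξ : HasFDerivAt ξ (fderiv ℝ ξ y) y :=
    ((contDiffAt_snd.comp y (ψ.contDiffAt_legendreModel hL hmem)).differentiableAt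
      (by simp)).hasFDerivAt
  have hG : HasFDerivAt (fun z : JModel E ↦ ψ.toModel x z.1) _ y :=
    (ψ.hasFDerivAt_toModel hmem).comp y hasFDerivAt_fst
  have hG2 : HasFDerivAt (fun z : JModel E ↦ fderiv ℝ (ψ.toModel x) z.1) _ y :=
    (ψ.hasFDerivAt_fderiv_toModel hmem).comp y hasFDerivAt_fst
  have hleg (u : JModel E) : fderiv ℝ (ψ.legendreModel L x) y u =
      (fderiv ℝ (ψ.toModel x) y.1 u.1, fderiv ℝ ξ y u) := by
    have h : HasFDerivAt (ψ.legendreModel L x) _ y := hG.prodMk hξ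
    rw [h.fderiv]
    rfl
  have hcomp : poincareCartan Λ =ᶠ[𝓝 y] fun z ↦ ξ z ∘L fderiv ℝ (ψ.toModel x) z.1 := by
    have hc : ContinuousAt (fun z : JModel E ↦ z.1) y := continuousAt_fst
    filter_upwards [hc.preimage_mem_nhds ((ψ.isOpen_overlap _).mem_nhds hmem)] with z hz
    exact ContinuousLinearMap.ext fun u ↦
      (congrArg (poincareCartan Λ z) (ψ.toModel_fderiv_comp hz u)).symm
  have hPC (u : JModel E) (s : ℝ × Fib E) : fderiv ℝ (poincareCartan Λ) y u s =
      ξ y (fderiv ℝ (fderiv ℝ (ψ.toModel x)) y.1 u.1 s) +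
        fderiv ℝ ξ y u (fderiv ℝ (ψ.toModel x) y.1 s) := by
    have h := (hξ.clm_comp hG2).congr_of_eventuallyEq hcomp
    rw [h.fderiv]
    simp
  -- The terms with the second derivative of the coordinate change cancel by symmetry.
  have hm (u : JModel E) := ψ.mfderiv_extLegendre_jetChart_symm hL hy u
  refine (canonicalForm_apply _ _ _).trans ?_
  rw [hm, hm, hleg, hleg, cartanForm, hPC, hPC, ψ.fderiv_fderiv_toModel_symm hmem w'.1]
  ring

end FibredChart

end LegendreCoordinates

/-! ### `A_π⁻¹ ∘ dL` is the Reeb field -/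

section ReebField

variable {E : Type*} [NormedAddCommGroup E] [NormedSpace ℝ E] [FiniteDimensional ℝ E]
  {M : Type*} [TopologicalSpace M] [ChartedSpace E M] [IsManifold 𝓘(ℝ, E) ∞ M]
  {π : M → ℝ} [IsFibration E π]

/-- The restricted Legendre transformation of a hyperregular Lagrangian, as a diffeomorphism. -/
def IsHyperregular.diffeo {L : Jet E π → ℝ} (hreg : IsHyperregular L) :
    Diffeomorph 𝓘(ℝ, JModel E) 𝓘(ℝ, VModel E) (Jet E π) (VDual E π) ∞ := hreg.choose

theorem IsHyperregular.diffeo_apply {L : Jet E π → ℝ} (hreg : IsHyperregular L) (v : Jet E π) :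
    hreg.diffeo v = resLegendre L v := hreg.choose_spec v

theorem hamiltonianSection_diffeo {L : Jet E π → ℝ} (hreg : IsHyperregular L) (v : Jet E π) :
    hamiltonianSection hreg (hreg.diffeo v) = extLegendre L v :=
  congrArg (extLegendre L) (hreg.diffeo.symm_apply_apply v)

namespace FibredChart

variable (ψ : FibredChart E π)

theorem mfderiv_dualChart_bijective {a : VDual E π} (ha : a.base ∈ ψ.chart.source) :
    Function.Bijective (mfderiv 𝓘(ℝ, VModel E) 𝓘(ℝ, VModel E) ψ.dualChart a) :=
  OpenPartialHomeomorph.MDifferentiable.mfderiv_bijective (e := ψ.dualChart)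
    ⟨(contMDiffOn_of_mem_maximalAtlas ψ.dualChart_mem_maximalAtlas).mdifferentiableOn (by simp),
      (contMDiffOn_symm_of_mem_maximalAtlas
        ψ.dualChart_mem_maximalAtlas).mdifferentiableOn (by simp)⟩ ha

theorem clock_dualProj {a : VDual E π} (ha : a.base ∈ ψ.chart.source)
    (Z : TangentSpace 𝓘(ℝ, VModel E) a) : clock (VModel E) (dualProj E π) a Z =
      (mfderiv 𝓘(ℝ, VModel E) 𝓘(ℝ, VModel E) ψ.dualChart a Z : VModel E).1.1 := by
  have h1 : dualProj E π =ᶠ[𝓝 a] (fun y : VModel E ↦ y.1.1) ∘ ψ.dualChart := by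
    filter_upwards [ψ.dualChart.open_source.mem_nhds ha] with b hb
    exact (ψ.fst_eq _ hb).symm
  have h2 := (ψ.contMDiffAt_dualChart ha).mdifferentiableAt (by simp)
  have h3 : HasFDerivAt (fun y : VModel E ↦ y.1.1)
      (ContinuousLinearMap.fst ℝ ℝ (Fib E) ∘L ContinuousLinearMap.fst ℝ (ℝ × Fib E) _)
      (ψ.dualChart a) := hasFDerivAt_fst.comp _ hasFDerivAt_fst
  have h4 := (h3.hasMFDerivAt.comp a h2.hasMFDerivAt).congr_of_eventuallyEq h1
  unfold clock
  rw [h4.mfderiv]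
  rfl

theorem jetClock_mfderiv_jetChart_symm {y : JModel E} (hy : y.1 ∈ ψ.chart.target) (w : JModel E) :
    jetClock E π (ψ.jetChart.symm y)
      (mfderiv 𝓘(ℝ, JModel E) 𝓘(ℝ, JModel E) ψ.jetChart.symm y w) = w.1.1 := by
  have hs : ContMDiffAt 𝓘(ℝ, JModel E) 𝓘(ℝ, ℝ) ∞ (fun v : Jet E π ↦ π v.1.proj)
      (ψ.jetChart.symm y) := by
    refine contMDiffAt_of_factor (g := fun z : JModel E ↦ z.1.1) (s := id)
      (ψ.contMDiffAt_jetChart (ψ.chart.map_target hy)) (by fun_prop) contMDiffAt_id ?_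
    filter_upwards [ψ.jetChart.open_source.mem_nhds (ψ.jetChart.map_target hy)] with v hv
    exact (ψ.fst_eq _ hv).symm
  have h1 := hs.mdifferentiableAt (by simp)
  have h2 := (ψ.contMDiffAt_jetChart_symm hy).mdifferentiableAt (by simp)
  have h3 := mfderiv_comp y h1 h2
  have h4 : (fun v : Jet E π ↦ π v.1.proj) ∘ ψ.jetChart.symm =ᶠ[𝓝 y] fun z ↦ z.1.1 := by
    have hc : ContinuousAt (fun z : JModel E ↦ z.1) y := continuousAt_fst
    filter_upwards [hc.preimage_mem_nhds (ψ.chart.open_target.mem_nhds hy)] with z hz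
    change π (ψ.chart.symm z.1) = z.1.1
    rw [← ψ.fst_eq _ (ψ.chart.map_target hz), ψ.chart.right_inv hz]
  have h5 : HasFDerivAt (fun z : JModel E ↦ z.1.1)
      (ContinuousLinearMap.fst ℝ ℝ (Fib E) ∘L ContinuousLinearMap.fst ℝ (ℝ × Fib E) _) y :=
    hasFDerivAt_fst.comp _ hasFDerivAt_fst
  have h6 := (h5.hasMFDerivAt.congr_of_eventuallyEq h4).mfderiv
  exact (congrArg (fun l ↦ l w) (h3.symm.trans h6) :)

variable {L : Jet E π → ℝ}

/-- The value of `A_π⁻¹` on the section induced by `dL`, in coordinates: it is the vector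
`(1, q̇; ∂L/∂q)` at the point `leg_L(t, q, q̇) = (t, q; ∂L/∂q̇)`. -/
theorem tulczyjewInv_reducedDifferential (hL : ContMDiff 𝓘(ℝ, JModel E) 𝓘(ℝ, ℝ) ∞ L)
    {y : JModel E} (hy : y.1 ∈ ψ.chart.target) :
    (tulczyjewInv (reducedDifferential L (ψ.jetChart.symm y))).proj =
      resLegendre L (ψ.jetChart.symm y) ∧
    (mfderiv 𝓘(ℝ, VModel E) 𝓘(ℝ, VModel E) ψ.dualChart
      (tulczyjewInv (reducedDifferential L (ψ.jetChart.symm y))).proj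
      (tulczyjewInv (reducedDifferential L (ψ.jetChart.symm y))).2 : VModel E) =
      ((1, y.2), force (ψ.localLagrangian L) y) := by
  let v := ψ.jetChart.symm y
  let Λ := ψ.localLagrangian L
  let dL : TangentSpace 𝓘(ℝ, JModel E) v →L[ℝ] ℝ := mfderiv 𝓘(ℝ, JModel E) 𝓘(ℝ, ℝ) L v
  let α : TangentSpace 𝓘(ℝ, JModel E) v →L[ℝ] ℝ := Quotient.out (reducedDifferential L v).2
  -- The representative `α` of the class of `dL` is `dL + c η₁`; the term `c η₁` only contributes to
  -- the component of `dt`, on which `ψ` does not depend.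
  obtain ⟨c, hc⟩ : ∃ c : ℝ, c • jetClock E π v = α - dL := by
    rw [← Submodule.mem_span_singleton, ← Submodule.Quotient.eq]
    exact Quotient.out_eq _
  have hdL (w : JModel E) :
      dL (mfderiv 𝓘(ℝ, JModel E) 𝓘(ℝ, JModel E) ψ.jetChart.symm y w) = fderiv ℝ Λ y w := by
    rw [← mfderiv_eq_fderiv]
    have h := mfderiv_comp y (hL.contMDiffAt.mdifferentiableAt (by simp))
      ((ψ.contMDiffAt_jetChart_symm hy).mdifferentiableAt (by simp))
    exact (congrArg (fun l ↦ l w) h).symm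
  let a : JModel E →L[ℝ] ℝ := fderiv ℝ Λ y +
    c • (ContinuousLinearMap.fst ℝ ℝ (Fib E) ∘L ContinuousLinearMap.fst ℝ (ℝ × Fib E) (Fib E))
  have ha (w : JModel E) :
      α (mfderiv 𝓘(ℝ, JModel E) 𝓘(ℝ, JModel E) ψ.jetChart.symm y w) = a w := by
    rw [← sub_add_cancel α dL, ← hc]
    change c • jetClock E π v _ + dL _ = fderiv ℝ Λ y w + c * w.1.1
    rw [hdL, ψ.jetClock_mfderiv_jetChart_symm hy, add_comm]
    rfl
  have h := ψ.psi_coordinates hy α a ha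
  have h1 : a ∘L ContinuousLinearMap.inr ℝ (ℝ × Fib E) (Fib E) = momentum Λ y := by
    ext1 u
    simp [a, momentum]
  have h2 : a ∘L ContinuousLinearMap.inl ℝ (ℝ × Fib E) (Fib E) ∘L
      ContinuousLinearMap.inr ℝ ℝ (Fib E) = force Λ y := by
    ext1 u
    simp [a, force]
  rw [h1, h2] at h
  refine ⟨?_, h.2⟩
  have hx : ψ.chart.symm y.1 ∈ ψ.chart.source := ψ.chart.map_target hy
  exact ψ.dualChart.injOn hx hx (h.1.trans (ψ.dualChart_resLegendre hL hy).symm)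

theorem clock_tulczyjewInv_reducedDifferential (hL : ContMDiff 𝓘(ℝ, JModel E) 𝓘(ℝ, ℝ) ∞ L)
    {y : JModel E} (hy : y.1 ∈ ψ.chart.target) :
    clock (VModel E) (dualProj E π) _
      (tulczyjewInv (reducedDifferential L (ψ.jetChart.symm y))).2 = 1 := by
  rw [ψ.clock_dualProj, (ψ.tulczyjewInv_reducedDifferential hL hy).2]
  exact ψ.chart.map_target hy

section Hyperregular

variable (hL : ContMDiff 𝓘(ℝ, JModel E) 𝓘(ℝ, ℝ) ∞ L) (hreg : IsHyperregular L) {y : JModel E}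
  (hy : y.1 ∈ ψ.chart.target)

include hy in
theorem mdifferentiableAt_diffeo_jetChart_symm : MDifferentiableAt 𝓘(ℝ, JModel E) 𝓘(ℝ, VModel E)
    (hreg.diffeo ∘ ψ.jetChart.symm) y :=
  (hreg.diffeo.contMDiff.contMDiffAt.comp y (ψ.contMDiffAt_jetChart_symm hy)).mdifferentiableAt
    (by simp)

include hy in
theorem mfderiv_diffeo_jetChart_symm_surjective : Function.Surjective
    (mfderiv 𝓘(ℝ, JModel E) 𝓘(ℝ, VModel E) (hreg.diffeo ∘ ψ.jetChart.symm) y) := by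
  rw [mfderiv_comp y (hreg.diffeo.contMDiff.contMDiffAt.mdifferentiableAt (by simp))
    ((ψ.contMDiffAt_jetChart_symm hy).mdifferentiableAt (by simp))]
  exact (hreg.diffeo.mfderivToContinuousLinearEquiv (by simp) _).surjective.comp
    (ψ.mfderiv_jetChart_symm_bijective hy).2

include hL hy in
theorem mfderiv_dualChart_diffeo (w : JModel E) :
    (mfderiv 𝓘(ℝ, VModel E) 𝓘(ℝ, VModel E) ψ.dualChart (hreg.diffeo (ψ.jetChart.symm y))
      (mfderiv 𝓘(ℝ, JModel E) 𝓘(ℝ, VModel E) (hreg.diffeo ∘ ψ.jetChart.symm) y w) : VModel E) =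
      (w.1, fderiv ℝ (momentum (ψ.localLagrangian L)) y w) := by
  have hx : (hreg.diffeo (ψ.jetChart.symm y)).base ∈ ψ.chart.source := by
    rw [hreg.diffeo_apply]; exact ψ.chart.map_target hy
  have h1 := mfderiv_comp y ((ψ.contMDiffAt_dualChart hx).mdifferentiableAt (by simp))
    (ψ.mdifferentiableAt_diffeo_jetChart_symm hreg hy)
  have h2 : ψ.dualChart ∘ (hreg.diffeo ∘ ψ.jetChart.symm) =ᶠ[𝓝 y]
      fun z ↦ (z.1, momentum (ψ.localLagrangian L) z) := by
    have hc : ContinuousAt (fun z : JModel E ↦ z.1) y := continuousAt_fst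
    filter_upwards [hc.preimage_mem_nhds (ψ.chart.open_target.mem_nhds hy)] with z hz
    rw [Function.comp_apply, Function.comp_apply, hreg.diffeo_apply]
    exact ψ.dualChart_resLegendre hL hz
  have h3 : HasFDerivAt (fun z ↦ (z.1, momentum (ψ.localLagrangian L) z)) _ y :=
    hasFDerivAt_fst.prodMk (hasFDerivAt_momentum (ψ.contDiffAt_localLagrangian hL hy))
  have h4 := (h3.hasMFDerivAt.congr_of_eventuallyEq h2).mfderiv
  exact (congrArg (fun l ↦ l w) (h1.symm.trans h4) :)

include hL hy in
/-- The form `leg_L^*(h^*Ω_M)` on `J¹π` is the negative of the exterior derivative of the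
Poincaré–Cartan form, since `h ∘ leg_L = Leg_L`. -/
theorem pullbackForm_diffeo (w w' : JModel E) :
    pullbackForm (hamiltonianSection hreg) (hreg.diffeo (ψ.jetChart.symm y))
      (mfderiv 𝓘(ℝ, JModel E) 𝓘(ℝ, VModel E) (hreg.diffeo ∘ ψ.jetChart.symm) y w)
      (mfderiv 𝓘(ℝ, JModel E) 𝓘(ℝ, VModel E) (hreg.diffeo ∘ ψ.jetChart.symm) y w') =
      cartanForm (ψ.localLagrangian L) y w w' := by
  have hleg : MDifferentiableAt 𝓘(ℝ, JModel E) (cotModel E) (extLegendre L) (ψ.jetChart.symm y) :=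
    (contMDiff_extLegendre hL).contMDiffAt.mdifferentiableAt (by simp)
  have hh : MDifferentiableAt 𝓘(ℝ, VModel E) (cotModel E) (hamiltonianSection hreg)
      (hreg.diffeo (ψ.jetChart.symm y)) :=
    ((contMDiff_extLegendre hL).comp hreg.diffeo.symm.contMDiff).contMDiffAt.mdifferentiableAt
      (by simp)
  have h1 : hamiltonianSection hreg ∘ (hreg.diffeo ∘ ψ.jetChart.symm) =
      extLegendre L ∘ ψ.jetChart.symm := funext fun z ↦ hamiltonianSection_diffeo hreg _
  have h2 (u : JModel E) : (mfderiv 𝓘(ℝ, VModel E) (cotModel E) (hamiltonianSection hreg)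
      (hreg.diffeo (ψ.jetChart.symm y))
      (mfderiv 𝓘(ℝ, JModel E) 𝓘(ℝ, VModel E) (hreg.diffeo ∘ ψ.jetChart.symm) y u) :
        E × (E →L[ℝ] ℝ)) =
      mfderiv 𝓘(ℝ, JModel E) (cotModel E) (extLegendre L) (ψ.jetChart.symm y)
        (mfderiv 𝓘(ℝ, JModel E) 𝓘(ℝ, JModel E) ψ.jetChart.symm y u) := by
    have h3 := mfderiv_comp y hh (ψ.mdifferentiableAt_diffeo_jetChart_symm hreg hy)
    have h4 := mfderiv_comp y hleg ((ψ.contMDiffAt_jetChart_symm hy).mdifferentiableAt (by simp))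
    have h5 : (mfderiv 𝓘(ℝ, JModel E) (cotModel E)
        (hamiltonianSection hreg ∘ (hreg.diffeo ∘ ψ.jetChart.symm)) y u : E × (E →L[ℝ] ℝ)) =
        mfderiv 𝓘(ℝ, JModel E) (cotModel E) (extLegendre L ∘ ψ.jetChart.symm) y u :=
      congrArg (fun f : JModel E → Cotangent E M ↦
        (mfderiv 𝓘(ℝ, JModel E) (cotModel E) f y u : E × (E →L[ℝ] ℝ))) h1
    exact (congrArg (fun l ↦ l u) h3).symm.trans (h5.trans (congrArg (fun l ↦ l u) h4))
  have h6 := ψ.canonicalForm_mfderiv_extLegendre hL hy w w'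
  rw [← h6]
  refine (canonicalForm_apply _ _ _).trans (Eq.trans ?_ (canonicalForm_apply _ _ _).symm)
  rw [h2, h2]

include hL hy in
/-- The Reeb vector field in coordinates: at `(t, q; ∂L/∂q̇)` it is the vector `(1, q̇; ∂L/∂q)`. -/
theorem isReebAt_iff (R : TangentSpace 𝓘(ℝ, VModel E) (hreg.diffeo (ψ.jetChart.symm y))) :
    IsReebAt (hamiltonianSection hreg) (hreg.diffeo (ψ.jetChart.symm y)) R ↔
      (mfderiv 𝓘(ℝ, VModel E) 𝓘(ℝ, VModel E) ψ.dualChart (hreg.diffeo (ψ.jetChart.symm y)) R :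
        VModel E) = ((1, y.2), force (ψ.localLagrangian L) y) := by
  have hx : (hreg.diffeo (ψ.jetChart.symm y)).base ∈ ψ.chart.source := by
    rw [hreg.diffeo_apply]; exact ψ.chart.map_target hy
  have hsurj := ψ.mfderiv_diffeo_jetChart_symm_surjective hreg hy
  have hΛ : Function.Surjective fun w : JModel E ↦
      (w.1, fderiv ℝ (momentum (ψ.localLagrangian L)) y w) := by
    intro b
    obtain ⟨w, hw⟩ := ((ψ.mfderiv_dualChart_bijective hx).2.comp hsurj) b
    exact ⟨w, (ψ.mfderiv_dualChart_diffeo hL hreg hy w).symm.trans hw⟩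
  obtain ⟨(w : JModel E), rfl⟩ := hsurj R
  have h1 := cartanForm_eq_zero_iff (ψ.contDiffAt_localLagrangian hL hy) hΛ w
  have h2 := ψ.mfderiv_dualChart_diffeo hL hreg hy w
  rw [IsReebAt, ψ.clock_dualProj hx, h2]
  refine Iff.trans ?_ (h1.trans Prod.mk_inj.symm)
  refine and_congr_left' ⟨fun h w' ↦ ?_, fun h Y ↦ ?_⟩
  · rw [← ψ.pullbackForm_diffeo hL hreg hy]
    exact h _
  · obtain ⟨w', rfl⟩ := hsurj Y
    exact (ψ.pullbackForm_diffeo hL hreg hy w w').trans (h w')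

end Hyperregular

end FibredChart

/-- The Tulczyjew map sends the differential of `L` to the Reeb vector field along `leg_L`. -/
theorem tulczyjewInv_reducedDifferential_eq_reeb {L : Jet E π → ℝ}
    (hL : ContMDiff 𝓘(ℝ, JModel E) 𝓘(ℝ, ℝ) ∞ L) (hreg : IsHyperregular L) (v : Jet E π) :
    tulczyjewInv (reducedDifferential L v) =
      ⟨hreg.diffeo v, reeb (hamiltonianSection hreg) (hreg.diffeo v)⟩ := by
  obtain ⟨ψ, y, hy, rfl⟩ := exists_fibredChart_jet v
  obtain ⟨h1, h2⟩ := ψ.tulczyjewInv_reducedDifferential hL hy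
  rw [← hreg.diffeo_apply] at h1
  generalize tulczyjewInv (reducedDifferential L (ψ.jetChart.symm y)) = X at h1 h2
  obtain ⟨b, R⟩ := X
  obtain rfl : b = hreg.diffeo (ψ.jetChart.symm y) := h1
  have hx : (hreg.diffeo (ψ.jetChart.symm y)).base ∈ ψ.chart.source := by
    rw [hreg.diffeo_apply]; exact ψ.chart.map_target hy
  have hR := (ψ.isReebAt_iff hL hreg hy R).2 h2
  have h3 := (ψ.isReebAt_iff hL hreg hy _).1 (Classical.epsilon_spec ⟨R, hR⟩)
  have h4 : R = reeb (hamiltonianSection hreg) (hreg.diffeo (ψ.jetChart.symm y)) :=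
    (ψ.mfderiv_dualChart_bijective hx).1 (h2.trans h3.symm)
  rw [← h4]

theorem lagrangianSet_eq_hamiltonianSet {L : Jet E π → ℝ}
    (hL : ContMDiff 𝓘(ℝ, JModel E) 𝓘(ℝ, ℝ) ∞ L) (hreg : IsHyperregular L) :
    lagrangianSet L = hamiltonianSet (hamiltonianSection hreg) := by
  ext X
  constructor
  · rintro ⟨_, ⟨v, rfl⟩, hv⟩
    exact ⟨hreg.diffeo v, by rw [← hv, tulczyjewInv_reducedDifferential_eq_reeb hL hreg]⟩
  · rintro ⟨a, ha⟩
    refine ⟨_, ⟨hreg.diffeo.symm a, rfl⟩, ?_⟩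
    rw [tulczyjewInv_reducedDifferential_eq_reeb hL hreg, hreg.diffeo.apply_symm_apply, ha]

end ReebField

/-! ### The parametrization of `S_L` by `J¹π` -/

section DualJetCoordinates

variable {E : Type*} [NormedAddCommGroup E] [NormedSpace ℝ E]

theorem finrank_fib_dual : finrank ℝ (Fib E →L[ℝ] ℝ) = finrank ℝ E - 1 := by
  rw [← (LinearMap.toContinuousLinearMap (𝕜 := ℝ) (E := Fib E) (F' := ℝ)).finrank_eq,
    Module.finrank_linearMap, Module.finrank_self, Module.finrank_fin_fun, mul_one]

variable (E) in
/-- A linear isomorphism of the model of `V^*π` with the model `ℝ × ℝ²ⁿ` of a fibration over `ℝ`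
that respects the first coordinate `t`. -/
def dualModelEquiv : VModel E ≃L[ℝ] ℝ × Fib (VModel E) :=
  (ContinuousLinearEquiv.prodAssoc ℝ ℝ (Fib E) (Fib E →L[ℝ] ℝ)).trans
    ((ContinuousLinearEquiv.refl ℝ ℝ).prodCongr (ContinuousLinearEquiv.ofFinrankEq (by
      rw [Module.finrank_prod, finrank_fib_dual, Module.finrank_fin_fun, Module.finrank_fin_fun,
        Module.finrank_prod, Module.finrank_prod, finrank_fib_dual, Module.finrank_fin_fun,
        Module.finrank_self]
      omega)))

theorem dualModelEquiv_fst (u : VModel E) : (dualModelEquiv E u).1 = u.1.1 := rfl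

variable [FiniteDimensional ℝ E]
  {M : Type*} [TopologicalSpace M] [ChartedSpace E M] [IsManifold 𝓘(ℝ, E) ∞ M]
  {π : M → ℝ} [IsFibration E π]

namespace FibredChart

variable (ψ : FibredChart E π)

/-- The coordinates `(t, qⁱ, pᵢ)` as fibred coordinates for `π₁^* : V^*π → ℝ`. -/
def dualFibred : FibredChart (VModel E) (dualProj E π) where
  chart := ψ.dualChart.transHomeomorph (dualModelEquiv E).toHomeomorph
  contMDiffOn := (dualModelEquiv E).contDiff.contMDiff.comp_contMDiffOn
    (contMDiffOn_of_mem_maximalAtlas ψ.dualChart_mem_maximalAtlas)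
  contMDiffOn_symm := (contMDiffOn_symm_of_mem_maximalAtlas ψ.dualChart_mem_maximalAtlas).comp
    (dualModelEquiv E).symm.contDiff.contMDiff.contMDiffOn fun _ hy ↦ hy
  fst_eq a ha := ψ.fst_eq a.base ha

theorem dualFibred_d {a : VDual E π} (ha : a.base ∈ ψ.chart.source)
    (Z : TangentSpace 𝓘(ℝ, VModel E) a) : ψ.dualFibred.d a Z =
      dualModelEquiv E (mfderiv 𝓘(ℝ, VModel E) 𝓘(ℝ, VModel E) ψ.dualChart a Z : VModel E) := by
  have h1 := (ψ.contMDiffAt_dualChart ha).mdifferentiableAt (by simp)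
  have h2 := ((dualModelEquiv E).hasFDerivAt (x := ψ.dualChart a)).hasMFDerivAt.comp a
    h1.hasMFDerivAt
  exact congrArg (fun l ↦ l Z) h2.mfderiv

/-- The preferred chart of `V^*π` at a point is given by coordinates `(t, qⁱ, pᵢ)`. -/
theorem exists_chartAt_eq_dualChart (a : VDual E π) :
    ∃ ψ : FibredChart E π, a.base ∈ ψ.chart.source ∧ chartAt (VModel E) a = ψ.dualChart :=
  ⟨(exists_fibredChart (E := E) π a.base).choose,
    (exists_fibredChart (E := E) π a.base).choose_spec, rfl⟩

end FibredChart

/-- In the coordinates of `T(V^*π)`, the tangent spaces of `J¹π₁^*` are given by `δṫ = 0`. -/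
theorem mem_range_dIncl_dual_iff (X : DualJet E π) (b : VModel E × VModel E) :
    (∃ u, dIncl (VModel E) (dualProj E π) X u = b) ↔ b.2.1.1 = 0 := by
  obtain ⟨ψ, hψ, hc⟩ := FibredChart.exists_chartAt_eq_dualChart X.1.proj
  let Ψ := ψ.dualFibred
  obtain ⟨Y, hY, rfl⟩ : ∃ Y : JModel (VModel E), Y.1 ∈ Ψ.chart.target ∧ Ψ.jetChart.symm Y = X :=
    ⟨Ψ.jetChart X, Ψ.chart.map_source hψ, Ψ.jetChart.left_inv hψ⟩
  let A := dualModelEquiv E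
  let G := Ψ.toModel (Ψ.chart.symm Y.1)
  -- The coordinates `Ψ` differ from the preferred ones by a linear map, so that the second
  -- derivative of the change of coordinates vanishes.
  have hG : ∀ z ∈ Ψ.chart.target, G z = A.symm z := by
    intro z hz
    change chartAt (VModel E) (Ψ.jetChart.symm Y).1.proj (ψ.dualChart.symm (A.symm z)) = _
    rw [hc]
    exact ψ.dualChart.right_inv hz
  have hG1 : ∀ z ∈ Ψ.chart.target, fderiv ℝ G z = A.symm := by
    intro z hz
    have h : G =ᶠ[𝓝 z] A.symm := by
      filter_upwards [Ψ.chart.open_target.mem_nhds hz] with z' hz' using hG z' hz'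
    rw [h.fderiv_eq, A.symm.fderiv]
  have hG2 : fderiv ℝ (fderiv ℝ G) Y.1 = 0 := by
    have h : fderiv ℝ G =ᶠ[𝓝 Y.1] fun _ ↦ (A.symm : ℝ × Fib (VModel E) →L[ℝ] VModel E) := by
      filter_upwards [Ψ.chart.open_target.mem_nhds hY] with z' hz' using hG1 z' hz'
    rw [h.fderiv_eq, fderiv_const_apply]
  have key (w : JModel (VModel E)) : (dIncl (VModel E) (dualProj E π) (Ψ.jetChart.symm Y)
      (mfderiv 𝓘(ℝ, JModel (VModel E)) 𝓘(ℝ, JModel (VModel E)) Ψ.jetChart.symm Y w) :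
        VModel E × VModel E) = (A.symm w.1, A.symm (0, w.2)) := by
    rw [Ψ.dIncl_mfderiv_jetChart_symm hY, Ψ.fderiv_inclModel (Ψ.symm_mem_overlap hY)]
    change (fderiv ℝ G Y.1 w.1, fderiv ℝ (fderiv ℝ G) Y.1 w.1 (1, Y.2) +
      fderiv ℝ G Y.1 (0, w.2)) = _
    rw [hG1 _ hY, hG2]
    simp
  constructor
  · rintro ⟨u, hu⟩
    obtain ⟨(w : JModel (VModel E)), rfl⟩ := (Ψ.mfderiv_jetChart_symm_bijective hY).2 u
    have h := (key w).symm.trans hu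
    have h1 : A (A.symm (0, w.2)) = (0, w.2) := A.apply_symm_apply _
    rw [← h]
    exact (dualModelEquiv_fst (A.symm (0, w.2))).symm.trans (congrArg Prod.fst h1)
  · intro hb
    refine ⟨mfderiv 𝓘(ℝ, JModel (VModel E)) 𝓘(ℝ, JModel (VModel E)) Ψ.jetChart.symm Y
      ((A b.1, (A b.2).2) : JModel (VModel E)), (key _).trans (Prod.ext ?_ ?_)⟩
    · exact A.symm_apply_apply _
    · have h1 : ((0, (A b.2).2) : ℝ × Fib (VModel E)) = A b.2 := Prod.ext hb.symm rfl
      change A.symm (0, (A b.2).2) = b.2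
      rw [h1, A.symm_apply_apply]

variable {L : Jet E π → ℝ}

/-- The parametrization `v ↦ A_π⁻¹(dL(v))` of `S_L` by `J¹π`. -/
def lagrangianEmbedding (hL : ContMDiff 𝓘(ℝ, JModel E) 𝓘(ℝ, ℝ) ∞ L) (v : Jet E π) : DualJet E π :=
  ⟨tulczyjewInv (reducedDifferential L v), by
    obtain ⟨ψ, y, hy, rfl⟩ := exists_fibredChart_jet v
    exact ψ.clock_tulczyjewInv_reducedDifferential hL hy⟩

theorem range_lagrangianEmbedding (hL : ContMDiff 𝓘(ℝ, JModel E) 𝓘(ℝ, ℝ) ∞ L) :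
    range (lagrangianEmbedding hL) = lagrangianSet L := by
  ext X
  constructor
  · rintro ⟨v, rfl⟩
    exact ⟨_, ⟨v, rfl⟩, rfl⟩
  · rintro ⟨_, ⟨v, rfl⟩, hv⟩
    exact ⟨v, Subtype.ext hv⟩

theorem lagrangianEmbedding_proj (hL : ContMDiff 𝓘(ℝ, JModel E) 𝓘(ℝ, ℝ) ∞ L) (v : Jet E π) :
    (lagrangianEmbedding hL v).1.proj = resLegendre L v := by
  obtain ⟨ψ, y, hy, rfl⟩ := exists_fibredChart_jet v
  exact (ψ.tulczyjewInv_reducedDifferential hL hy).1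

theorem lagrangianEmbedding_proj_base (hL : ContMDiff 𝓘(ℝ, JModel E) 𝓘(ℝ, ℝ) ∞ L)
    (v : Jet E π) : (lagrangianEmbedding hL v).1.proj.base = v.1.proj := by
  rw [lagrangianEmbedding_proj]; rfl

theorem contMDiff_lagrangianEmbedding (hL : ContMDiff 𝓘(ℝ, JModel E) 𝓘(ℝ, ℝ) ∞ L) :
    ContMDiff 𝓘(ℝ, JModel E) 𝓘(ℝ, JModel (VModel E)) ∞ (lagrangianEmbedding hL) := by
  intro v
  obtain ⟨ψ, hψ⟩ := exists_fibredChart (E := E) π v.1.proj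
  let Ψ := ψ.dualFibred
  let A := dualModelEquiv E
  let Λ := ψ.localLagrangian L
  let g : JModel E → JModel (VModel E) := fun z ↦
    (A (z.1, momentum Λ z), (A ((1, z.2), force Λ z)).2)
  have hsrc (u : Jet E π) (hu : u.1.proj ∈ ψ.chart.source) :
      lagrangianEmbedding hL u ∈ Ψ.jetChart.source := by
    change (lagrangianEmbedding hL u).1.proj.base ∈ ψ.chart.source
    rwa [lagrangianEmbedding_proj_base]
  have key (u : Jet E π) (hu : u.1.proj ∈ ψ.chart.source) :
      Ψ.jetChart (lagrangianEmbedding hL u) = g (ψ.jetChart u) := by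
    obtain ⟨y, hy, rfl⟩ : ∃ y : JModel E, y.1 ∈ ψ.chart.target ∧ ψ.jetChart.symm y = u :=
      ⟨ψ.jetChart u, ψ.chart.map_source hu, ψ.jetChart.left_inv hu⟩
    rw [ψ.jetChart.right_inv hy]
    refine Prod.ext ?_ ?_
    · change A (ψ.dualChart (lagrangianEmbedding hL (ψ.jetChart.symm y)).1.proj) = _
      rw [lagrangianEmbedding_proj, ψ.dualChart_resLegendre hL hy]
    · change (Ψ.d (lagrangianEmbedding hL (ψ.jetChart.symm y)).1.proj
        (lagrangianEmbedding hL (ψ.jetChart.symm y)).1.2).2 = _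
      rw [ψ.dualFibred_d (hsrc _ hu)]
      exact congrArg (fun b ↦ (A b).2) (ψ.tulczyjewInv_reducedDifferential hL hy).2
  have hΛ : ContDiffAt ℝ ∞ Λ (ψ.jetChart v) :=
    ψ.contDiffAt_localLagrangian hL (ψ.chart.map_source hψ)
  refine contMDiffAt_of_factor (g := g) (ψ.contMDiffAt_jetChart hψ) ?_
    (Ψ.contMDiffAt_jetChart_symm ?_) ?_
  · exact (A.contDiff.contDiffAt.comp _ (contDiffAt_fst.prodMk (contDiffAt_momentum hΛ))).prodMk
      (contDiffAt_snd.comp _ (A.contDiff.contDiffAt.comp _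
        ((contDiffAt_const.prodMk contDiffAt_snd).prodMk (contDiffAt_force hΛ))))
  · rw [← key v hψ]
    exact Ψ.jetChart.map_source (hsrc v hψ)
  · filter_upwards [ψ.jetChart.open_source.mem_nhds hψ] with u hu
    rw [← key u hu, Ψ.jetChart.left_inv (hsrc u hu)]

/-- The tangent map of the parametrization of `S_L` in coordinates. -/
theorem FibredChart.dIncl_mfderiv_lagrangianEmbedding (ψ : FibredChart E π)
    (hL : ContMDiff 𝓘(ℝ, JModel E) 𝓘(ℝ, ℝ) ∞ L)
    {y : JModel E} (hy : y.1 ∈ ψ.chart.target)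
    (hc : chartAt (VModel E) (lagrangianEmbedding hL (ψ.jetChart.symm y)).1.proj = ψ.dualChart)
    (w : JModel E) :
    (dIncl (VModel E) (dualProj E π) (lagrangianEmbedding hL (ψ.jetChart.symm y))
      (mfderiv 𝓘(ℝ, JModel E) 𝓘(ℝ, JModel (VModel E)) (lagrangianEmbedding hL)
        (ψ.jetChart.symm y)
        (mfderiv 𝓘(ℝ, JModel E) 𝓘(ℝ, JModel E) ψ.jetChart.symm y w)) : VModel E × VModel E) =
      ((w.1, fderiv ℝ (momentum (ψ.localLagrangian L)) y w),
        ((0, w.2), fderiv ℝ (force (ψ.localLagrangian L)) y w)) := by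
  let Λ := ψ.localLagrangian L
  have hΛ : ContDiffAt ℝ ∞ Λ y := ψ.contDiffAt_localLagrangian hL hy
  let S : JModel E → VModel E × VModel E := fun z ↦ ((z.1, momentum Λ z), ((1, z.2), force Λ z))
  have hS : HasFDerivAt S _ y :=
    (hasFDerivAt_fst.prodMk (hasFDerivAt_momentum hΛ)).prodMk
      (((hasFDerivAt_const (1 : ℝ) y).prodMk hasFDerivAt_snd).prodMk (hasFDerivAt_force hΛ))
  have h1 : MDifferentiableAt 𝓘(ℝ, JModel (VModel E)) 𝓘(ℝ, VModel E).tangent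
      (fun X : DualJet E π ↦ X.1) (lagrangianEmbedding hL (ψ.jetChart.symm y)) :=
    contMDiff_jet_incl.contMDiffAt.mdifferentiableAt (by simp)
  have h2 : MDifferentiableAt 𝓘(ℝ, JModel E) 𝓘(ℝ, JModel (VModel E)) (lagrangianEmbedding hL)
      (ψ.jetChart.symm y) :=
    (contMDiff_lagrangianEmbedding hL).contMDiffAt.mdifferentiableAt (by simp)
  have h3 := (ψ.contMDiffAt_jetChart_symm hy).mdifferentiableAt (by simp)
  have h4 := mfderiv_comp y h2 h3
  have h5 := mfderiv_comp y h1 (h2.comp y h3)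
  have heq : ∀ᶠ z in 𝓝 y, extChartAt 𝓘(ℝ, VModel E).tangent
      (lagrangianEmbedding hL (ψ.jetChart.symm y)).1
      (lagrangianEmbedding hL (ψ.jetChart.symm z)).1 = S z := by
    have hfc : ContinuousAt (fun z : JModel E ↦ z.1) y := continuousAt_fst
    filter_upwards [hfc.preimage_mem_nhds (ψ.chart.open_target.mem_nhds hy)] with z hz
    have hz' : (lagrangianEmbedding hL (ψ.jetChart.symm z)).1.proj ∈
        (chartAt (VModel E) (lagrangianEmbedding hL (ψ.jetChart.symm y)).1.proj).source := by
      rw [hc]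
      change (lagrangianEmbedding hL (ψ.jetChart.symm z)).1.proj.base ∈ ψ.chart.source
      rw [lagrangianEmbedding_proj_base]
      exact ψ.chart.map_target hz
    rw [extChartAt_tangentBundle_apply _ _ hz', hc]
    refine Prod.ext ?_ (ψ.tulczyjewInv_reducedDifferential hL hz).2
    change ψ.dualChart _ = _
    rw [lagrangianEmbedding_proj, ψ.dualChart_resLegendre hL hz]
  have h6 := mfderiv_of_source_normedSpace (h1.comp y (h2.comp y h3)) hS heq w
  refine Eq.trans ?_ (h6.trans ?_)
  · refine Eq.trans ?_ (congrArg (fun l ↦ l w) h5).symm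
    exact congrArg (dIncl (VModel E) (dualProj E π) (lagrangianEmbedding hL (ψ.jetChart.symm y)))
      (congrArg (fun l ↦ l w) h4).symm
  · rfl

end DualJetCoordinates

/-! ### Symmetric subspaces and the Lagrangian condition -/

section LinearPoisson

variable (E : Type*) [NormedAddCommGroup E] [NormedSpace ℝ E]

/-- The bivector `∑ ∂/∂qⁱ ∧ ∂/∂pᵢ` on the model of `V^*π`. -/
def canonicalBivector : LinearMap.BilinForm ℝ (Dual ℝ (VModel E)) :=
  ∑ i, ((Dual.eval ℝ (VModel E) (dq E i)).smulRight (Dual.eval ℝ (VModel E) (dp E i)) -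
    (Dual.eval ℝ (VModel E) (dp E i)).smulRight (Dual.eval ℝ (VModel E) (dq E i)))

/-- The complete lift of `canonicalBivector` to the model of `T(V^*π)`. -/
def canonicalLift : LinearMap.BilinForm ℝ (Dual ℝ (VModel E × VModel E)) :=
  (canonicalBivector E).compl₁₂ (LinearMap.inl ℝ (VModel E) (VModel E)).dualMap
      (LinearMap.inr ℝ (VModel E) (VModel E)).dualMap +
    (canonicalBivector E).compl₁₂ (LinearMap.inr ℝ (VModel E) (VModel E)).dualMap
      (LinearMap.inl ℝ (VModel E) (VModel E)).dualMap

variable {E}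

/-- The Hamiltonian vector of a covector for `canonicalBivector`. -/
def hamVec (α : Dual ℝ (VModel E)) : VModel E :=
  ∑ i, (α (dq E i) • dp E i - α (dp E i) • dq E i)

theorem apply_hamVec (α β : Dual ℝ (VModel E)) : β (hamVec α) = canonicalBivector E α β := by
  simp [hamVec, canonicalBivector, LinearMap.sum_apply]

theorem hamVec_fst_fst (α : Dual ℝ (VModel E)) : (hamVec α).1.1 = 0 := by
  simp [hamVec, Prod.fst_sum, dq, dp]

theorem hamVec_fst_snd (α : Dual ℝ (VModel E)) (i : Fin (finrank ℝ E - 1)) :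
    (hamVec α).1.2 i = -α (dp E i) := by
  simp [hamVec, Prod.fst_sum, Prod.snd_sum, dq, dp, Finset.sum_apply, Pi.single_apply]

theorem hamVec_snd_single (α : Dual ℝ (VModel E)) (i : Fin (finrank ℝ E - 1)) :
    (hamVec α).2 (Pi.single i 1) = α (dq E i) := by
  simp [hamVec, Prod.snd_sum, dq, dp, Pi.single_apply]

theorem form_apply_eq_sum (p : Fib E →L[ℝ] ℝ) (u : Fib E) :
    p u = ∑ i, u i * p (Pi.single i 1) := by
  conv_lhs => rw [pi_eq_sum_univ' u, map_sum]
  exact Finset.sum_congr rfl fun i _ ↦ by rw [map_smul, smul_eq_mul]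

theorem eq_sum_dq_add_dp {v : VModel E} (hv : v.1.1 = 0) :
    v = ∑ i, (v.1.2 i • dq E i + v.2 (Pi.single i 1) • dp E i) := by
  refine Prod.ext (Prod.ext ?_ ?_) (ContinuousLinearMap.ext fun u ↦ ?_)
  · simp [Prod.fst_sum, dq, dp, hv]
  · ext j
    simp [Prod.fst_sum, Prod.snd_sum, dq, dp, Finset.sum_apply, Pi.single_apply]
  · rw [form_apply_eq_sum]
    simp [Prod.snd_sum, dq, dp, mul_comm]

/-- The canonical `2`-form `∑ dpᵢ ∧ dqⁱ` inverts the bivector on the vectors without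
`t`-component. -/
theorem apply_eq_hamVec {v : VModel E} (hv : v.1.1 = 0) (α : Dual ℝ (VModel E)) :
    α v = (hamVec α).2 v.1.2 - v.2 (hamVec α).1.2 := by
  conv_lhs => rw [eq_sum_dq_add_dp hv, map_sum]
  rw [form_apply_eq_sum, form_apply_eq_sum v.2, ← Finset.sum_sub_distrib]
  refine Finset.sum_congr rfl fun i _ ↦ ?_
  rw [hamVec_fst_snd, hamVec_snd_single, map_add, map_smul, map_smul, smul_eq_mul, smul_eq_mul]
  ring

theorem exists_hamVec_eq {u : VModel E} (hu : u.1.1 = 0) :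
    ∃ α : Dual ℝ (VModel E), hamVec α = u := by
  let α : Dual ℝ (VModel E) :=
    u.2.toLinearMap ∘ₗ LinearMap.snd ℝ ℝ (Fib E) ∘ₗ LinearMap.fst ℝ _ _ -
      (ContinuousLinearMap.apply ℝ ℝ u.1.2).toLinearMap ∘ₗ LinearMap.snd ℝ _ _
  refine ⟨α, Prod.ext (Prod.ext ?_ ?_) (ContinuousLinearMap.ext fun z ↦ ?_)⟩
  · rw [hamVec_fst_fst, hu]
  · ext i
    rw [hamVec_fst_snd]
    simp [α, dp]
  · rw [form_apply_eq_sum, form_apply_eq_sum u.2]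
    refine Finset.sum_congr rfl fun i _ ↦ ?_
    rw [hamVec_snd_single]
    simp [α, dq]

/-- The Hamiltonian vector of a covector for `canonicalLift`. -/
def hamVecLift (κ : Dual ℝ (VModel E × VModel E)) : VModel E × VModel E :=
  (hamVec (κ ∘ₗ LinearMap.inr ℝ _ _), hamVec (κ ∘ₗ LinearMap.inl ℝ _ _))

theorem canonicalLift_apply (κ κ' : Dual ℝ (VModel E × VModel E)) : canonicalLift E κ κ' =
    κ' (hamVecLift κ) := by
  have h : hamVecLift κ = LinearMap.inl ℝ _ _ (hamVecLift κ).1 +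
      LinearMap.inr ℝ _ _ (hamVecLift κ).2 := by simp
  rw [h, map_add]
  refine Eq.trans ?_ (add_comm _ _)
  exact congrArg₂ (· + ·) (apply_hamVec _ (κ' ∘ₗ LinearMap.inr ℝ _ _)).symm
    (apply_hamVec _ (κ' ∘ₗ LinearMap.inl ℝ _ _)).symm

theorem exists_hamVecLift_eq {b : VModel E × VModel E} (h1 : b.1.1.1 = 0) (h2 : b.2.1.1 = 0) :
    ∃ κ, hamVecLift κ = b := by
  obtain ⟨α, hα⟩ := exists_hamVec_eq h1
  obtain ⟨β, hβ⟩ := exists_hamVec_eq h2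
  refine ⟨LinearMap.coprod β α, Prod.ext ?_ ?_⟩
  · rw [hamVecLift, LinearMap.coprod_inr, hα]
  · rw [hamVecLift, LinearMap.coprod_inl, hβ]

theorem apply_eq_hamVecLift {b : VModel E × VModel E} (h1 : b.1.1.1 = 0) (h2 : b.2.1.1 = 0)
    (κ : Dual ℝ (VModel E × VModel E)) : κ b =
      (hamVecLift κ).2.2 b.1.1.2 - b.1.2 (hamVecLift κ).2.1.2 +
        ((hamVecLift κ).1.2 b.2.1.2 - b.2.2 (hamVecLift κ).1.1.2) := by
  have h : b = LinearMap.inl ℝ _ _ b.1 + LinearMap.inr ℝ _ _ b.2 := by simp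
  conv_lhs => rw [h, map_add]
  exact congrArg₂ (· + ·) (apply_eq_hamVec h1 (κ ∘ₗ LinearMap.inl ℝ _ _))
    (apply_eq_hamVec h2 (κ ∘ₗ LinearMap.inr ℝ _ _))

variable {W : Type*} [AddCommGroup W] [Module ℝ W] {ι : W →ₗ[ℝ] VModel E × VModel E}
  {r : VModel E × VModel E →ₗ[ℝ] W} (hr : ∀ u, r (ι u) = u)
  (hι : ∀ b, (∃ u, ι u = b) ↔ b.2.1.1 = 0) [FiniteDimensional ℝ W]

/-- The map `Λ^♯` for the restriction of the complete lift along the inclusion `ι` of a subspace,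
by means of a left inverse `r` of `ι`. -/
theorem sharp_compl_eq (α : Dual ℝ W) :
    (evalEquiv ℝ W).symm ((canonicalLift E).compl₁₂ r.dualMap r.dualMap α) =
      r (hamVecLift (α ∘ₗ r)) := by
  rw [LinearEquiv.symm_apply_eq]
  ext β
  exact canonicalLift_apply (α ∘ₗ r) (β ∘ₗ r)

include hr hι

/-- The complete lift is tangent to `J¹π₁^*`: its Hamiltonian vectors satisfy `δṫ = 0`. -/
theorem incl_sharp_compl (α : Dual ℝ W) :
    ι ((evalEquiv ℝ W).symm ((canonicalLift E).compl₁₂ r.dualMap r.dualMap α)) =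
      hamVecLift (α ∘ₗ r) := by
  obtain ⟨u, hu⟩ := (hι (hamVecLift (α ∘ₗ r))).2 (hamVec_fst_fst _)
  rw [sharp_compl_eq, ← hu, hr]

theorem mem_range_sharp_compl_iff (u : W) :
    u ∈ ((evalEquiv ℝ W).symm.toLinearMap ∘ₗ
      (canonicalLift E).compl₁₂ r.dualMap r.dualMap).range ↔ (ι u).1.1.1 = 0 := by
  constructor
  · rintro ⟨α, rfl⟩
    exact (congrArg (fun b ↦ b.1.1.1) (incl_sharp_compl hr hι α)).trans (hamVec_fst_fst _)
  · intro hu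
    obtain ⟨κ, hκ⟩ := exists_hamVecLift_eq hu ((hι _).1 ⟨u, rfl⟩)
    refine ⟨κ ∘ₗ ι, ?_⟩
    -- The Hamiltonian vector of `κ` only involves the values of `κ` on the range of `ι`.
    have hrange (v : VModel E × VModel E) (h1 : v.1.1.1 = 0) (h2 : v.2.1.1 = 0) :
        κ (ι (r v)) = κ v := by
      obtain ⟨u', rfl⟩ := (hι v).2 h2
      rw [hr]
    have h1 : hamVecLift ((κ ∘ₗ ι) ∘ₗ r) = hamVecLift κ := by
      refine congrArg₂ Prod.mk (Finset.sum_congr rfl fun i _ ↦ ?_)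
        (Finset.sum_congr rfl fun i _ ↦ ?_)
      · have h2 := hrange (0, dq E i) rfl rfl
        have h3 := hrange (0, dp E i) rfl rfl
        exact congrArg₂ (fun a b ↦ a • dp E i - b • dq E i) h2 h3
      · have h2 := hrange (dq E i, 0) rfl rfl
        have h3 := hrange (dp E i, 0) rfl rfl
        exact congrArg₂ (fun a b ↦ a • dp E i - b • dq E i) h2 h3
    have h2 := (sharp_compl_eq (r := r) (κ ∘ₗ ι)).trans (congrArg r (h1.trans hκ))
    exact h2.trans (hr u)

variable {τ : JModel E →ₗ[ℝ] W} {P Q : JModel E → (Fib E →L[ℝ] ℝ)}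
  (hτ : ∀ w, ι (τ w) = ((w.1, P w), ((0, w.2), Q w)))

theorem finrank_range_sharp_compl :
    finrank ℝ ((evalEquiv ℝ W).symm.toLinearMap ∘ₗ
      (canonicalLift E).compl₁₂ r.dualMap r.dualMap).range = 4 * (finrank ℝ E - 1) := by
  have hinj : Function.Injective ι := Function.LeftInverse.injective hr
  let k : (Fib E × (Fib E →L[ℝ] ℝ)) →ₗ[ℝ] VModel E :=
    LinearMap.prodMap (LinearMap.inr ℝ ℝ (Fib E)) LinearMap.id
  let j := LinearMap.prodMap k k
  have hj : Function.Injective j := by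
    intro a b h
    simp only [j, k, LinearMap.prodMap_apply, LinearMap.inr_apply, LinearMap.id_apply,
      Prod.mk.injEq] at h
    exact Prod.ext (Prod.ext h.1.1.2 h.1.2) (Prod.ext h.2.1.2 h.2.2)
  have h : (((evalEquiv ℝ W).symm.toLinearMap ∘ₗ
      (canonicalLift E).compl₁₂ r.dualMap r.dualMap).range).map ι = j.range := by
    ext b
    constructor
    · rintro ⟨u, hu, rfl⟩
      have h1 := (mem_range_sharp_compl_iff hr hι u).1 hu
      have h2 := (hι _).1 ⟨u, rfl⟩
      exact ⟨(((ι u).1.1.2, (ι u).1.2), ((ι u).2.1.2, (ι u).2.2)),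
        Prod.ext (Prod.ext (Prod.ext h1.symm rfl) rfl) (Prod.ext (Prod.ext h2.symm rfl) rfl)⟩
    · rintro ⟨c, rfl⟩
      obtain ⟨u, hu⟩ := (hι (j c)).2 rfl
      exact ⟨u, (mem_range_sharp_compl_iff hr hι u).2 (by rw [hu]; rfl), hu⟩
  rw [(Submodule.equivMapOfInjective ι hinj _).finrank_eq, h, LinearMap.finrank_range_of_inj hj]
  simp only [Module.finrank_prod, finrank_fib_dual, Module.finrank_fin_fun]
  ring

include hτ in
theorem isotropic_of_symm
    (hs : ∀ w w' : JModel E, w.1.1 = 0 → w'.1.1 = 0 →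
      P w w'.2 + Q w w'.1.2 = P w' w.2 + Q w' w.1.2) (α β : Dual ℝ W)
    (hα : (evalEquiv ℝ W).symm ((canonicalLift E).compl₁₂ r.dualMap r.dualMap α) ∈ τ.range)
    (hβ : (evalEquiv ℝ W).symm ((canonicalLift E).compl₁₂ r.dualMap r.dualMap β) ∈ τ.range) :
    (canonicalLift E).compl₁₂ r.dualMap r.dualMap α β = 0 := by
  obtain ⟨w, hw⟩ := hα
  obtain ⟨w', hw'⟩ := hβ
  have h1 := (congrArg ι hw).trans (incl_sharp_compl hr hι α)
  have h2 := (congrArg ι hw').trans (incl_sharp_compl hr hι β)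
  rw [hτ] at h1 h2
  have h3 : w.1.1 = 0 := (congrArg (fun b ↦ b.1.1.1) h1).trans (hamVec_fst_fst _)
  have h4 : w'.1.1 = 0 := (congrArg (fun b ↦ b.1.1.1) h2).trans (hamVec_fst_fst _)
  refine (canonicalLift_apply (α ∘ₗ r) (β ∘ₗ r)).trans ?_
  rw [← h1, apply_eq_hamVecLift h3 rfl, ← h2]
  simp only
  linarith [hs w w' h3 h4]

include hτ in
theorem finrank_range_inf :
    finrank ℝ ↥(τ.range ⊓ ((evalEquiv ℝ W).symm.toLinearMap ∘ₗ
      (canonicalLift E).compl₁₂ r.dualMap r.dualMap).range) = 2 * (finrank ℝ E - 1) := by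
  let k : (Fib E × Fib E) →ₗ[ℝ] JModel E :=
    LinearMap.prodMap (LinearMap.inr ℝ ℝ (Fib E)) LinearMap.id
  have hk : Function.Injective (τ ∘ₗ k) := by
    intro a b h
    have h1 := (hτ (k a)).symm.trans ((congrArg ι h).trans (hτ (k b)))
    exact Prod.ext (congrArg (fun b ↦ b.1.1.2) h1) (congrArg (fun b ↦ b.2.1.2) h1)
  have h : τ.range ⊓ ((evalEquiv ℝ W).symm.toLinearMap ∘ₗ
      (canonicalLift E).compl₁₂ r.dualMap r.dualMap).range = (τ ∘ₗ k).range := by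
    ext u
    rw [Submodule.mem_inf, mem_range_sharp_compl_iff hr hι]
    constructor
    · rintro ⟨⟨w, rfl⟩, hw⟩
      rw [hτ] at hw
      exact ⟨(w.1.2, w.2), congrArg τ (Prod.ext (Prod.ext hw.symm rfl) rfl)⟩
    · rintro ⟨z, rfl⟩
      exact ⟨⟨k z, rfl⟩, by rw [LinearMap.comp_apply, hτ]; rfl⟩
  rw [h, LinearMap.finrank_range_of_inj hk, Module.finrank_prod, Module.finrank_fin_fun]
  ring

/-- A subspace parametrized by a symmetric matrix is Lagrangian. -/
theorem isotropic_and_finrank_of_symm {T : Submodule ℝ W}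
    (hT : ∃ (τ : JModel E →ₗ[ℝ] W) (P Q : JModel E → (Fib E →L[ℝ] ℝ)), T = τ.range ∧
      (∀ w, ι (τ w) = ((w.1, P w), ((0, w.2), Q w))) ∧
      ∀ w w' : JModel E, w.1.1 = 0 → w'.1.1 = 0 →
        P w w'.2 + Q w w'.1.2 = P w' w.2 + Q w' w.1.2) :
    (∀ α β, (evalEquiv ℝ W).symm ((canonicalLift E).compl₁₂ r.dualMap r.dualMap α) ∈ T →
      (evalEquiv ℝ W).symm ((canonicalLift E).compl₁₂ r.dualMap r.dualMap β) ∈ T →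
      (canonicalLift E).compl₁₂ r.dualMap r.dualMap α β = 0) ∧
    2 * finrank ℝ ↥(T ⊓ ((evalEquiv ℝ W).symm.toLinearMap ∘ₗ
      (canonicalLift E).compl₁₂ r.dualMap r.dualMap).range) =
      finrank ℝ ((evalEquiv ℝ W).symm.toLinearMap ∘ₗ
        (canonicalLift E).compl₁₂ r.dualMap r.dualMap).range := by
  obtain ⟨τ, P, Q, rfl, hτ, hs⟩ := hT
  refine ⟨isotropic_of_symm hr hι hτ hs, ?_⟩
  rw [finrank_range_inf hr hι hτ, finrank_range_sharp_compl hr hι]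
  ring

end LinearPoisson

section Lagrangian

variable {E : Type*} [NormedAddCommGroup E] [NormedSpace ℝ E] [FiniteDimensional ℝ E]
  {M : Type*} [TopologicalSpace M] [ChartedSpace E M] [IsManifold 𝓘(ℝ, E) ∞ M]
  {π : M → ℝ} [IsFibration E π] {L : Jet E π → ℝ}

/-- The set `S_L` is the image of a section of `J¹π₁^* → V^*π`, since its parametrization by `J¹π`
covers `leg_L`. -/
theorem isEmbeddedSubmanifold_lagrangianSet (hL : ContMDiff 𝓘(ℝ, JModel E) 𝓘(ℝ, ℝ) ∞ L)
    (hreg : IsHyperregular L) :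
    IsEmbeddedSubmanifold (JModel (VModel E)) (lagrangianSet L) := by
  have h := isEmbeddedSubmanifold_range_section
    (s := fun a : VDual E π ↦ lagrangianEmbedding hL (hreg.diffeo.symm a))
    ((contMDiff_lagrangianEmbedding hL).comp hreg.diffeo.symm.contMDiff) fun a ↦ by
      rw [lagrangianEmbedding_proj, ← hreg.diffeo_apply, hreg.diffeo.apply_symm_apply]
  rw [← range_lagrangianEmbedding hL]
  rwa [show (fun a : VDual E π ↦ lagrangianEmbedding hL (hreg.diffeo.symm a)) =
    lagrangianEmbedding hL ∘ hreg.diffeo.symm from rfl,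
    (show Function.Surjective hreg.diffeo.symm from hreg.diffeo.symm.surjective).range_comp] at h

theorem tangentOf_lagrangianSet (hL : ContMDiff 𝓘(ℝ, JModel E) 𝓘(ℝ, ℝ) ∞ L)
    (hreg : IsHyperregular L) (v : Jet E π) :
    tangentOf (lagrangianSet L) (lagrangianEmbedding hL v) =
      (mfderiv 𝓘(ℝ, JModel E) 𝓘(ℝ, JModel (VModel E)) (lagrangianEmbedding hL) v).range := by
  rw [← range_lagrangianEmbedding hL]
  refine tangentOf_range (r := fun X ↦ hreg.diffeo.symm X.1.proj)
    (contMDiff_lagrangianEmbedding hL) (ContMDiff.comp (g := hreg.diffeo.symm)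
      (f := fun X : DualJet E π ↦ X.1.proj) hreg.diffeo.symm.contMDiff contMDiff_jet_proj)
    (fun u ↦ ?_) v
  refine (congrArg hreg.diffeo.symm (lagrangianEmbedding_proj hL u)).trans ?_
  rw [← hreg.diffeo_apply, hreg.diffeo.symm_apply_apply]

theorem exists_fibredChart_lagrangianEmbedding (hL : ContMDiff 𝓘(ℝ, JModel E) 𝓘(ℝ, ℝ) ∞ L)
    (v : Jet E π) : ∃ (ψ : FibredChart E π) (y : JModel E), y.1 ∈ ψ.chart.target ∧
      ψ.jetChart.symm y = v ∧
      chartAt (VModel E) (lagrangianEmbedding hL v).1.proj = ψ.dualChart := by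
  obtain ⟨ψ, hψ, hc⟩ :=
    FibredChart.exists_chartAt_eq_dualChart (lagrangianEmbedding hL v).1.proj
  have hv : v.1.proj ∈ ψ.chart.source := (lagrangianEmbedding_proj_base hL v) ▸ hψ
  exact ⟨ψ, ψ.jetChart v, ψ.chart.map_source hv, ψ.jetChart.left_inv hv, hc⟩

/-- The tangent spaces of `S_L` in the coordinates of `T(V^*π)`: the maps `P` and `Q` are rows of
the second derivative of the Lagrangian in coordinates, and the last statement is its symmetry. -/
theorem exists_tangentOf_lagrangianSet_eq_range (hL : ContMDiff 𝓘(ℝ, JModel E) 𝓘(ℝ, ℝ) ∞ L)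
    (hreg : IsHyperregular L) : ∀ X ∈ range (lagrangianEmbedding hL),
    ∃ (τ : JModel E →ₗ[ℝ] TangentSpace 𝓘(ℝ, JModel (VModel E)) X)
      (P Q : JModel E → (Fib E →L[ℝ] ℝ)), tangentOf (lagrangianSet L) X = τ.range ∧
      (∀ w, (dIncl (VModel E) (dualProj E π) X (τ w) :
        VModel E × VModel E) = ((w.1, P w), ((0, w.2), Q w))) ∧
      ∀ w w' : JModel E, w.1.1 = 0 → w'.1.1 = 0 →
        P w w'.2 + Q w w'.1.2 = P w' w.2 + Q w' w.1.2 := by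
  refine forall_mem_range.2 fun v ↦ ?_
  obtain ⟨ψ, y, hy, rfl, hc⟩ := exists_fibredChart_lagrangianEmbedding hL v
  let Λ := ψ.localLagrangian L
  have hΛ : ContDiffAt ℝ ∞ Λ y := ψ.contDiffAt_localLagrangian hL hy
  let dσ := mfderiv 𝓘(ℝ, JModel E) 𝓘(ℝ, JModel (VModel E)) (lagrangianEmbedding hL)
    (ψ.jetChart.symm y)
  let dJ := mfderiv 𝓘(ℝ, JModel E) 𝓘(ℝ, JModel E) ψ.jetChart.symm y
  refine ⟨dσ.toLinearMap ∘ₗ dJ.toLinearMap, fderiv ℝ (momentum Λ) y, fderiv ℝ (force Λ) y, ?_,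
    ψ.dIncl_mfderiv_lagrangianEmbedding hL hy hc, fun w w' h h' ↦ ?_⟩
  · exact (tangentOf_lagrangianSet hL hreg _).trans (LinearMap.range_comp_of_range_eq_top _
      (LinearMap.range_eq_top.2 (ψ.mfderiv_jetChart_symm_bijective hy).2)).symm
  · have key (u u' : JModel E) (hu : u'.1.1 = 0) : fderiv ℝ (momentum Λ) y u u'.2 +
        fderiv ℝ (force Λ) y u u'.1.2 = fderiv ℝ (fderiv ℝ Λ) y u u' := by
      rw [fderiv_momentum_apply hΛ, fderiv_force_apply hΛ, ← map_add]
      refine congrArg _ (Prod.ext (Prod.ext ?_ ?_) ?_) <;> simp [hu]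
    rw [key w w' h', key w' w h]
    exact (hΛ.isSymmSndFDerivAt (by simp [ENat.LEInfty.out])).eq w w'

theorem isLagrangian_lagrangianSet (hL : ContMDiff 𝓘(ℝ, JModel E) 𝓘(ℝ, ℝ) ∞ L)
    (hreg : IsHyperregular L) : IsLagrangian (dualJetPoisson E π) (lagrangianSet L) := by
  refine ⟨isEmbeddedSubmanifold_lagrangianSet hL hreg, fun X hX ↦ ?_⟩
  have hr : ∀ u, (dIncl (VModel E) (dualProj E π) X).toLinearMap.leftInverse
      ((dIncl (VModel E) (dualProj E π) X).toLinearMap u) = u :=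
    LinearMap.leftInverse_apply_of_inj (LinearMap.ker_eq_bot.2 (dIncl_injective X))
  -- `Λ` at `X` is by definition the restriction of `canonicalLift` along the left inverse of `dIncl`.
  exact isotropic_and_finrank_of_symm hr (mem_range_dIncl_dual_iff X)
    (exists_tangentOf_lagrangianSet_eq_range hL hreg X
      ((range_lagrangianEmbedding hL).symm ▸ hX))

end Lagrangian

end TimeMech

end

theorem mainTheorem5 {E : Type*} [NormedAddCommGroup E] [NormedSpace ℝ E] [FiniteDimensional ℝ E]
    {M : Type*} [TopologicalSpace M] [T2Space M] [SecondCountableTopology M]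
    [ChartedSpace E M] [IsManifold 𝓘(ℝ, E) ∞ M]
    (π : M → ℝ) [TimeMech.IsFibration E π]
    (L : TimeMech.Jet E π → ℝ)
    (hL : ContMDiff 𝓘(ℝ, TimeMech.JModel E) 𝓘(ℝ, ℝ) ∞ L)
    (hreg : TimeMech.IsHyperregular L) :
    TimeMech.IsLagrangian (TimeMech.dualJetPoisson E π) (TimeMech.lagrangianSet L) ∧
    TimeMech.IsLagrangian (TimeMech.dualJetPoisson E π)
      (TimeMech.hamiltonianSet (TimeMech.hamiltonianSection hreg)) ∧
    TimeMech.lagrangianSet L =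
      TimeMech.hamiltonianSet (TimeMech.hamiltonianSection hreg) :=
  TimeMech.lagrangianSet_eq_hamiltonianSet hL hreg ▸
    ⟨TimeMech.isLagrangian_lagrangianSet hL hreg, TimeMech.isLagrangian_lagrangianSet hL hreg, rfl⟩
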